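/- Let $G$ be a compact, connected, simply connected, simple Lie group with maximal torus $T$, $\mathfrak t=\mathrm{Lie}(T)$, given by its (reduced, irreducible, crystallographic) root system. Let $\Pi=\ker(\exp\colon\mathfrak t\to T)$, which is the coroot lattice, $\Pi^*=\mathrm{Hom}(\Pi,\mathbb Z)=\mathrm{Hom}(T,U(1))$ the weight lattice (the character of $T$ given by $\xi$ is written $t\mapsto t^\xi$), and $T^\vee=\mathrm{Hom}(\Pi,U(1))$. Let $B$ be the basic inner product (invariant, with short coroots of squared length $2$). It is integral on $\Pi$ and gives an embedding $B^\flat\colon\Pi\to\Pi^*$, by which $\Pi$ is regarded as a sublattice of $\Pi^*$. Put $\kappa_\eta(t)=t^{-B^\flat(\eta)}$. For a lattice basis $\beta_1,\dots,\beta_r$ of $\Pi$ let $\epsilon$ be the bilinear form on $\Pi$ with $\epsilon(\beta_i,\beta_j)=B(\beta_i,\beta_j)$ if $i>j$ and $0$ if $i\le j$. For $k\in\mathbb Z$ let $\Gamma_k$ be the group $T\times\Pi\times U(1)$ with multiplication \[(t_1,\eta_1,z_1)(t_2,\eta_2,z_2)=\bigl(t_1t_2,\ \eta_1+\eta_2,\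 \kappa_{\eta_1}(t_2)^k(-1)^{k\epsilon(\eta_1,\eta_2)}z_1z_2\bigr),\] and let $\Gamma_k^{\mathrm{triv}}$ be the group defined in the same way with $\epsilon=0$. Thus $\Gamma_1=T\ltimes\Pi^{\mathrm{bas}}$ and $\Gamma_1^{\mathrm{triv}}=T\ltimes\Pi^{\mathrm{triv}}$, and $\Gamma_\ell=T\ltimes\Pi^\tau$ is the restriction to $T\times\Pi$ of $\tau=\ell$ times the basic central extension of the loop group. For $\Gamma=\Gamma_k$ let $C^*(\Gamma)_{(n)}$ be the norm closure, in the maximal group $C^*$-algebra $C^*(\Gamma)$, of the set of all $f\in C_c(\Gamma)$ with $f(z^{-1}\gamma)=z^nf(\gamma)$ for $z\in U(1)$, $\gamma\in\Gamma$. Isomorphisms of these groups are isomorphisms of topological groups that restrict to the identity on the central $U(1)$. Then: 1. The $C^*(T\ltimes\Pi^{\mathrm{bas}})_{(n)}$, $n\in\mathbb Z$, are closed two-sided ideals, and $C^*(T\ltimes\Pi^{\mathrm{bas}})$ is their ($c_0$-)direct sum. 2. For every $k$ there is an isomorphism $\Gamma_k\to\Gamma_k^{\mathrm{triv}}$ that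 is the identity on $T$. Every isomorphism $\Phi\colon T\ltimes\Pi^{\mathrm{bas}}\to T\ltimes\Pi^{\mathrm{triv}}$ determines isomorphisms of $C^*$-algebras \[C^*(T\ltimes\Pi^{\mathrm{bas}})_{(0)}\cong C_0(\Pi^*\times T^\vee),\qquad C^*(T\ltimes\Pi^{\mathrm{bas}})_{(\ell)}\cong\bigoplus_{[\xi]\in\Pi^*/\ell\Pi}\mathbb K(L^2([\xi]))\quad(\ell\neq0),\] where $[\xi]=\xi+\ell\Pi$. On functions $f\in C_c$ they are given by $f\mapsto\int f(\gamma)\,\rho(\Phi(\gamma))\,d\gamma$. For $\ell=0$, $\rho$ runs through the characters $(t,\eta,z)\mapsto t^\xi\chi(\eta)$ with $(\xi,\chi)\in\Pi^*\times T^\vee$. For $\ell\ne0$, $\rho$ is the representation $\rho(t,\eta,z)\delta_\mu=z^\ell t^{\mu+\ell\eta}\delta_{\mu+\ell\eta}$ on the spaces $L^2([\xi])$. 3. Let $\ell\neq0$, let $\tau$ be $\ell$ times the basic central extension, and let $C^*_\tau(T\times\Pi)=C^*(T\ltimes\Pi^\tau)_{(1)}$. Then there is an isomorphism of abelian groups \[K_0\bigl(C^*_\tau(T\times\Pi)\bigr)\cong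 R^{-\infty}(T)^{\ell\Pi}=\Bigl\{\sum_{\xi\in\Pi^*}a_\xi e_\xi:\ a_\xi\in\mathbb Z,\ a_{\xi+\ell\eta}=a_\xi\text{ for all }\eta\in\Pi\Bigr\},\] with the following property. Every isomorphism $\Phi\colon\Gamma_\ell\to\Gamma_\ell^{\mathrm{triv}}$ that is the identity on $T$ determines, by integrating the representation $(t,\eta,z)\delta_\mu=z\,t^{\mu+\ell\eta}\delta_{\mu+\ell\eta}$, an isomorphism $C^*_\tau(T\times\Pi)\cong\bigoplus_{[\xi]\in\Pi^*/\ell\Pi}\mathbb K(L^2([\xi]))$, and for every projection $p\in C^*_\tau(T\times\Pi)$ the class $[p]$ is sent to $\sum_\xi\mathrm{rank}(p_{[\xi]})\,e_\xi$, where $p_{[\xi]}$ is the component of $p$ in $\mathbb K(L^2([\xi]))$. In particular the generator $L^2([\xi])$ of $K_0(\mathbb K(L^2([\xi])))$ is sent to its formal $T$-character $\sum_{\eta\in\Pi}e_{\xi+\ell\eta}$. -/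

import Mathlib

open MeasureTheory Filter Topology
open scoped ENNReal ZeroAtInfty CompactlySupported

noncomputable section

universe u

/-! ## Group C*-algebras -/

/-- The C*-algebra of bounded families in a family of C*-algebras, with the supremum norm. -/
instance lpInftyCStarAlgebra {I : Type*} (A : I → Type*) [∀ i, NonUnitalCStarAlgebra (A i)] :
    NonUnitalCStarAlgebra (lp A ∞) where
  toCompleteSpace := inferInstance
  norm_mul_self_le x := (CStarRing.norm_star_mul_self (x := x)).symm.le

/-- A strongly continuous unitary representation of a topological group on a Hilbert space. -/
structure UnitaryRep (G : Type u) [Group G] [TopologicalSpace G] : Type (u + 1) where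
  /-- the underlying Hilbert space -/
  H : Type u
  [normed : NormedAddCommGroup H]
  [inner : InnerProductSpace ℂ H]
  [complete : CompleteSpace H]
  /-- the action by unitary operators -/
  act : G →* unitary (H →L[ℂ] H)
  continuous_act : ∀ h : H, Continuous fun g => (act g : H →L[ℂ] H) h

namespace UnitaryRep

attribute [instance] UnitaryRep.normed UnitaryRep.inner UnitaryRep.complete

variable {G : Type u} [Group G] [TopologicalSpace G]

theorem norm_act (π : UnitaryRep G) (g : G) (h : π.H) :
    ‖(π.act g : π.H →L[ℂ] π.H) h‖ = ‖h‖ :=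
  ContinuousLinearMap.norm_map_of_mem_unitary (π.act g).2 h

variable [IsTopologicalGroup G] [LocallyCompactSpace G] [MeasurableSpace G] [BorelSpace G]

theorem integrable_smul_act (π : UnitaryRep G) (f : C_c(G, ℂ)) (h : π.H) :
    Integrable (fun g => f g • (π.act g : π.H →L[ℂ] π.H) h) Measure.haar :=
  (f.continuous.smul (π.continuous_act h)).integrable_of_hasCompactSupport
    f.hasCompactSupport.smul_right

/-- The integrated form of a unitary representation, on compactly supported functions:
`π(f) h = ∫ f(g) π(g) h dg`, with respect to a left Haar measure. -/
def integrated (π : UnitaryRep G) (f : C_c(G, ℂ)) : π.H →L[ℂ] π.H :=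
  LinearMap.mkContinuous
    { toFun := fun h => ∫ g, f g • (π.act g : π.H →L[ℂ] π.H) h ∂Measure.haar
      map_add' := fun x y => by
        rw [← integral_add (π.integrable_smul_act f x) (π.integrable_smul_act f y)]
        simp
      map_smul' := fun c x => by
        rw [RingHom.id_apply, ← integral_smul]
        simp [smul_comm c] }
    (∫ g, ‖f g‖ ∂Measure.haar)
    (fun h => by
      refine (norm_integral_le_integral_norm _).trans (le_of_eq ?_)
      simp only [norm_smul, norm_act]
      rw [integral_mul_const])

theorem integrated_apply (π : UnitaryRep G) (f : C_c(G, ℂ)) (h : π.H) :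
    π.integrated f h = ∫ g, f g • (π.act g : π.H →L[ℂ] π.H) h ∂Measure.haar := rfl

theorem norm_integrated_le (π : UnitaryRep G) (f : C_c(G, ℂ)) :
    ‖π.integrated f‖ ≤ ∫ g, ‖f g‖ ∂Measure.haar :=
  LinearMap.mkContinuous_norm_le _ (integral_nonneg fun _ => norm_nonneg _) _

end UnitaryRep

section GroupCStar

variable (G : Type u) [Group G] [TopologicalSpace G]

/-- The C*-algebra of bounded families `(T_π)_π` of operators, `π` running through all unitary
representations of `G`. -/
def UniversalOperators : Type (u + 1) := lp (fun π : UnitaryRep G => π.H →L[ℂ] π.H) ∞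

instance : NonUnitalCStarAlgebra (UniversalOperators G) :=
  lpInftyCStarAlgebra fun π : UnitaryRep G => π.H →L[ℂ] π.H

variable [IsTopologicalGroup G] [LocallyCompactSpace G] [MeasurableSpace G] [BorelSpace G]

variable {G} in
/-- The image `(π(f))_π` of a compactly supported function `f` in the universal representation.
Its norm is `sup_π ‖π(f)‖`, the maximal C*-norm of `f`. -/
def universalRep (f : C_c(G, ℂ)) : UniversalOperators G :=
  ⟨fun π => π.integrated f, memℓp_infty ⟨∫ g, ‖f g‖ ∂Measure.haar, by
    rintro _ ⟨π, rfl⟩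
    exact π.norm_integrated_le f⟩⟩

/-- The (maximal) group C*-algebra `C*(G)`: the completion of the convolution algebra `C_c(G)` in
the maximal C*-norm, realised as a closed *-subalgebra in the universal representation. -/
def GroupCStar : NonUnitalStarSubalgebra ℂ (UniversalOperators G) :=
  (NonUnitalStarAlgebra.adjoin ℂ (Set.range (universalRep (G := G)))).topologicalClosure

/-- `C*(G)` as a type. -/
def GroupCStarAlgebra : Type (u + 1) := GroupCStar G

instance : NonUnitalCStarAlgebra (GroupCStarAlgebra G) :=
  NonUnitalStarSubalgebra.nonUnitalCStarAlgebra (GroupCStar G)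
    (h_closed := NonUnitalStarSubalgebra.isClosed_topologicalClosure _)

variable {G}

/-- Functions of homogeneity `n` for the subgroup `c : U(1) → G`: `f(z⁻¹ g) = zⁿ f(g)`. -/
def IsHomogeneous (c : Circle →* G) (n : ℤ) (f : C_c(G, ℂ)) : Prop :=
  ∀ (z : Circle) (g : G), f ((c z)⁻¹ * g) = ((z ^ n : Circle) : ℂ) * f g

/-- The homogeneous ideal `C*(G)_(n)`: the C*-algebra generated by the functions in `C_c(G)` of
homogeneity `n`, that is the closure of the space of all those functions. -/
def HomogIdeal (c : Circle →* G) (n : ℤ) : NonUnitalStarSubalgebra ℂ (UniversalOperators G) :=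
  (NonUnitalStarAlgebra.adjoin ℂ (universalRep '' {f | IsHomogeneous c n f})).topologicalClosure

/-- `C*(G)_(n)` as a type. -/
def HomogAlgebra (c : Circle →* G) (n : ℤ) : Type (u + 1) := HomogIdeal c n

instance (c : Circle →* G) (n : ℤ) : NonUnitalCStarAlgebra (HomogAlgebra c n) :=
  NonUnitalStarSubalgebra.nonUnitalCStarAlgebra (HomogIdeal c n)
    (h_closed := NonUnitalStarSubalgebra.isClosed_topologicalClosure _)

/-- An element of `C*(G)` in the universal representation. -/
def GroupCStarAlgebra.toOperators (a : GroupCStarAlgebra G) : UniversalOperators G :=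
  Subtype.val (p := (· ∈ GroupCStar G)) a

/-- An element of `C*(G)_(n)` in the universal representation. -/
def HomogAlgebra.toOperators {c : Circle →* G} {n : ℤ} (a : HomogAlgebra c n) :
    UniversalOperators G :=
  Subtype.val (p := (· ∈ HomogIdeal c n)) a

/-- A function of homogeneity `n` as an element of the `n`-th homogeneous ideal. -/
def homogeneousElement (c : Circle →* G) (n : ℤ) (f : C_c(G, ℂ)) (hf : IsHomogeneous c n f) :
    HomogAlgebra c n :=
  ⟨universalRep f, NonUnitalStarSubalgebra.le_topologicalClosure _
    (NonUnitalStarAlgebra.subset_adjoin ℂ _ ⟨f, hf, rfl⟩)⟩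

end GroupCStar

/-! ## Direct sums and compact operators -/

/-- The direct sum of a family of C*-algebras: the families `(a_i)` with `‖a_i‖ → 0` at infinity,
with the supremum norm. -/
def CStarSum {I : Type*} (A : I → Type*) [∀ i, NonUnitalCStarAlgebra (A i)] :
    NonUnitalStarSubalgebra ℂ (lp A ∞) where
  carrier := {a | Tendsto (fun i => ‖a i‖) cofinite (𝓝 0)}
  zero_mem' := by simpa using tendsto_const_nhds
  add_mem' {a b} ha hb := by
    refine squeeze_zero (fun _ => norm_nonneg _) (fun i => ?_) (by simpa using Tendsto.add ha hb)
    simpa using norm_add_le (a i) (b i)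
  mul_mem' {a b} ha hb := by
    refine squeeze_zero (fun _ => norm_nonneg _) (fun i => ?_) (by simpa using Tendsto.mul ha hb)
    simpa using norm_mul_le (a i) (b i)
  smul_mem' c a ha := by
    have h := Tendsto.const_mul ‖c‖ (show Tendsto (fun i => ‖a i‖) cofinite (𝓝 0) from ha)
    simpa [norm_smul] using h
  star_mem' {a} ha := by simpa using ha

theorem isClosed_cStarSum {I : Type*} (A : I → Type*) [∀ i, NonUnitalCStarAlgebra (A i)] :
    IsClosed (CStarSum A : Set (lp A ∞)) := by
  refine isClosed_of_closure_subset fun a ha => ?_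
  change Tendsto (fun i => ‖a i‖) cofinite (𝓝 0)
  rw [Metric.tendsto_nhds]
  intro ε hε
  obtain ⟨b, hb, hab⟩ := Metric.mem_closure_iff.1 ha (ε / 2) (half_pos hε)
  have hb' : Tendsto (fun i => ‖b i‖) cofinite (𝓝 0) := hb
  filter_upwards [Metric.tendsto_nhds.1 hb' (ε / 2) (half_pos hε)] with i hi
  have h1 : ‖(a - b) i‖ ≤ ‖a - b‖ := lp.norm_apply_le_norm ENNReal.top_ne_zero _ i
  have h2 : ‖a i‖ ≤ ‖(a - b) i‖ + ‖b i‖ := by simpa using norm_add_le ((a - b) i) (b i)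
  rw [dist_eq_norm] at hab
  simp only [dist_zero_right, norm_norm] at hi ⊢
  linarith

/-- The direct sum of C*-algebras as a type. -/
def CStarSumAlgebra {I : Type*} (A : I → Type*) [∀ i, NonUnitalCStarAlgebra (A i)] : Type _ :=
  CStarSum A

instance {I : Type*} (A : I → Type*) [∀ i, NonUnitalCStarAlgebra (A i)] :
    NonUnitalCStarAlgebra (CStarSumAlgebra A) :=
  NonUnitalStarSubalgebra.nonUnitalCStarAlgebra (CStarSum A) (h_closed := isClosed_cStarSum A)

/-- The components of an element of a direct sum. -/
def CStarSumAlgebra.component {I : Type*} {A : I → Type*} [∀ i, NonUnitalCStarAlgebra (A i)]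
    (x : CStarSumAlgebra A) (i : I) : A i := (Subtype.val (p := (· ∈ CStarSum A)) x) i

theorem isCompactOperator_star {H : Type*} [NormedAddCommGroup H] [InnerProductSpace ℂ H]
    [CompleteSpace H] {T : H →L[ℂ] H} (hT : IsCompactOperator T) :
    IsCompactOperator (star T : H →L[ℂ] H) := by
  have h1 : IsCompactOperator (T * star T : H →L[ℂ] H) := hT.comp_clm (star T)
  have h2 := (h1.isCompact_closure_image_closedBall (f := (T * star T : H →L[ℂ] H).toLinearMap)
    1).totallyBounded.subset subset_closure
  refine (isCompactOperator_iff_isCompact_closure_image_closedBall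
    (star T : H →L[ℂ] H).toLinearMap one_pos).2 ?_
  refine TotallyBounded.isCompact_of_isClosed (TotallyBounded.closure ?_) isClosed_closure
  rw [Metric.totallyBounded_iff]
  intro ε hε
  obtain ⟨t, hts, htf, ht⟩ := totallyBounded_iff_subset.1 h2 {p | dist p.1 p.2 < ε ^ 2 / 2}
    (Metric.dist_mem_uniformity (by positivity))
  have hts' : ∀ y ∈ t, ∃ x ∈ Metric.closedBall (0 : H) 1, (T * star T : H →L[ℂ] H) x = y :=
    fun y hy => hts hy
  choose! x hx hxe using hts'
  refine ⟨(fun y => (star T : H →L[ℂ] H) (x y)) '' t, htf.image _, ?_⟩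
  rintro _ ⟨w, hw, rfl⟩
  have hmem := ht ⟨w, hw, rfl⟩
  simp only [Set.mem_iUnion, Set.mem_ofPred_eq, exists_prop] at hmem
  obtain ⟨y, hy, hd⟩ := hmem
  simp only [Set.mem_iUnion, Set.mem_image, exists_prop, exists_exists_and_eq_and]
  refine ⟨y, hy, ?_⟩
  rw [← hxe y hy, dist_eq_norm] at hd
  have hwy : ‖w - x y‖ ≤ 2 := by
    have h4 := norm_sub_le w (x y)
    have h5 : ‖w‖ ≤ 1 := by simpa using hw
    have h6 : ‖x y‖ ≤ 1 := by simpa using hx y hy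
    linarith
  have key : ‖(star T : H →L[ℂ] H) (w - x y)‖ ^ 2 ≤
      ‖(T * star T : H →L[ℂ] H) (w - x y)‖ * ‖w - x y‖ := by
    have h7 : inner ℂ ((T * star T : H →L[ℂ] H) (w - x y)) (w - x y) =
        ((‖(star T : H →L[ℂ] H) (w - x y)‖ ^ 2 : ℝ) : ℂ) := by
      rw [ContinuousLinearMap.star_eq_adjoint, mul_apply_eq_comp,
        ← ContinuousLinearMap.adjoint_inner_right, inner_self_eq_norm_sq_to_K]
      norm_cast
    have h8 := norm_inner_le_norm (𝕜 := ℂ) ((T * star T : H →L[ℂ] H) (w - x y)) (w - x y)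
    rw [h7, Complex.norm_real, Real.norm_of_nonneg (by positivity)] at h8
    exact h8
  have hd' : ‖(T * star T : H →L[ℂ] H) (w - x y)‖ < ε ^ 2 / 2 := by
    rw [map_sub]
    exact hd
  rw [Metric.mem_ball, dist_eq_norm]
  change ‖(star T : H →L[ℂ] H) w - (star T : H →L[ℂ] H) (x y)‖ < ε
  rw [← map_sub]
  refine lt_of_pow_lt_pow_left₀ 2 hε.le ?_
  nlinarith [norm_nonneg ((T * star T : H →L[ℂ] H) (w - x y)), norm_nonneg (w - x y)]

/-- The C*-algebra `𝕂(H)` of compact operators on a Hilbert space. -/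
def CompactOperators (H : Type*) [NormedAddCommGroup H] [InnerProductSpace ℂ H] [CompleteSpace H] :
    NonUnitalStarSubalgebra ℂ (H →L[ℂ] H) where
  carrier := {T : H →L[ℂ] H | IsCompactOperator T}
  zero_mem' := isCompactOperator_zero
  add_mem' ha hb := IsCompactOperator.add ha hb
  mul_mem' {_ b} ha _ := IsCompactOperator.comp_clm ha b
  smul_mem' c _ ha := IsCompactOperator.smul ha c
  star_mem' ha := isCompactOperator_star ha

/-- `𝕂(H)` as a type. -/
def CompactAlgebra (H : Type*) [NormedAddCommGroup H] [InnerProductSpace ℂ H] [CompleteSpace H] :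
    Type _ := CompactOperators H

instance (H : Type*) [NormedAddCommGroup H] [InnerProductSpace ℂ H] [CompleteSpace H] :
    NonUnitalCStarAlgebra (CompactAlgebra H) :=
  NonUnitalStarSubalgebra.nonUnitalCStarAlgebra (CompactOperators H)
    (h_closed := isClosed_setOfPred_isCompactOperator)

/-- A compact operator as a bounded operator. -/
def CompactAlgebra.toOperator {H : Type*} [NormedAddCommGroup H] [InnerProductSpace ℂ H]
    [CompleteSpace H] (T : CompactAlgebra H) : H →L[ℂ] H :=
  Subtype.val (p := (· ∈ CompactOperators H)) T

/-! ## K-theory -/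

/-- A projection (self-adjoint idempotent) in a matrix algebra over a *-ring. -/
structure MatrixProjection (R : Type*) [Ring R] [StarRing R] where
  size : ℕ
  mat : Matrix (Fin size) (Fin size) R
  isStarProjection : IsStarProjection mat

namespace MatrixProjection

open scoped Matrix

variable {R S : Type*} [Ring R] [StarRing R] [Ring S] [StarRing S]

/-- Murray-von Neumann equivalence: `p = v* v` and `q = v v*` for a rectangular matrix `v`. -/
def Equivalent (p q : MatrixProjection R) : Prop :=
  ∃ v : Matrix (Fin q.size) (Fin p.size) R, vᴴ * v = p.mat ∧ v * vᴴ = q.mat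

/-- The block sum `diag(p, q)`. -/
def blockSum (p q : MatrixProjection R) : MatrixProjection R where
  size := p.size + q.size
  mat := Matrix.reindex finSumFinEquiv finSumFinEquiv (Matrix.fromBlocks p.mat 0 0 q.mat)
  isStarProjection := by
    have hp := p.isStarProjection
    have hq := q.isStarProjection
    constructor
    · rw [IsIdempotentElem, Matrix.reindex_apply, Matrix.submatrix_mul_equiv,
        Matrix.fromBlocks_multiply]
      simp [hp.isIdempotentElem.eq, hq.isIdempotentElem.eq]
    · rw [isSelfAdjoint_iff, Matrix.star_eq_conjTranspose, Matrix.reindex_apply,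
        Matrix.conjTranspose_submatrix, Matrix.fromBlocks_conjTranspose]
      have h1 : p.matᴴ = p.mat := hp.isSelfAdjoint
      have h2 : q.matᴴ = q.mat := hq.isSelfAdjoint
      simp [h1, h2]

/-- The image of a projection under a *-homomorphism. -/
def map (f : R →+* S) (hf : ∀ x, f (star x) = star (f x)) (p : MatrixProjection R) :
    MatrixProjection S where
  size := p.size
  mat := p.mat.map f
  isStarProjection := by
    have hp := p.isStarProjection
    constructor
    · rw [IsIdempotentElem, ← Matrix.map_mul, hp.isIdempotentElem.eq]
    · rw [isSelfAdjoint_iff, Matrix.star_eq_conjTranspose,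
        ← Matrix.conjTranspose_map f hf]
      have h1 : p.matᴴ = p.mat := hp.isSelfAdjoint
      rw [h1]

end MatrixProjection

section KTheory

variable (R : Type*) [Ring R] [StarRing R]

/-- The relations `[diag(p, q)] = [p] + [q]`, and `[p] = [q]` for equivalent projections. -/
def kRelations : AddSubgroup (FreeAbelianGroup (MatrixProjection R)) :=
  AddSubgroup.closure
    ({x | ∃ p q : MatrixProjection R, x = FreeAbelianGroup.of (p.blockSum q) -
        (FreeAbelianGroup.of p + FreeAbelianGroup.of q)} ∪
      {x | ∃ p q : MatrixProjection R, p.Equivalent q ∧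
        x = FreeAbelianGroup.of p - FreeAbelianGroup.of q})

/-- `K₀` of a unital C*-algebra: the Grothendieck group of the monoid of equivalence classes of
projections in matrix algebras, by generators and relations. -/
abbrev KZeroUnital : Type _ := FreeAbelianGroup (MatrixProjection R) ⧸ kRelations R

variable {R}

/-- The class of a projection in `K₀`. -/
def KZeroUnital.mk (p : MatrixProjection R) : KZeroUnital R :=
  QuotientAddGroup.mk (FreeAbelianGroup.of p)

theorem KZeroUnital.mk_blockSum (p q : MatrixProjection R) :
    mk (p.blockSum q) = mk p + mk q := by
  rw [← sub_eq_zero]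
  exact (QuotientAddGroup.eq_zero_iff _).2 (AddSubgroup.subset_closure (Or.inl ⟨p, q, rfl⟩))

theorem KZeroUnital.mk_eq {p q : MatrixProjection R} (h : p.Equivalent q) : mk p = mk q := by
  rw [← sub_eq_zero]
  exact (QuotientAddGroup.eq_zero_iff _).2 (AddSubgroup.subset_closure (Or.inr ⟨p, q, h, rfl⟩))

theorem KZeroUnital.mk_eq_zero {p : MatrixProjection R} (h : p.mat = 0) : mk p = 0 := by
  have h0 : (p.blockSum p).mat = 0 := by
    change Matrix.reindex finSumFinEquiv finSumFinEquiv (Matrix.fromBlocks p.mat 0 0 p.mat) =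
      (0 : Matrix (Fin (p.size + p.size)) (Fin (p.size + p.size)) R)
    rw [h]
    simp
  have h1 : p.Equivalent (p.blockSum p) :=
    ⟨0, (Matrix.mul_zero _).trans h.symm, (Matrix.zero_mul _).trans h0.symm⟩
  have h2 := KZeroUnital.mk_eq h1
  rw [KZeroUnital.mk_blockSum] at h2
  simpa using h2

variable {S : Type*} [Ring S] [StarRing S]

/-- Functoriality of `K₀` for unital *-homomorphisms. -/
def KZeroUnital.map (f : R →+* S) (hf : ∀ x, f (star x) = star (f x)) :
    KZeroUnital R →+ KZeroUnital S :=
  QuotientAddGroup.lift (kRelations R)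
    (FreeAbelianGroup.lift fun p => KZeroUnital.mk (p.map f hf)) <| by
    refine (AddSubgroup.closure_le _).2 ?_
    rintro _ (⟨p, q, rfl⟩ | ⟨p, q, ⟨v, hv, hv'⟩, rfl⟩)
    · have h : (p.blockSum q).map f hf = (p.map f hf).blockSum (q.map f hf) := by
        have h1 : (Matrix.reindex finSumFinEquiv finSumFinEquiv
            (Matrix.fromBlocks p.mat 0 0 q.mat)).map f =
            Matrix.reindex finSumFinEquiv finSumFinEquiv
              (Matrix.fromBlocks (p.mat.map f) 0 0 (q.mat.map f)) := by
          rw [Matrix.reindex_apply, Matrix.reindex_apply, ← Matrix.submatrix_map,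
            Matrix.fromBlocks_map]
          simp
        unfold MatrixProjection.blockSum MatrixProjection.map
        congr 1
      simp [h, KZeroUnital.mk_blockSum]
    · have hv₁ := congrArg (fun M => M.map f) hv
      have hv₂ := congrArg (fun M => M.map f) hv'
      simp only [Matrix.map_mul, Matrix.conjTranspose_map f hf] at hv₁ hv₂
      have h : (p.map f hf).Equivalent (q.map f hf) := ⟨v.map f, hv₁, hv₂⟩
      simp [KZeroUnital.mk_eq h]

variable (A : Type*) [NonUnitalCStarAlgebra A]

/-- The map `K₀(A⁺) → K₀(ℂ)` induced by the augmentation of the unitization `A⁺ = ℂ ⊕ A`. -/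
def kAugmentation : KZeroUnital (Unitization ℂ A) →+ KZeroUnital ℂ :=
  KZeroUnital.map (Unitization.fstHom ℂ A : Unitization ℂ A →+* ℂ) fun x => Unitization.fst_star x

/-- `K₀` of a (not necessarily unital) C*-algebra: the kernel of `K₀(A⁺) → K₀(ℂ)`. -/
def KZero : AddSubgroup (KZeroUnital (Unitization ℂ A)) := (kAugmentation A).ker

variable {A}

/-- The class in `K₀(A)` of a projection in `A`. -/
def KZero.mk (p : A) (hp : IsStarProjection p) : KZero A :=
  ⟨KZeroUnital.mk
    { size := 1
      mat := Matrix.of fun _ _ => (p : Unitization ℂ A)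
      isStarProjection := by
        constructor
        · refine Matrix.ext fun i j => ?_
          simp [Matrix.mul_apply, ← Unitization.inr_mul, hp.isIdempotentElem.eq]
        · rw [isSelfAdjoint_iff]
          refine Matrix.ext fun i j => ?_
          simp [Matrix.star_apply, ← Unitization.inr_star, hp.isSelfAdjoint.star_eq] },
   by
    refine AddMonoidHom.mem_ker.2 ?_
    have h : ∀ q, kAugmentation A (KZeroUnital.mk q) = KZeroUnital.mk (q.map _ _) := fun q => by
      simp [kAugmentation, KZeroUnital.map, KZeroUnital.mk]
      rfl
    rw [h]
    refine KZeroUnital.mk_eq_zero ?_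
    exact Matrix.ext fun i j => Unitization.fst_inr ℂ p⟩

end KTheory

/-! ## The lattices, the basic inner product and the torus

A compact, connected, simply connected, simple Lie group `G` with maximal torus `T` is encoded by
its root system `P`, with roots in `V = 𝔱*` and coroots in `W = 𝔱`. -/

section LieData

variable {ι V W : Type*} [AddCommGroup V] [Module ℝ V] [AddCommGroup W] [Module ℝ W]

/-- The integral lattice `Π = ker(exp : 𝔱 → T)`. As `G` is simply connected, it is the coroot
lattice. It carries the discrete topology. -/
def IntegralLattice (P : RootPairing ι ℝ V W) : Type _ := P.corootSpan ℤ

variable (P : RootPairing ι ℝ V W)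

instance : AddCommGroup (IntegralLattice P) := inferInstanceAs (AddCommGroup (P.corootSpan ℤ))

instance : TopologicalSpace (IntegralLattice P) := ⊥

instance : DiscreteTopology (IntegralLattice P) := ⟨rfl⟩

/-- The weight lattice `Π* = Hom(Π, ℤ)`, with the discrete topology. -/
def WeightLattice : Type _ := IntegralLattice P →+ ℤ

instance : AddCommGroup (WeightLattice P) := inferInstanceAs (AddCommGroup (IntegralLattice P →+ ℤ))

instance : TopologicalSpace (WeightLattice P) := ⊥

instance : DiscreteTopology (WeightLattice P) := ⟨rfl⟩

/-- The maximal torus `T = 𝔱/Π`, as the group `Hom(Π*, U(1))` of characters of the weight lattice;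
`exp(x)`, `x ∈ 𝔱`, is the character `ξ ↦ exp(2πi ξ(x))`. -/
abbrev MaximalTorus : Type _ := PontryaginDual (Multiplicative (WeightLattice P))

/-- The dual torus `T^∨ = 𝔱*/Π*`, the Pontryagin dual of `Π`. -/
abbrev DualTorus : Type _ := PontryaginDual (Multiplicative (IntegralLattice P))

variable {P}

/-- The value `t^ξ ∈ U(1)` of the character `ξ ∈ Π*` at `t ∈ T`. -/
def MaximalTorus.pow (t : MaximalTorus P) (ξ : WeightLattice P) : Circle :=
  t (Multiplicative.ofAdd ξ)

variable (P) [Fintype ι]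

/-- The basic inner product on `𝔱`: the multiple of the canonical Weyl-invariant inner product
`(x, y) ↦ ∑_α α(x) α(y)` for which the short coroots have squared length `2`. -/
def basicInner : LinearMap.BilinForm ℝ W :=
  (2 / ⨅ i, P.CorootForm (P.coroot i) (P.coroot i)) • P.CorootForm

theorem corootForm_coroot_pos (i : ι) : 0 < P.CorootForm (P.coroot i) (P.coroot i) := by
  rw [P.corootForm_apply_apply]
  refine Finset.sum_pos' (fun j _ => mul_self_nonneg _) ⟨i, Finset.mem_univ _, ?_⟩
  simp

theorem exists_int_corootForm_eq [P.IsCrystallographic] [P.IsReduced] [P.IsIrreducible] (i j : ι)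
    (h : P.CorootForm (P.coroot j) (P.coroot j) ≤ P.CorootForm (P.coroot i) (P.coroot i)) :
    ∃ n : ℤ, P.CorootForm (P.coroot i) (P.coroot i) =
      n * P.CorootForm (P.coroot j) (P.coroot j) := by
  let B := (P.flip.posRootForm ℝ).toInvariantForm
  obtain ⟨k, hk, hne⟩ := P.flip.exists_form_eq_form_and_form_ne_zero B j i
  have hB : ∀ a, B.form (P.flip.root a) (P.flip.root a) =
      P.CorootForm (P.coroot a) (P.coroot a) := fun a => rfl
  have hpos : ∀ a, 0 < B.form (P.flip.root a) (P.flip.root a) := fun a => by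
    rw [hB]
    exact corootForm_coroot_pos P a
  have hsw := B.pairing_mul_eq_pairing_mul_swap j k
  have hset := P.flip.pairingIn_pairingIn_mem_set_of_isCrystal_of_isRed j k
  rw [hk] at hsw
  rw [← hB, ← hB] at h ⊢
  have hne' : P.flip.pairing j k ≠ 0 := fun h0 => hne ((B.apply_root_root_zero_iff j k).2 h0)
  rw [← P.flip.algebraMap_pairingIn ℤ j k, ← P.flip.algebraMap_pairingIn ℤ k j] at hsw
  rw [← P.flip.algebraMap_pairingIn ℤ j k] at hne'
  have hi := hpos i
  have hj := hpos j
  simp only [Set.mem_insert_iff, Set.mem_singleton_iff, Prod.mk.injEq] at hset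
  rcases hset with ⟨e1, e2⟩ | ⟨e1, e2⟩ | ⟨e1, e2⟩ | ⟨e1, e2⟩ | ⟨e1, e2⟩ | ⟨e1, e2⟩ | ⟨e1, e2⟩ |
      ⟨e1, e2⟩ | ⟨e1, e2⟩ | ⟨e1, e2⟩ | ⟨e1, e2⟩ | ⟨e1, e2⟩ | ⟨e1, e2⟩ <;>
    rw [e1, e2] at hsw <;> simp only [eq_intCast] at hsw <;> push_cast at hsw
  · simp [e1] at hne'
  all_goals first
    | exact ⟨1, by push_cast; linarith⟩
    | exact ⟨2, by push_cast; linarith⟩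
    | exact ⟨3, by push_cast; linarith⟩

theorem basicInner_coroot_coroot [P.IsCrystallographic] [P.IsReduced] [P.IsIrreducible] (i j : ι) :
    ∃ n : ℤ, basicInner P (P.coroot i) (P.coroot j) = n := by
  have : Nonempty ι := ⟨i⟩
  obtain ⟨m, hm⟩ := exists_eq_ciInf_of_finite
    (f := fun i => P.CorootForm (P.coroot i) (P.coroot i))
  have hle : P.CorootForm (P.coroot m) (P.coroot m) ≤ P.CorootForm (P.coroot j) (P.coroot j) := by
    have h1 := ciInf_le (Set.finite_range fun i => P.CorootForm (P.coroot i) (P.coroot i)).bddBelow j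
    rw [← hm] at h1
    exact h1
  obtain ⟨n, hn⟩ := exists_int_corootForm_eq P j m hle
  have h2 : 2 * P.CorootForm (P.coroot i) (P.coroot j) =
      P.flip.pairing i j * P.CorootForm (P.coroot j) (P.coroot j) :=
    (P.flip.posRootForm ℝ).toInvariantForm.two_mul_apply_root_root i j
  rw [← P.flip.algebraMap_pairingIn ℤ i j, eq_intCast, hn] at h2
  have hpos := corootForm_coroot_pos P m
  refine ⟨P.flip.pairingIn ℤ i j * n, ?_⟩
  rw [basicInner, ← hm]
  simp only [LinearMap.smul_apply, smul_eq_mul]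
  push_cast
  field_simp
  linarith

theorem exists_int_basicInner [P.IsCrystallographic] [P.IsReduced] [P.IsIrreducible]
    (x y : IntegralLattice P) : ∃ n : ℤ, basicInner P x.1 y.1 = n := by
  obtain ⟨x, hx⟩ := x
  obtain ⟨y, hy⟩ := y
  change ∃ n : ℤ, basicInner P x y = n
  unfold RootPairing.corootSpan at hx hy
  induction hx using Submodule.span_induction with
  | zero => exact ⟨0, by simp⟩
  | add a b _ _ ha hb =>
    obtain ⟨m, hm⟩ := ha
    obtain ⟨n, hn⟩ := hb
    exact ⟨m + n, by simp [hm, hn]⟩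
  | smul c a _ ha =>
    obtain ⟨m, hm⟩ := ha
    exact ⟨c * m, by rw [map_zsmul, LinearMap.smul_apply, hm]; simp⟩
  | mem a ha =>
    obtain ⟨i, rfl⟩ := ha
    induction hy using Submodule.span_induction with
    | zero => exact ⟨0, by simp⟩
    | add a b _ _ ha hb =>
      obtain ⟨m, hm⟩ := ha
      obtain ⟨n, hn⟩ := hb
      exact ⟨m + n, by simp [hm, hn]⟩
    | smul c a _ ha =>
      obtain ⟨m, hm⟩ := ha
      exact ⟨c * m, by rw [map_zsmul, hm]; simp⟩
    | mem a ha =>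
      obtain ⟨j, rfl⟩ := ha
      exact basicInner_coroot_coroot P i j

variable [P.IsCrystallographic] [P.IsReduced] [P.IsIrreducible]

/-- The restriction `Π × Π → ℤ` of the basic inner product. -/
def latticeInner (x y : IntegralLattice P) : ℤ := (exists_int_basicInner P x y).choose

theorem latticeInner_spec (x y : IntegralLattice P) :
    basicInner P x.1 y.1 = latticeInner P x y := (exists_int_basicInner P x y).choose_spec

/-- The inclusion `B♭ : Π → Π*`, `η ↦ B(η, ·)`. -/
def flat : IntegralLattice P →+ WeightLattice P :=
  AddMonoidHom.mk' (fun x => (AddMonoidHom.mk' (fun y => latticeInner P x y) fun a b => by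
      have h : ((latticeInner P x (a + b) : ℤ) : ℝ) = latticeInner P x a + latticeInner P x b := by
        rw [← latticeInner_spec, ← latticeInner_spec, ← latticeInner_spec]
        exact map_add (basicInner P x.1) a.1 b.1
      exact_mod_cast h : IntegralLattice P →+ ℤ)) fun a b => by
    refine AddMonoidHom.ext fun y => ?_
    have h : ((latticeInner P (a + b) y : ℤ) : ℝ) = latticeInner P a y + latticeInner P b y := by
      rw [← latticeInner_spec, ← latticeInner_spec, ← latticeInner_spec]
      exact LinearMap.map_add₂ (basicInner P) a.1 b.1 y.1
    exact_mod_cast h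

/-- The bilinear form `ε` on `Π` with `ε(β_i, β_j) = B(β_i, β_j)` for `i > j` and `0` for `i ≤ j`,
where `β` is a lattice basis. -/
def epsilonForm {r : ℕ} (β : Module.Basis (Fin r) ℤ (IntegralLattice P)) :
    LinearMap.BilinForm ℤ (IntegralLattice P) :=
  Matrix.toBilin β (Matrix.of fun i j => if j < i then latticeInner P (β i) (β j) else 0)

end LieData

/-! ## The groups `T ⋉ Π^bas` and `T ⋉ Π^triv` -/

section Groups

variable {ι : Type*} {V W : Type*} [AddCommGroup V] [Module ℝ V] [AddCommGroup W]
  [Module ℝ W]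

/-- The `U(1)` central extension of `T × Π` with underlying space `T × Π × U(1)` and multiplication
`(t₁, η₁, z₁)(t₂, η₂, z₂) = (t₁ t₂, η₁ + η₂, κ_{η₁}(t₂)^k (-1)^{k ε(η₁, η₂)} z₁ z₂)`, where
`κ_η(t) = t^{-B♭(η)}`. For `k = 1` and `ε` the form of a lattice basis this is `T ⋉ Π^bas`, and for
general `k` it is the restriction to `T × Π` of the `k`-th multiple of the basic central extension
of the loop group. For `ε = 0` it is the analogous group with trivial extension `Π × U(1)`. -/
@[ext]
structure TorusExt (P : RootPairing ι ℝ V W) (ε : LinearMap.BilinForm ℤ (IntegralLattice P))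
    (k : ℤ) where
  torus : MaximalTorus P
  lattice : IntegralLattice P
  phase : Circle

namespace TorusExt

variable {P : RootPairing ι ℝ V W} {ε : LinearMap.BilinForm ℤ (IntegralLattice P)} {k : ℤ}

/-- The underlying product space. -/
def equivProd : TorusExt P ε k ≃ MaximalTorus P × IntegralLattice P × Circle where
  toFun g := (g.torus, g.lattice, g.phase)
  invFun x := ⟨x.1, x.2.1, x.2.2⟩
  left_inv _ := rfl
  right_inv _ := rfl

instance : TopologicalSpace (TorusExt P ε k) := TopologicalSpace.induced equivProd inferInstance

/-- The underlying product space, topologically. -/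
def homeoProd : TorusExt P ε k ≃ₜ MaximalTorus P × IntegralLattice P × Circle :=
  equivProd.toHomeomorphOfIsInducing ⟨rfl⟩

instance : LocallyCompactSpace (TorusExt P ε k) :=
  homeoProd.isClosedEmbedding.locallyCompactSpace

instance : T2Space (TorusExt P ε k) := homeoProd.isEmbedding.t2Space

instance : MeasurableSpace (TorusExt P ε k) := borel _

instance : BorelSpace (TorusExt P ε k) := ⟨rfl⟩

theorem continuous_torus : Continuous (TorusExt.torus : TorusExt P ε k → _) :=
  continuous_fst.comp homeoProd.continuous

theorem continuous_lattice : Continuous (TorusExt.lattice : TorusExt P ε k → _) :=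
  (continuous_fst.comp continuous_snd).comp homeoProd.continuous

theorem continuous_phase : Continuous (TorusExt.phase : TorusExt P ε k → _) :=
  (continuous_snd.comp continuous_snd).comp homeoProd.continuous

instance : One (TorusExt P ε k) := ⟨⟨1, 0, 1⟩⟩

theorem one_def : (1 : TorusExt P ε k) = ⟨1, 0, 1⟩ := rfl

variable [Fintype ι] [P.IsCrystallographic] [P.IsReduced] [P.IsIrreducible]

/-- The commutator pairing `κ_η(t) = t^{-B♭(η)}`. -/
def kappa (η : IntegralLattice P) (t : MaximalTorus P) : Circle := t.pow (-flat P η)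

theorem kappa_mul (η : IntegralLattice P) (t s : MaximalTorus P) :
    kappa η (t * s) = kappa η t * kappa η s := rfl

theorem kappa_one (η : IntegralLattice P) : kappa η (1 : MaximalTorus P) = 1 := rfl

theorem kappa_inv (η : IntegralLattice P) (t : MaximalTorus P) :
    kappa η t⁻¹ = (kappa η t)⁻¹ := rfl

theorem kappa_add (η ζ : IntegralLattice P) (t : MaximalTorus P) :
    kappa (η + ζ) t = kappa η t * kappa ζ t := by
  simp only [kappa, MaximalTorus.pow, map_add, neg_add, ofAdd_add, map_mul]

theorem kappa_zero (t : MaximalTorus P) : kappa (0 : IntegralLattice P) t = 1 := by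
  simp [kappa, MaximalTorus.pow]

theorem kappa_neg (η : IntegralLattice P) (t : MaximalTorus P) :
    kappa (-η) t = (kappa η t)⁻¹ := by
  simp [kappa, MaximalTorus.pow]

theorem continuous_kappa : Continuous fun x : IntegralLattice P × MaximalTorus P =>
    kappa x.1 x.2 := by
  refine continuous_prod_of_discrete_left.mpr fun η => ?_
  exact (continuous_eval_const (F := C(Multiplicative (WeightLattice P), Circle))
    (Multiplicative.ofAdd (-flat P η))).comp
    (ContinuousMonoidHom.isInducing_toContinuousMap (Multiplicative (WeightLattice P))
      Circle).continuous

instance : Mul (TorusExt P ε k) where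
  mul a b := ⟨a.torus * b.torus, a.lattice + b.lattice,
    kappa a.lattice b.torus ^ k * (-1) ^ (k * ε a.lattice b.lattice) * a.phase * b.phase⟩

instance : Inv (TorusExt P ε k) where
  inv a := ⟨a.torus⁻¹, -a.lattice,
    kappa a.lattice a.torus ^ k * (-1) ^ (k * ε a.lattice a.lattice) * a.phase⁻¹⟩

theorem mul_def (a b : TorusExt P ε k) : a * b = ⟨a.torus * b.torus, a.lattice + b.lattice,
    kappa a.lattice b.torus ^ k * (-1) ^ (k * ε a.lattice b.lattice) * a.phase * b.phase⟩ := rfl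

theorem inv_def (a : TorusExt P ε k) : a⁻¹ = ⟨a.torus⁻¹, -a.lattice,
    kappa a.lattice a.torus ^ k * (-1) ^ (k * ε a.lattice a.lattice) * a.phase⁻¹⟩ := rfl

instance : Group (TorusExt P ε k) := Group.ofLeftAxioms
  (fun a b c => by
    simp only [mul_def, TorusExt.mk.injEq, mul_assoc, add_assoc, true_and]
    simp only [kappa_mul, kappa_add, map_add, LinearMap.add_apply, mul_add, zpow_add, mul_zpow]
    generalize kappa a.lattice b.torus ^ k = x₁
    generalize kappa a.lattice c.torus ^ k = x₂
    generalize kappa b.lattice c.torus ^ k = x₃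
    generalize (-1 : Circle) ^ (k * ε a.lattice b.lattice) = y₁
    generalize (-1 : Circle) ^ (k * ε a.lattice c.lattice) = y₂
    generalize (-1 : Circle) ^ (k * ε b.lattice c.lattice) = y₃
    ac_rfl)
  (fun a => by simp [mul_def, one_def, kappa_zero])
  (fun a => by
    simp only [mul_def, one_def, inv_def, TorusExt.mk.injEq, inv_mul_cancel, neg_add_cancel,
      kappa_neg, map_neg, LinearMap.neg_apply, mul_neg, zpow_neg, inv_zpow, true_and]
    rw [← mul_inv, mul_assoc, mul_assoc, inv_mul_cancel, mul_one, inv_mul_cancel])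

instance : IsTopologicalGroup (TorusExt P ε k) where
  continuous_mul := by
    refine continuous_induced_rng.2 ?_
    have h1 : Continuous fun x : TorusExt P ε k × TorusExt P ε k =>
        kappa x.1.lattice x.2.torus ^ k :=
      (continuous_kappa.comp ((continuous_lattice.comp continuous_fst).prodMk
        (continuous_torus.comp continuous_snd))).zpow k
    have h2 : Continuous fun x : TorusExt P ε k × TorusExt P ε k =>
        ((-1 : Circle) ^ (k * ε x.1.lattice x.2.lattice)) :=
      (continuous_of_discreteTopology (f := fun y : IntegralLattice P × IntegralLattice P =>
        ((-1 : Circle) ^ (k * ε y.1 y.2)))).comp ((continuous_lattice.comp continuous_fst).prodMk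
        (continuous_lattice.comp continuous_snd))
    exact ((continuous_torus.comp continuous_fst).mul (continuous_torus.comp continuous_snd)).prodMk
      (((continuous_lattice.comp continuous_fst).add (continuous_lattice.comp continuous_snd)).prodMk
        (((h1.mul h2).mul (continuous_phase.comp continuous_fst)).mul
          (continuous_phase.comp continuous_snd)))
  continuous_inv := by
    refine continuous_induced_rng.2 ?_
    have h1 : Continuous fun x : TorusExt P ε k => kappa x.lattice x.torus ^ k :=
      (continuous_kappa.comp (continuous_lattice.prodMk continuous_torus)).zpow k
    have h2 : Continuous fun x : TorusExt P ε k =>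
        ((-1 : Circle) ^ (k * ε x.lattice x.lattice)) :=
      (continuous_of_discreteTopology (f := fun y : IntegralLattice P =>
        ((-1 : Circle) ^ (k * ε y y)))).comp continuous_lattice
    exact continuous_torus.inv.prodMk
      (continuous_lattice.neg.prodMk ((h1.mul h2).mul continuous_phase.inv))

/-- The central circle. -/
def central : Circle →* TorusExt P ε k where
  toFun z := ⟨1, 0, z⟩
  map_one' := rfl
  map_mul' z w := by simp [mul_def, kappa_one]

end TorusExt

end Groups

/-! ## Cosets, block algebras and formal characters -/

section Blocks

variable {ι : Type*} {V W : Type*} [Fintype ι] [AddCommGroup V] [Module ℝ V] [AddCommGroup W]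
  [Module ℝ W] (P : RootPairing ι ℝ V W) [P.IsCrystallographic] [P.IsReduced] [P.IsIrreducible]

/-- The sublattice `ℓΠ` of `Π*`, where `Π ⊆ Π*` by means of the basic inner product. -/
def levelLattice (ℓ : ℤ) : AddSubgroup (WeightLattice P) := (ℓ • flat P).range

/-- The set `Π*/ℓΠ` of cosets. -/
abbrev LevelQuotient (ℓ : ℤ) : Type _ := WeightLattice P ⧸ levelLattice P ℓ

variable {P}

/-- The Hilbert space `L²([ξ])` of a coset `[ξ] ⊆ Π*`. -/
abbrev CosetL2 {ℓ : ℤ} (q : LevelQuotient P ℓ) : Type _ :=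
  lp (fun _ : {μ : WeightLattice P // (μ : LevelQuotient P ℓ) = q} => ℂ) 2

variable (P) in
/-- The C*-algebra `⨁_{[ξ] ∈ Π*/ℓΠ} 𝕂(L²([ξ]))`. -/
abbrev BlockAlgebra (ℓ : ℤ) :=
  CStarSumAlgebra fun q : LevelQuotient P ℓ => CompactAlgebra (CosetL2 q)

/-- The component in `𝕂(L²([ξ]))` of an element of the direct sum. -/
def blockComponent {ℓ : ℤ} (x : BlockAlgebra P ℓ) (q : LevelQuotient P ℓ) :
    CosetL2 q →L[ℂ] CosetL2 q := (x.component q).toOperator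

open Classical in
/-- Matrix coefficients of the Schrödinger representation of `T ⋉ Π^triv` on `L²(Π*)`, with central
circle of weight `n`: `(t, η, z) δ_μ = zⁿ t^(μ + ℓη) δ_(μ + ℓη)`. This is the coefficient of
`δ_ν`. -/
def schrodingerCoeff {k : ℤ} (ℓ n : ℤ) (g : TorusExt P 0 k) (μ ν : WeightLattice P) : ℂ :=
  if ν = μ + ℓ • flat P g.lattice then ((g.phase ^ n * g.torus.pow ν : Circle) : ℂ) else 0

open Classical in
/-- The isomorphism `φ` from the `n`-th homogeneous ideal of a group `Γ` to the block algebra is the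
one determined by `Φ : Γ → T ⋉ Π^triv`: on functions it is the integrated form
`f ↦ ∫ f(g) ρ(Φ(g)) dg` of the Schrödinger representation `ρ`. -/
def IsDeterminedBy {k : ℤ} {ε : LinearMap.BilinForm ℤ (IntegralLattice P)} {ℓ n : ℤ}
    (Φ : TorusExt P ε k ≃ₜ* TorusExt P 0 k)
    (φ : HomogAlgebra (TorusExt.central (P := P) (ε := ε) (k := k)) n ≃⋆ₐ[ℂ] BlockAlgebra P ℓ) :
    Prop :=
  ∀ (f : C_c(TorusExt P ε k, ℂ)) (hf : IsHomogeneous TorusExt.central n f)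
    (q : LevelQuotient P ℓ) (μ ν : {μ : WeightLattice P // (μ : LevelQuotient P ℓ) = q}),
    (blockComponent (φ (homogeneousElement TorusExt.central n f hf)) q (lp.single 2 μ 1)) ν =
      ∫ g, f g * schrodingerCoeff ℓ n (Φ g) μ ν ∂Measure.haar

variable (P) in
/-- The group `R^{-∞}(T)^{ℓΠ}` of formal characters `∑ a_ξ e_ξ`, `ξ ∈ Π* = Irr(T)`, with integer
coefficients such that `a_(ξ + ℓη) = a_ξ` for all `η ∈ Π`. -/
def InvariantFormalCharacters (ℓ : ℤ) : AddSubgroup (WeightLattice P → ℤ) where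
  carrier := {a | ∀ (ξ : WeightLattice P) (η : IntegralLattice P), a (ξ + ℓ • flat P η) = a ξ}
  zero_mem' _ _ := rfl
  add_mem' ha hb ξ η := by simp [ha ξ η, hb ξ η]
  neg_mem' ha ξ η := by simp [ha ξ η]

end Blocks

end

/-! The sign cocycle can be removed by translations in the torus. The form `B` is nondegenerate, so
Π and Π* span the same real space and ε extends to a real-valued form on Π* × Π. The characters
exp(iπ ε(·, η)) of Π* then define a homomorphism s : Π → T with κ_η(s(ζ)) = (-1)^ε(η, ζ), and (t, η,
z) ↦ (t s(η), η, z) is an isomorphism onto the untwisted group (`kappa_twist`, `untwist`). The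
C*-algebraic arguments concern any group `G` with an isomorphism `Φ` to `TorusExt P 0 k`.

The subgroup T × U(1) is compact and open, and the vectors in a unitary representation on which it
acts by the character zⁿ t^ξ are those of weight (n, ξ). By the commutation relation the element (1,
η, 1) carries weight (n, ξ) to weight (n, ξ + knη). The operators "translation by η after projection
to the weight (n, ξ)" are integrals of multiples of characters supported on single sheets T × {η} ×
U(1). These are the wave units. They multiply like the arrows of the transformation groupoid of Π
acting on the pairs (n, ξ) (`waveUnit_mul_same`, `waveUnit_mul_of_ne`, `star_waveUnit`). By
Stone-Weierstrass on each sheet they span a dense subspace of C*(G), and those with fixed n span a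
dense subspace of the n-th homogeneous ideal (`groupCStar_eq_closure`, `homogIdeal_eq_closure`). As
n never changes, the ideals are mutually orthogonal, and C*(G) is their direct sum.

Put ℓ = kn. If ℓ ≠ 0, then Π acts freely on Π* by translations by ℓη, the orbits are the cosets, and
the wave units are matrix units. The Schrödinger representations take them to the standard matrix
units. They are jointly faithful because cutting an element down by two weights of one coset leaves
a scalar multiple of a single wave unit, and the scalar is a matrix coefficient of the Schrödinger
representation (`waveElt_mul_mul_waveElt`). If n = 0, the action on weights is trivial, the ideal is
commutative, its characters are given by pairs (ξ, χ), and Gelfand duality applies.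

For the K-theory, Π*/ℓΠ is finite, so `K₀` of a finite direct sum of algebras of compact operators
is needed. Rank-one projections generate it: a projection over the unitization is almost scalar
outside a projection `f` of the algebra, and it differs from its scalar part by classes of
projections over the algebra itself (`exists_sub_scalarPart_eq`), which decompose into rank-one
projections. These classes are independent: a projection of class zero is absorbed by an identity
matrix, and by the Fredholm alternative one-sided inverses over scalars plus compact operators act
as two-sided ones, so the projection acts as zero. Finally, any two trivializations that fix T and
U(1) agree on the identity sheet. They have the same weight projections, whose classes generate
`K₀`, so the rank isomorphism does not depend on the choice. -/

noncomputable section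

/-! ## Isomorphisms of C*-algebras from injective *-homomorphisms -/

section StarHoms

/-- Two injective *-homomorphisms of C*-algebras with the same range differ by an isomorphism. -/
theorem exists_starAlgEquiv_of_range_eq {A B C : Type*} [NonUnitalCStarAlgebra A]
    [NonUnitalCStarAlgebra B] [NonUnitalCStarAlgebra C] (ψ : A →⋆ₙₐ[ℂ] C) (i : B →⋆ₙₐ[ℂ] C)
    (hψ : Function.Injective ψ) (hi : Function.Injective i) (h : Set.range ψ = Set.range i) :
    ∃ φ : A ≃⋆ₐ[ℂ] B, ∀ a, i (φ a) = ψ a := by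
  have h1 : ∀ a, ∃ b, i b = ψ a := fun a => h.subset ⟨a, rfl⟩
  choose f hf using h1
  have h2 : ∀ b, ∃ a, ψ a = i b := fun b => h.symm.subset ⟨b, rfl⟩
  choose g hg using h2
  refine ⟨{ toFun := f, invFun := g, left_inv := fun a => hψ (by rw [hg, hf]),
            right_inv := fun b => hi (by rw [hf, hg]), map_mul' := ?_, map_add' := ?_,
            map_star' := ?_, map_smul' := ?_ }, hf⟩
  · exact fun a b => hi (by simp [hf])
  · exact fun a b => hi (by simp [hf])
  · exact fun a => hi (by simp [hf, map_star])
  · exact fun c a => hi (by simp [hf])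

/-- An injective *-homomorphism of C*-algebras has closed range. -/
theorem isClosed_range_of_injective {A C : Type*} [NonUnitalCStarAlgebra A]
    [NonUnitalCStarAlgebra C] (ψ : A →⋆ₙₐ[ℂ] C) (hψ : Function.Injective ψ) :
    IsClosed (Set.range ψ) :=
  (NonUnitalStarAlgHom.isometry ψ hψ).isClosedEmbedding.isClosed_range

theorem continuous_starAlgHom {A C : Type*} [NonUnitalCStarAlgebra A]
    [NonUnitalCStarAlgebra C] (ψ : A →⋆ₙₐ[ℂ] C) : Continuous ψ :=
  AddMonoidHomClass.continuous_of_bound ψ 1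
    fun x => by simpa using NonUnitalStarAlgHom.norm_apply_le ψ x

/-- If two *-homomorphisms map dense linear subspaces onto the same set, and are injective, then
they differ by an isomorphism. -/
theorem exists_starAlgEquiv_of_dense {A B C : Type*} [NonUnitalCStarAlgebra A]
    [NonUnitalCStarAlgebra B] [NonUnitalCStarAlgebra C] (ψ : A →⋆ₙₐ[ℂ] C) (i : B →⋆ₙₐ[ℂ] C)
    (hψ : Function.Injective ψ) (hi : Function.Injective i) {J : Type*} (a : J → A) (b : J → B)
    (hab : ∀ j, ψ (a j) = i (b j))
    (ha : ∀ x, x ∈ closure (Submodule.span ℂ (Set.range a) : Set A))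
    (hb : ∀ x, x ∈ closure (Submodule.span ℂ (Set.range b) : Set B)) :
    ∃ φ : A ≃⋆ₐ[ℂ] B, ∀ a, i (φ a) = ψ a := by
  refine exists_starAlgEquiv_of_range_eq ψ i hψ hi (Set.Subset.antisymm ?_ ?_)
  · rintro _ ⟨x, rfl⟩
    -- The range of `i` is closed, so only the dense span has to be shown to land in it.
    refine closure_minimal ?_ ((isClosed_range_of_injective i hi).preimage
      (continuous_starAlgHom ψ)) (ha x)
    intro y hy
    induction hy using Submodule.span_induction with
    | mem y hy => obtain ⟨j, rfl⟩ := hy; exact ⟨b j, (hab j).symm⟩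
    | zero => exact ⟨0, by simp⟩
    | add y z _ _ hy hz =>
      obtain ⟨y', hy'⟩ := hy
      obtain ⟨z', hz'⟩ := hz
      exact ⟨y' + z', by simp [hy', hz']⟩
    | smul c y _ hy => obtain ⟨y', hy'⟩ := hy; exact ⟨c • y', by simp [hy']⟩
  · rintro _ ⟨x, rfl⟩
    refine closure_minimal ?_ ((isClosed_range_of_injective ψ hψ).preimage
      (continuous_starAlgHom i)) (hb x)
    intro y hy
    induction hy using Submodule.span_induction with
    | mem y hy => obtain ⟨j, rfl⟩ := hy; exact ⟨a j, hab j⟩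
    | zero => exact ⟨0, by simp⟩
    | add y z _ _ hy hz =>
      obtain ⟨y', hy'⟩ := hy
      obtain ⟨z', hz'⟩ := hz
      exact ⟨y' + z', by simp [hy', hz']⟩
    | smul c y _ hy => obtain ⟨y', hy'⟩ := hy; exact ⟨c • y', by simp [hy']⟩

/-- Evaluation of bounded families at an index. -/
def lpEval {I : Type*} (A : I → Type*) [∀ i, NonUnitalCStarAlgebra (A i)] (i : I) :
    lp A ∞ →⋆ₙₐ[ℂ] A i where
  toFun a := a i
  map_smul' _ _ := rfl
  map_zero' := rfl
  map_add' _ _ := rfl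
  map_mul' _ _ := rfl
  map_star' _ := rfl

/-- The *-homomorphism to bounded families with given components. -/
def lpLift {I : Type*} {A : I → Type*} [∀ i, NonUnitalCStarAlgebra (A i)] {B : Type*}
    [NonUnitalCStarAlgebra B] (f : ∀ i, B →⋆ₙₐ[ℂ] A i) : B →⋆ₙₐ[ℂ] lp A ∞ where
  toFun b := ⟨fun i => f i b, memℓp_infty ⟨‖b‖, by
    rintro _ ⟨i, rfl⟩
    exact NonUnitalStarAlgHom.norm_apply_le (f i) b⟩⟩
  map_smul' c b := lp.ext (funext fun i => map_smul (f i) c b)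
  map_zero' := lp.ext (funext fun i => map_zero (f i))
  map_add' a b := lp.ext (funext fun i => map_add (f i) a b)
  map_mul' a b := lp.ext (funext fun i => map_mul (f i) a b)
  map_star' a := lp.ext (funext fun i => map_star (f i) a)

/-- The inclusion of compact operators into bounded operators. -/
def compactInclusion (H : Type*) [NormedAddCommGroup H] [InnerProductSpace ℂ H]
    [CompleteSpace H] : CompactAlgebra H →⋆ₙₐ[ℂ] (H →L[ℂ] H) :=
  NonUnitalStarSubalgebraClass.subtype (CompactOperators H)

theorem compactInclusion_injective (H : Type*) [NormedAddCommGroup H] [InnerProductSpace ℂ H]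
    [CompleteSpace H] : Function.Injective (compactInclusion H) := Subtype.val_injective

/-- The inclusion of the direct sum into the algebra of bounded families. -/
def sumInclusion {I : Type*} (A : I → Type*) [∀ i, NonUnitalCStarAlgebra (A i)] :
    CStarSumAlgebra A →⋆ₙₐ[ℂ] lp A ∞ :=
  NonUnitalStarSubalgebraClass.subtype (CStarSum A)

/-- The components of an element of a direct sum, as a *-homomorphism. -/
def sumComponent {I : Type*} (A : I → Type*) [∀ i, NonUnitalCStarAlgebra (A i)] (i : I) :
    CStarSumAlgebra A →⋆ₙₐ[ℂ] A i := (lpEval A i).comp (sumInclusion A)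

theorem sumComponent_apply {I : Type*} {A : I → Type*} [∀ i, NonUnitalCStarAlgebra (A i)]
    (x : CStarSumAlgebra A) (i : I) : sumComponent A i x = x.component i := rfl

theorem CStarSumAlgebra.ext {I : Type*} {A : I → Type*} [∀ i, NonUnitalCStarAlgebra (A i)]
    {x y : CStarSumAlgebra A} (h : ∀ i, x.component i = y.component i) : x = y :=
  Subtype.ext (lp.ext (funext h))

theorem CStarSumAlgebra.tendsto_norm {I : Type*} {A : I → Type*}
    [∀ i, NonUnitalCStarAlgebra (A i)] (x : CStarSumAlgebra A) :
    Tendsto (fun i => ‖x.component i‖) cofinite (𝓝 0) := x.2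

theorem CStarSumAlgebra.norm_le {I : Type*} {A : I → Type*} [∀ i, NonUnitalCStarAlgebra (A i)]
    {x : CStarSumAlgebra A} {C : ℝ} (hC : 0 ≤ C) (h : ∀ i, ‖x.component i‖ ≤ C) : ‖x‖ ≤ C :=
  lp.norm_le_of_forall_le hC h

open Classical in
/-- The inclusion of a summand into a direct sum. -/
def sumSingle {I : Type*} (A : I → Type*) [∀ i, NonUnitalCStarAlgebra (A i)] (i : I) :
    A i →⋆ₙₐ[ℂ] CStarSumAlgebra A where
  toFun a := ⟨⟨Pi.single i a, memℓp_infty ⟨‖a‖, by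
      rintro _ ⟨j, rfl⟩
      by_cases h : j = i
      · subst h; simp
      · simp [Pi.single_eq_of_ne h]⟩⟩, by
      refine tendsto_const_nhds.congr' ?_
      filter_upwards [(Set.finite_singleton i).compl_mem_cofinite] with j hj
      simp [Pi.single_eq_of_ne (show j ≠ i from hj)]⟩
  map_smul' c a := CStarSumAlgebra.ext fun j => by
    by_cases h : j = i
    · subst h
      exact (Pi.single_eq_same j (c • a)).trans (congrArg (c • ·) (Pi.single_eq_same j a).symm)
    · exact (Pi.single_eq_of_ne h (c • a)).trans
        ((smul_zero c).symm.trans (congrArg (c • ·) (Pi.single_eq_of_ne h a).symm))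
  map_zero' := CStarSumAlgebra.ext fun j => by
    change (Pi.single i (0 : A i) : ∀ i, A i) j = 0
    simp
  map_add' a b := CStarSumAlgebra.ext fun j => congrFun (Pi.single_add i a b) j
  map_mul' a b := CStarSumAlgebra.ext fun j => congrFun (Pi.single_mul i a b) j
  map_star' a := CStarSumAlgebra.ext fun j => congrFun (Pi.single_star i a) j

theorem sumSingle_component_same {I : Type*} {A : I → Type*} [∀ i, NonUnitalCStarAlgebra (A i)]
    (i : I) (a : A i) : (sumSingle A i a).component i = a := by
  classical exact Pi.single_eq_same i a

theorem sumSingle_component_of_ne {I : Type*} {A : I → Type*}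
    [∀ i, NonUnitalCStarAlgebra (A i)] {i j : I} (h : j ≠ i) (a : A i) :
    (sumSingle A i a).component j = 0 := by
  classical exact Pi.single_eq_of_ne h a

/-- Elements of finite support are dense in a direct sum. -/
theorem mem_closure_span_sumSingle {I : Type*} {A : I → Type*}
    [∀ i, NonUnitalCStarAlgebra (A i)] (x : CStarSumAlgebra A) :
    x ∈ closure (Submodule.span ℂ {y | ∃ i a, y = sumSingle A i a} : Set (CStarSumAlgebra A)) := by
  rw [Metric.mem_closure_iff]
  intro ε hε
  have h1 := x.tendsto_norm.eventually (gt_mem_nhds (half_pos hε))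
  -- The indices with component of norm at least `ε / 2`; dropping all the others costs at most `ε /
  -- 2` in the supremum norm.
  let s := (Filter.eventually_cofinite.1 h1).toFinset
  refine ⟨∑ i ∈ s, sumSingle A i (x.component i),
    Submodule.sum_mem _ fun i _ => Submodule.subset_span ⟨i, _, rfl⟩, ?_⟩
  rw [dist_eq_norm]
  refine (CStarSumAlgebra.norm_le (half_pos hε).le fun i => ?_).trans_lt (half_lt_self hε)
  have h2 : (x - ∑ i ∈ s, sumSingle A i (x.component i)).component i =
      x.component i - ∑ j ∈ s, (sumSingle A j (x.component j)).component i := by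
    simp only [← sumComponent_apply, map_sub, map_sum]
  rw [h2]
  by_cases hi : i ∈ s
  · rw [Finset.sum_eq_single_of_mem i hi fun j _ hj => sumSingle_component_of_ne hj.symm _,
      sumSingle_component_same, sub_self, norm_zero]
    exact (half_pos hε).le
  · rw [Finset.sum_eq_zero fun j hj => sumSingle_component_of_ne
      (fun h : i = j => hi (h ▸ hj)) _, sub_zero]
    have : ¬ ¬ (‖x.component i‖ < ε / 2) := by simpa [s] using hi
    exact (not_not.1 this).le

end StarHoms
end

noncomputable section

/-! ## The universal representation -/

section UniversalRep

universe u

variable {G : Type u} [Group G] [TopologicalSpace G]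

/-- Evaluation of a family of operators at a representation. -/
def evalRep (π : UnitaryRep G) : UniversalOperators G →⋆ₙₐ[ℂ] (π.H →L[ℂ] π.H) :=
  lpEval (fun π : UnitaryRep G => π.H →L[ℂ] π.H) π

theorem evalRep_ext {a b : UniversalOperators G} (h : ∀ π, evalRep π a = evalRep π b) : a = b :=
  lp.ext (funext h)

variable [IsTopologicalGroup G] [LocallyCompactSpace G] [MeasurableSpace G] [BorelSpace G]

theorem evalRep_universalRep (π : UnitaryRep G) (f : C_c(G, ℂ)) :
    evalRep π (universalRep f) = π.integrated f := rfl

theorem universalRep_add (f g : C_c(G, ℂ)) :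
    universalRep (f + g) = universalRep f + universalRep g := by
  refine evalRep_ext fun π => ContinuousLinearMap.ext fun h => ?_
  rw [map_add, evalRep_universalRep, evalRep_universalRep, evalRep_universalRep,
    _root_.add_apply, π.integrated_apply, π.integrated_apply, π.integrated_apply,
    ← integral_add (π.integrable_smul_act f h) (π.integrable_smul_act g h)]
  simp [add_smul]

theorem universalRep_smul (c : ℂ) (f : C_c(G, ℂ)) :
    universalRep (c • f) = c • universalRep f := by
  refine evalRep_ext fun π => ContinuousLinearMap.ext fun h => ?_
  rw [map_smul, evalRep_universalRep, evalRep_universalRep,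
    _root_.smul_apply, π.integrated_apply, π.integrated_apply, ← integral_smul]
  simp [mul_smul]

/-- The map `f ↦ (π(f))_π` as a linear map. -/
def universalRepLinear : C_c(G, ℂ) →ₗ[ℂ] UniversalOperators G where
  toFun := universalRep
  map_add' := universalRep_add
  map_smul' := universalRep_smul

theorem norm_universalRep_le (f : C_c(G, ℂ)) :
    ‖universalRep f‖ ≤ ∫ g, ‖f g‖ ∂Measure.haar :=
  lp.norm_le_of_forall_le (integral_nonneg fun _ => norm_nonneg _) fun π => π.norm_integrated_le f

/-- Left translation of compactly supported functions turns into multiplication by the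
representation. -/
theorem UnitaryRep.act_integrated (π : UnitaryRep G) (h : G) (f f' : C_c(G, ℂ))
    (hf : ∀ g, f' (h * g) = f g) (v : π.H) :
    (π.act h : π.H →L[ℂ] π.H) (π.integrated f v) = π.integrated f' v := by
  -- Left invariance of Haar measure absorbs the translation by `h`.
  rw [π.integrated_apply, π.integrated_apply,
    ← integral_mul_left_eq_self (fun g => f' g • (π.act g : π.H →L[ℂ] π.H) v) h,
    ← ContinuousLinearMap.integral_comp_comm _ (π.integrable_smul_act f v)]
  refine integral_congr_ae (Eventually.of_forall fun g => ?_)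
  simp only [hf, map_smul, map_mul]
  rfl

/-- The inclusion of a homogeneous ideal. -/
def homogInclusion (c : Circle →* G) (n : ℤ) : HomogAlgebra c n →⋆ₙₐ[ℂ] UniversalOperators G :=
  NonUnitalStarSubalgebraClass.subtype (HomogIdeal c n)

theorem homogInclusion_injective (c : Circle →* G) (n : ℤ) :
    Function.Injective (homogInclusion c n) := Subtype.val_injective

variable (G) in
/-- The inclusion of the group C*-algebra. -/
def groupInclusion : GroupCStarAlgebra G →⋆ₙₐ[ℂ] UniversalOperators G :=
  NonUnitalStarSubalgebraClass.subtype (GroupCStar G)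

theorem groupInclusion_apply (a : GroupCStarAlgebra G) :
    groupInclusion G a = a.toOperators := rfl

theorem groupInclusion_injective : Function.Injective (groupInclusion G) := Subtype.val_injective

end UniversalRep

/-! ## Monomial representations -/

section Monomial

universe u

variable {G : Type u} [Group G] {I : Type u}

/-- Data for a monomial representation: `g δ_i = c(g, i) δ_(g i)`. -/
structure MonomialData (G : Type u) [Group G] (I : Type u) where
  perm : G →* Equiv.Perm I
  coeff : G → I → Circle
  coeff_mul : ∀ g h i, coeff (g * h) i = coeff g (perm h i) * coeff h i

namespace MonomialData

variable (D : MonomialData G I)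

theorem coeff_one (i : I) : D.coeff 1 i = 1 := by
  have h := D.coeff_mul 1 1 i
  simpa using h

/-- The function `g v` on the index set. -/
def toFun (g : G) (v : I → ℂ) : I → ℂ :=
  fun j => D.coeff g ((D.perm g).symm j) * v ((D.perm g).symm j)

theorem norm_toFun (g : G) (v : I → ℂ) (j : I) :
    ‖D.toFun g v j‖ = ‖v ((D.perm g).symm j)‖ := by
  rw [toFun, norm_mul, Circle.norm_coe, one_mul]

theorem memℓp_toFun (g : G) (v : lp (fun _ : I => ℂ) 2) : Memℓp (D.toFun g v) 2 := by
  refine memℓp_gen ?_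
  have h := (lp.memℓp v).summable (by simp)
  simp only [norm_toFun]
  exact (Equiv.summable_iff (D.perm g).symm).2 h

/-- The action on square-summable functions. -/
def linear (g : G) : lp (fun _ : I => ℂ) 2 →ₗᵢ[ℂ] lp (fun _ : I => ℂ) 2 where
  toFun v := ⟨D.toFun g v, D.memℓp_toFun g v⟩
  map_add' v w := lp.ext (funext fun j => mul_add _ _ _)
  map_smul' c v := lp.ext (funext fun j => mul_left_comm _ _ _)
  norm_map' v := by
    rw [lp.norm_eq_tsum_rpow (by simp), lp.norm_eq_tsum_rpow (by simp)]
    congr 1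
    change ∑' j, ‖D.toFun g v j‖ ^ _ = _
    simp only [norm_toFun]
    exact Equiv.tsum_eq (D.perm g).symm fun j => ‖v j‖ ^ (2 : ℝ≥0∞).toReal

theorem linear_apply (g : G) (v : lp (fun _ : I => ℂ) 2) (j : I) :
    D.linear g v j = D.coeff g ((D.perm g).symm j) * v ((D.perm g).symm j) := rfl

theorem linear_mul (g h : G) (v : lp (fun _ : I => ℂ) 2) :
    D.linear (g * h) v = D.linear g (D.linear h v) := by
  refine lp.ext (funext fun j => ?_)
  have h1 : (D.perm (g * h)).symm j = (D.perm h).symm ((D.perm g).symm j) := by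
    rw [map_mul]; rfl
  rw [linear_apply, linear_apply, linear_apply, D.coeff_mul, h1, Equiv.apply_symm_apply]
  push_cast
  ring

theorem linear_one (v : lp (fun _ : I => ℂ) 2) : D.linear 1 v = v := by
  refine lp.ext (funext fun j => ?_)
  rw [linear_apply, map_one, D.coeff_one, Circle.coe_one, one_mul]
  rfl

/-- The action by linear isometry equivalences. -/
def equiv (g : G) : lp (fun _ : I => ℂ) 2 ≃ₗᵢ[ℂ] lp (fun _ : I => ℂ) 2 where
  __ := D.linear g
  invFun := D.linear g⁻¹
  left_inv v := by
    change D.linear g⁻¹ (D.linear g v) = v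
    rw [← linear_mul, inv_mul_cancel, linear_one]
  right_inv v := by
    change D.linear g (D.linear g⁻¹ v) = v
    rw [← linear_mul, mul_inv_cancel, linear_one]

variable [DecidableEq I]

theorem linear_single (g : G) (i : I) :
    D.linear g (lp.single 2 i 1) = (D.coeff g i : ℂ) • lp.single 2 (D.perm g i) (1 : ℂ) := by
  refine lp.ext (funext fun j => ?_)
  rw [linear_apply, lp.coeFn_smul, Pi.smul_apply]
  by_cases h : j = D.perm g i
  · subst h
    simp
  · have h' : (D.perm g).symm j ≠ i := fun h0 => h (by rw [← h0, Equiv.apply_symm_apply])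
    simp [lp.single_apply, h, h']

variable [TopologicalSpace G]

/-- A monomial representation on square-summable functions. -/
def rep (hD : ∀ i : I, Continuous fun g => D.linear g (lp.single 2 i 1)) : UnitaryRep G where
  H := lp (fun _ : I => ℂ) 2
  act :=
    { toFun := fun g => Unitary.linearIsometryEquiv.symm (D.equiv g)
      map_one' := by
        refine Subtype.ext (ContinuousLinearMap.ext fun v => ?_)
        exact D.linear_one v
      map_mul' := fun g h => by
        refine Subtype.ext (ContinuousLinearMap.ext fun v => ?_)
        exact D.linear_mul g h v }
  continuous_act := fun v => by
    change Continuous fun g => D.linear g v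
    have h1 : ∀ w ∈ Submodule.span ℂ (Set.range fun i : I => lp.single 2 i (1 : ℂ)),
        Continuous fun g => D.linear g w := by
      intro w hw
      induction hw using Submodule.span_induction with
      | mem w hw => obtain ⟨i, rfl⟩ := hw; exact hD i
      | zero => simpa using continuous_const
      | add x y _ _ hx hy => simp only [map_add]; exact hx.add hy
      | smul c x _ hx => simp only [map_smul]; exact hx.const_smul c
    have h2 : v ∈ closure (Submodule.span ℂ
        (Set.range fun i : I => (lp.single 2 i (1 : ℂ) : lp (fun _ : I => ℂ) 2)) :
          Set (lp (fun _ : I => ℂ) 2)) := by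
      refine mem_closure_of_tendsto (lp.hasSum_single (by simp) v)
        (Eventually.of_forall fun s => ?_)
      refine Submodule.sum_mem _ fun i _ => ?_
      have : lp.single 2 i (v i) = v i • (lp.single 2 i (1 : ℂ) : lp (fun _ : I => ℂ) 2) := by
        rw [← lp.single_smul, smul_eq_mul, mul_one]
      rw [this]
      exact Submodule.smul_mem _ _ (Submodule.subset_span ⟨i, rfl⟩)
    -- The operators are isometric, so approximating `v` by a finite combination of basis vectors
    -- approximates its orbit map uniformly in `g`.
    refine continuous_of_uniform_approx_of_continuous fun U hU => ?_
    obtain ⟨ε, hε, hεU⟩ := Metric.mem_uniformity_dist.1 hU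
    obtain ⟨w, hw, hvw⟩ := Metric.mem_closure_iff.1 h2 ε hε
    refine ⟨_, h1 w hw, fun g => hεU ?_⟩
    rwa [(D.linear g).dist_map]

end MonomialData

end Monomial
end

noncomputable section

/-! ## The lattices -/

section Weights

variable {ι V W : Type*} [AddCommGroup V] [Module ℝ V] [AddCommGroup W] [Module ℝ W]
  (P : RootPairing ι ℝ V W)

instance : FunLike (WeightLattice P) (IntegralLattice P) ℤ :=
  inferInstanceAs (FunLike (IntegralLattice P →+ ℤ) (IntegralLattice P) ℤ)

variable {P}

theorem WeightLattice.ext {ξ ζ : WeightLattice P} (h : ∀ x, ξ x = ζ x) : ξ = ζ :=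
  AddMonoidHom.ext h

theorem WeightLattice.zsmul_apply (n : ℤ) (ξ : WeightLattice P) (x : IntegralLattice P) :
    (n • ξ) x = n * ξ x :=
  (AddMonoidHom.zsmul_apply (N := ℤ) ξ n x).trans (smul_eq_mul _ _)

theorem WeightLattice.sum_apply {J : Type*} (s : Finset J) (ξ : J → WeightLattice P)
    (x : IntegralLattice P) : (∑ j ∈ s, ξ j) x = ∑ j ∈ s, ξ j x :=
  AddMonoidHom.finsetSum_apply (M := IntegralLattice P) (N := ℤ) ξ s x

end Weights

section Lattice

variable {ι V W : Type*} [Fintype ι] [AddCommGroup V] [Module ℝ V] [AddCommGroup W]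
  [Module ℝ W] (P : RootPairing ι ℝ V W)

/-- The form is a positive multiple of the sum of the squares of all roots. A null vector is
therefore annihilated by every root, and the roots span `V`. -/
theorem basicInner_self_eq_zero [P.IsRootSystem] [Nonempty ι] {x : W}
    (h : basicInner P x x = 0) : x = 0 := by
  obtain ⟨m, hm⟩ := exists_eq_ciInf_of_finite
    (f := fun i => P.CorootForm (P.coroot i) (P.coroot i))
  have hpos := corootForm_coroot_pos P m
  rw [hm] at hpos
  rw [basicInner, LinearMap.smul_apply, LinearMap.smul_apply, smul_eq_mul, mul_eq_zero] at h
  have h1 := h.resolve_left (by positivity)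
  rw [P.corootForm_apply_apply, Finset.sum_eq_zero_iff_of_nonneg fun i _ => mul_self_nonneg _] at h1
  have h2 : P.flip.toLinearMap x = 0 := by
    refine LinearMap.ext_on_range (v := P.root) (RootPairing.IsRootSystem.span_root_eq_top) ?_
    intro i
    exact mul_self_eq_zero.1 (h1 i (Finset.mem_univ i))
  exact P.flip.toPerfPair.injective (h2.trans (map_zero _).symm)

variable [P.IsCrystallographic] [P.IsReduced] [P.IsIrreducible]

theorem flat_injective [P.IsRootSystem] : Function.Injective (flat P) := by
  refine (injective_iff_map_eq_zero _).2 fun x hx => ?_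
  -- Without roots the space they span would be zero, but irreducibility includes nontriviality. A
  -- root is needed for the infimum that normalises the form to be attained.
  have hne : Nonempty ι := by
    by_contra h
    rw [not_nonempty_iff] at h
    have : Subsingleton V := by
      have h1 := RootPairing.IsRootSystem.span_root_eq_top (P := P)
      rw [Set.range_eq_empty, Submodule.span_empty] at h1
      exact (Submodule.subsingleton_iff ℝ).1 (subsingleton_of_bot_eq_top h1)
    have := RootPairing.IsIrreducible.nontrivial (P := P)
    exact not_subsingleton V ‹_›
  have h1 : latticeInner P x x = 0 := DFunLike.congr_fun hx x
  have h2 := latticeInner_spec P x x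
  rw [h1, Int.cast_zero] at h2
  exact Subtype.ext (basicInner_self_eq_zero P h2)

/-- Freeness of the action of Π on Π* by translations by `ℓη`. It is the reason why wave operators
of nonzero level are matrix units. -/
theorem level_flat_injective [P.IsRootSystem] {ℓ : ℤ} (hℓ : ℓ ≠ 0) {η ζ : IntegralLattice P}
    (h : ℓ • flat P η = ℓ • flat P ζ) : η = ζ := by
  refine flat_injective P (WeightLattice.ext fun y => ?_)
  have h1 : ℓ * flat P η y = ℓ * flat P ζ y := by
    rw [← WeightLattice.zsmul_apply, ← WeightLattice.zsmul_apply, h]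
  exact mul_left_cancel₀ hℓ h1

/-! ### The Gram matrix, finiteness of the quotient, and the removal of the sign cocycle -/

variable {r : ℕ} (β : Module.Basis (Fin r) ℤ (IntegralLattice P))

/-- The Gram matrix of a lattice basis. -/
def gramMatrix : Matrix (Fin r) (Fin r) ℤ := Matrix.of fun i j => latticeInner P (β i) (β j)

theorem flat_basis_eq_vecMul (x : IntegralLattice P) (j : Fin r) :
    flat P x (β j) = Matrix.vecMul (fun i => β.repr x i) (gramMatrix P β) j := by
  conv_lhs => rw [← β.sum_repr x]
  rw [map_sum, WeightLattice.sum_apply]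
  simp only [map_zsmul, WeightLattice.zsmul_apply, Matrix.vecMul, dotProduct, gramMatrix,
    Matrix.of_apply]
  rfl

/-- A left null vector of the Gram matrix is the coordinate vector of a lattice element killed by
the injective map `flat`. -/
theorem gramMatrix_det_ne_zero [P.IsRootSystem] : (gramMatrix P β).det ≠ 0 := by
  intro h
  obtain ⟨v, hv, hv0⟩ := Matrix.exists_vecMul_eq_zero_iff.2 h
  refine hv ?_
  have h1 : flat P (β.equivFun.symm v) = 0 := by
    have h2 : (flat P (β.equivFun.symm v) : IntegralLattice P →+ ℤ).toIntLinearMap = 0 :=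
      β.ext fun j => by
      change flat P (β.equivFun.symm v) (β j) = 0
      rw [flat_basis_eq_vecMul]
      have : (fun i => β.repr (β.equivFun.symm v) i) = v := β.equivFun.apply_symm_apply v
      rw [this, hv0]
      rfl
    exact WeightLattice.ext fun y => DFunLike.congr_fun h2 y
  have h3 : β.equivFun.symm v = 0 := flat_injective P (h1.trans (map_zero _).symm)
  exact β.equivFun.symm.map_eq_zero_iff.1 h3

/-- A subgroup of a free group of finite rank has finite index if its rank is the same. Finiteness
is what lets the invariant formal characters, which are arbitrary integer functions on the cosets,
match a direct sum of copies of ℤ. -/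
theorem finite_levelQuotient [P.IsRootSystem] {r : ℕ}
    (β : Module.Basis (Fin r) ℤ (IntegralLattice P)) {ℓ : ℤ} (hℓ : ℓ ≠ 0) :
    Finite (LevelQuotient P ℓ) := by
  let e : WeightLattice P ≃ₗ[ℤ] Module.Dual ℤ (IntegralLattice P) :=
    (addMonoidHomLequivInt ℤ : (IntegralLattice P →+ ℤ) ≃ₗ[ℤ] (IntegralLattice P →ₗ[ℤ] ℤ))
  let b : Module.Basis (Fin r) ℤ (WeightLattice P) := β.dualBasis.map e.symm
  have := Module.Free.of_basis b
  have := Module.Finite.of_basis b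
  let f : IntegralLattice P →ₗ[ℤ] WeightLattice P := (ℓ • flat P).toIntLinearMap
  have hf : Function.Injective f := fun x y h => level_flat_injective P hℓ h
  have h := Submodule.finiteQuotientOfFreeOfRankEq (LinearMap.range f) (by
    rw [LinearMap.finrank_range_of_inj hf, Module.finrank_eq_card_basis β,
      Module.finrank_eq_card_basis b])
  have h2 : (LinearMap.range f).toAddSubgroup = levelLattice P ℓ := rfl
  unfold LevelQuotient
  rw [← h2]
  exact h

/-- The coordinates of a weight with respect to a basis of the sublattice `Π ⊆ Π*`. -/
def flatCoord : WeightLattice P →+ (Fin r → ℝ) where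
  toFun ξ := Matrix.vecMul (fun j => (ξ (β j) : ℝ)) ((gramMatrix P β).map (Int.cast : ℤ → ℝ))⁻¹
  map_zero' := by
    rw [← Matrix.zero_vecMul (((gramMatrix P β).map (Int.cast : ℤ → ℝ))⁻¹)]
    congr 1
    exact funext fun j => Int.cast_zero
  map_add' ξ ζ := by
    rw [← Matrix.add_vecMul]
    congr 1
    exact funext fun j => Int.cast_add (ξ (β j)) (ζ (β j))

/-- The values of `flat x` on the basis are the coordinate row of `x` times the Gram matrix, which
`flatCoord` inverts over the reals. -/
theorem flatCoord_flat [P.IsRootSystem] (x : IntegralLattice P) (i : Fin r) :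
    flatCoord P β (flat P x) i = β.repr x i := by
  have hdet : IsUnit ((gramMatrix P β).map (Int.cast : ℤ → ℝ)).det := by
    have h1 : ((gramMatrix P β).map (Int.cast : ℤ → ℝ)).det = ((gramMatrix P β).det : ℝ) :=
      ((Int.castRingHom ℝ).map_det (gramMatrix P β)).symm
    rw [h1]
    exact (Int.cast_ne_zero.2 (gramMatrix_det_ne_zero P β)).isUnit
  have h2 : (fun j => (flat P x (β j) : ℝ)) =
      Matrix.vecMul (fun i => (β.repr x i : ℝ)) ((gramMatrix P β).map (Int.cast : ℤ → ℝ)) := by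
    funext j
    rw [flat_basis_eq_vecMul]
    simp [Matrix.vecMul, dotProduct]
  change Matrix.vecMul (fun j => (flat P x (β j) : ℝ)) _ i = _
  rw [h2, Matrix.vecMul_vecMul, Matrix.mul_nonsing_inv _ hdet, Matrix.vecMul_one]

/-- The real number `θ` with `θ(B♭(η₁), η₂) = ε(η₁, η₂)`, additive in both arguments. -/
def twistAngle (ε : LinearMap.BilinForm ℤ (IntegralLattice P)) (ξ : WeightLattice P)
    (η : IntegralLattice P) : ℝ := ∑ i, flatCoord P β ξ i * ε (β i) η

theorem twistAngle_add_left (ε : LinearMap.BilinForm ℤ (IntegralLattice P))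
    (ξ ζ : WeightLattice P) (η : IntegralLattice P) :
    twistAngle P β ε (ξ + ζ) η = twistAngle P β ε ξ η + twistAngle P β ε ζ η := by
  simp [twistAngle, add_mul, Finset.sum_add_distrib]

theorem twistAngle_add_right (ε : LinearMap.BilinForm ℤ (IntegralLattice P))
    (ξ : WeightLattice P) (η ζ : IntegralLattice P) :
    twistAngle P β ε ξ (η + ζ) = twistAngle P β ε ξ η + twistAngle P β ε ξ ζ := by
  simp [twistAngle, mul_add, Finset.sum_add_distrib]

theorem twistAngle_flat [P.IsRootSystem] (ε : LinearMap.BilinForm ℤ (IntegralLattice P))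
    (x η : IntegralLattice P) : twistAngle P β ε (flat P x) η = ε x η := by
  simp only [twistAngle, flatCoord_flat]
  conv_rhs => rw [← β.sum_repr x]
  simp only [map_sum, map_smul, LinearMap.sum_apply, LinearMap.smul_apply, smul_eq_mul,
    Int.cast_sum, Int.cast_mul]

/-- The homomorphism `s : Π → T` with `s(η₂)^(B♭(η₁)) = (-1)^ε(η₁, η₂)`. -/
def twist (ε : LinearMap.BilinForm ℤ (IntegralLattice P)) :
    IntegralLattice P →+ Additive (MaximalTorus P) :=
  AddMonoidHom.mk' (fun η => Additive.ofMul
    (⟨MonoidHom.mk' (fun ξ => Circle.exp (Real.pi * twistAngle P β ε ξ.toAdd η)) fun ξ ζ => by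
        rw [toAdd_mul, twistAngle_add_left, mul_add, Circle.exp_add],
      continuous_of_discreteTopology⟩ : Multiplicative (WeightLattice P) →ₜ* Circle)) fun η ζ => by
    refine congrArg Additive.ofMul (PontryaginDual.ext fun ξ => ?_)
    change Circle.exp _ = Circle.exp _ * Circle.exp _
    rw [twistAngle_add_right, mul_add, Circle.exp_add]

theorem twist_pow (ε : LinearMap.BilinForm ℤ (IntegralLattice P)) (η : IntegralLattice P)
    (ξ : WeightLattice P) : MaximalTorus.pow (twist P β ε η).toMul ξ =
      Circle.exp (Real.pi * twistAngle P β ε ξ η) := rfl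

theorem circle_exp_pi_mul_int (m : ℤ) : Circle.exp (Real.pi * m) = (-1) ^ m := by
  have h : Circle.exp Real.pi = -1 := Circle.ext (by simp)
  rw [mul_comm, ← zsmul_eq_mul, Circle.exp_zsmul, h]

/-- The identity that makes `untwist` multiplicative. The minus sign in `kappa` does not matter, as
-1 is its own inverse. -/
theorem kappa_twist [P.IsRootSystem] (ε : LinearMap.BilinForm ℤ (IntegralLattice P))
    (η ζ : IntegralLattice P) :
    TorusExt.kappa η (twist P β ε ζ).toMul = (-1) ^ (ε η ζ) := by
  rw [TorusExt.kappa, twist_pow, ← map_neg, twistAngle_flat, circle_exp_pi_mul_int, map_neg,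
    LinearMap.neg_apply, zpow_neg, ← inv_zpow, inv_neg, inv_one]

/-- The isomorphism `(t, η, z) ↦ (t s(η), η, z)` of central extensions. -/
def untwist [P.IsRootSystem] (ε : LinearMap.BilinForm ℤ (IntegralLattice P)) (k : ℤ) :
    TorusExt P ε k ≃ₜ* TorusExt P 0 k where
  toFun g := ⟨g.torus * (twist P β ε g.lattice).toMul, g.lattice, g.phase⟩
  invFun g := ⟨g.torus * (twist P β ε g.lattice).toMul⁻¹, g.lattice, g.phase⟩
  left_inv g := by simp
  right_inv g := by simp
  map_mul' a b := by
    simp only [TorusExt.mul_def, TorusExt.kappa_mul, kappa_twist, map_add, toMul_add, mul_zpow,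
      LinearMap.zero_apply, mul_zero, zpow_zero, mul_one, TorusExt.mk.injEq, true_and]
    refine ⟨by ac_rfl, ?_⟩
    rw [← zpow_mul, mul_comm k]
  continuous_toFun := by
    refine continuous_induced_rng.2 ((TorusExt.continuous_torus.mul ?_).prodMk
      (TorusExt.continuous_lattice.prodMk TorusExt.continuous_phase))
    exact (continuous_of_discreteTopology (f := fun η => (twist P β ε η).toMul)).comp
      TorusExt.continuous_lattice
  continuous_invFun := by
    refine continuous_induced_rng.2 ((TorusExt.continuous_torus.mul ?_).prodMk
      (TorusExt.continuous_lattice.prodMk TorusExt.continuous_phase))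
    exact (continuous_of_discreteTopology (f := fun η => (twist P β ε η).toMul⁻¹)).comp
      TorusExt.continuous_lattice

theorem untwist_central [P.IsRootSystem] (ε : LinearMap.BilinForm ℤ (IntegralLattice P)) (k : ℤ)
    (z : Circle) : untwist P β ε k (TorusExt.central z) = TorusExt.central z := by
  change (⟨1 * (twist P β ε 0).toMul, 0, z⟩ : TorusExt P 0 k) = ⟨1, 0, z⟩
  simp

theorem untwist_torus [P.IsRootSystem] (ε : LinearMap.BilinForm ℤ (IntegralLattice P)) (k : ℤ)
    (t : MaximalTorus P) : untwist P β ε k ⟨t, 0, 1⟩ = ⟨t, 0, 1⟩ := by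
  change (⟨t * (twist P β ε 0).toMul, 0, 1⟩ : TorusExt P 0 k) = ⟨t, 0, 1⟩
  simp

end Lattice
end

noncomputable section

/-! ## Wave functions on the central extensions -/

/-! ### Weights as characters of the torus -/

namespace MaximalTorus

variable {ι V W : Type*} [AddCommGroup V] [Module ℝ V] [AddCommGroup W] [Module ℝ W]
  {P : RootPairing ι ℝ V W}

theorem pow_add (t : MaximalTorus P) (ξ ζ : WeightLattice P) :
    t.pow (ξ + ζ) = t.pow ξ * t.pow ζ := map_mul t _ _

theorem pow_zero (t : MaximalTorus P) : t.pow 0 = 1 := map_one t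

theorem pow_neg (t : MaximalTorus P) (ξ : WeightLattice P) : t.pow (-ξ) = (t.pow ξ)⁻¹ :=
  map_inv t _

theorem pow_zsmul (t : MaximalTorus P) (n : ℤ) (ξ : WeightLattice P) :
    t.pow (n • ξ) = t.pow ξ ^ n := map_zpow t _ _

theorem mul_pow (t s : MaximalTorus P) (ξ : WeightLattice P) :
    MaximalTorus.pow (t * s) ξ = t.pow ξ * s.pow ξ := rfl

theorem one_pow (ξ : WeightLattice P) : MaximalTorus.pow (1 : MaximalTorus P) ξ = 1 := rfl

theorem continuous_pow (ξ : WeightLattice P) : Continuous fun t : MaximalTorus P => t.pow ξ :=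
  (continuous_eval_const (F := C(Multiplicative (WeightLattice P), Circle))
    (Multiplicative.ofAdd ξ)).comp
    (ContinuousMonoidHom.isInducing_toContinuousMap (Multiplicative (WeightLattice P))
      Circle).continuous

theorem exists_pow_ne {ξ ζ : WeightLattice P} (h : ξ ≠ ζ) :
    ∃ t : MaximalTorus P, t.pow ξ ≠ t.pow ζ := by
  obtain ⟨x, hx⟩ : ∃ x, ξ x ≠ ζ x := by
    by_contra hc
    push Not at hc
    exact h (WeightLattice.ext hc)
  -- The exponential of a real multiple of `x`, scaled so that its values at `ξ` and `ζ` differ by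
  -- the factor exp(iπ) = -1.
  let t : MaximalTorus P := (⟨MonoidHom.mk'
    (fun θ => Circle.exp (Real.pi / (ξ x - ζ x) * θ.toAdd x)) fun a b => by
      rw [← Circle.exp_add, ← mul_add, ← Int.cast_add]
      rfl, continuous_of_discreteTopology⟩ : Multiplicative (WeightLattice P) →ₜ* Circle)
  refine ⟨t, fun hc => ?_⟩
  have h1 : Circle.exp (Real.pi / (ξ x - ζ x) * ξ x) =
      Circle.exp (Real.pi / (ξ x - ζ x) * ζ x) := hc
  have h0 : (ξ x - ζ x : ℝ) ≠ 0 := sub_ne_zero.2 (Int.cast_injective.ne hx)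
  have h2 : Circle.exp Real.pi = 1 := by
    have h3 : Real.pi = Real.pi / (ξ x - ζ x) * ξ x - Real.pi / (ξ x - ζ x) * ζ x := by
      field_simp
    rw [h3, Circle.exp_sub, h1, div_self']
  exact Circle.exp_pi_ne_one h2

end MaximalTorus

/-! ### Sheets of the group and the functions supported on them -/

section Waves

universe u

variable {ι V : Type*} {W : Type u} [AddCommGroup V] [Module ℝ V] [AddCommGroup W]
  [Module ℝ W] {P : RootPairing ι ℝ V W}

/-- The character `(t, z) ↦ zⁿ t^ξ` of `T × U(1)`. -/
def torusChar (n : ℤ) (ξ : WeightLattice P) : C(MaximalTorus P × Circle, ℂ) where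
  toFun x := ((x.2 ^ n * x.1.pow ξ : Circle) : ℂ)
  continuous_toFun := by
    have h : Continuous fun x : MaximalTorus P × Circle => x.2 ^ n * x.1.pow ξ :=
      (continuous_snd.zpow n).mul ((MaximalTorus.continuous_pow ξ).comp continuous_fst)
    exact continuous_subtype_val.comp h

theorem torusChar_apply (n : ℤ) (ξ : WeightLattice P) (x : MaximalTorus P × Circle) :
    torusChar n ξ x = ((x.2 ^ n * x.1.pow ξ : Circle) : ℂ) := rfl

theorem star_torusChar_inv (n : ℤ) (ξ : WeightLattice P) (x : MaximalTorus P × Circle) :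
    star (torusChar n ξ x⁻¹) = torusChar n ξ x := by
  rw [torusChar_apply, torusChar_apply, ← starRingEnd_apply, ← Circle.coe_inv_eq_conj]
  congr 1
  have h : MaximalTorus.pow (x⁻¹).1 ξ = (MaximalTorus.pow x.1 ξ)⁻¹ := rfl
  rw [h, Prod.snd_inv, inv_zpow, mul_inv, inv_inv, inv_inv]

theorem exists_torusChar_ne {n m : ℤ} {ξ ζ : WeightLattice P} (h : (n, ξ) ≠ (m, ζ)) :
    ∃ x, torusChar n ξ x ≠ torusChar m ζ x := by
  by_cases h1 : ξ = ζ
  · subst h1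
    have hnm : n ≠ m := fun h0 => h (by rw [h0])
    have h0 : (n - m : ℝ) ≠ 0 := sub_ne_zero.2 (Int.cast_injective.ne hnm)
    -- The `n`-th and the `m`-th power of this point of the circle differ by the factor exp(iπ) =
    -- -1.
    refine ⟨(1, Circle.exp (Real.pi / (n - m))), fun hc => ?_⟩
    rw [torusChar_apply, torusChar_apply, MaximalTorus.one_pow, mul_one, mul_one] at hc
    have h2 := Circle.ext hc
    refine Circle.exp_pi_ne_one ?_
    have h3 : Real.pi = n • (Real.pi / (n - m)) - m • (Real.pi / (n - m)) := by
      simp only [zsmul_eq_mul]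
      field_simp
    rw [h3, Circle.exp_sub, Circle.exp_zsmul, Circle.exp_zsmul, h2, div_self']
  · obtain ⟨t, ht⟩ := MaximalTorus.exists_pow_ne h1
    refine ⟨(t, 1), fun hc => ht ?_⟩
    rw [torusChar_apply, torusChar_apply, one_zpow, one_zpow, one_mul, one_mul] at hc
    exact Circle.ext hc

variable [Fintype ι] [P.IsCrystallographic] [P.IsReduced] [P.IsIrreducible] {k : ℤ}

variable {G : Type u} [Group G] [TopologicalSpace G]
  (Φ : G ≃ₜ* TorusExt P 0 k)

/-- The component of `T × Π × U(1)` over an element of `Π`, as a subset of `G`. -/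
def sheet (η : IntegralLattice P) : Set G := {g | (Φ g).lattice = η}

theorem isOpen_sheet (η : IntegralLattice P) : IsOpen (sheet Φ η) :=
  (isOpen_discrete {η}).preimage (TorusExt.continuous_lattice.comp Φ.continuous)

theorem isCompact_sheet (η : IntegralLattice P) : IsCompact (sheet Φ η) := by
  have h : sheet Φ η = (Φ.toHomeomorph.trans TorusExt.homeoProd) ⁻¹'
      (Set.univ ×ˢ ({η} ×ˢ Set.univ)) := by
    ext g
    simp only [sheet, Set.mem_preimage, Set.mem_prod, Set.mem_univ, Set.mem_singleton_iff,
      true_and, and_true]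
    rfl
  rw [h]
  exact (Homeomorph.isCompact_preimage _).2
    (isCompact_univ.prod (isCompact_singleton.prod isCompact_univ))

/-- The element `(t, 0, z)`. -/
def torusElt (x : MaximalTorus P × Circle) : G := Φ.symm ⟨x.1, 0, x.2⟩

/-- The element `(1, η, 1)`. -/
def latticeElt (η : IntegralLattice P) : G := Φ.symm ⟨1, η, 1⟩

theorem apply_torusElt (x : MaximalTorus P × Circle) : Φ (torusElt Φ x) = ⟨x.1, 0, x.2⟩ :=
  Φ.apply_symm_apply _

theorem apply_latticeElt (η : IntegralLattice P) : Φ (latticeElt Φ η) = ⟨1, η, 1⟩ :=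
  Φ.apply_symm_apply _

theorem eq_torusElt {g : G} (hg : (Φ g).lattice = 0) :
    g = torusElt Φ ((Φ g).torus, (Φ g).phase) := by
  refine Φ.injective ?_
  rw [apply_torusElt]
  exact TorusExt.ext rfl hg rfl

theorem apply_torusElt_mul (x : MaximalTorus P × Circle) (g : G) :
    Φ (torusElt Φ x * g) = ⟨x.1 * (Φ g).torus, (Φ g).lattice, x.2 * (Φ g).phase⟩ := by
  rw [map_mul, apply_torusElt, TorusExt.mul_def]
  simp [TorusExt.kappa_zero]

theorem apply_latticeElt_mul (η : IntegralLattice P) (g : G) :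
    Φ (latticeElt Φ η * g) = ⟨(Φ g).torus, η + (Φ g).lattice,
      TorusExt.kappa η (Φ g).torus ^ k * (Φ g).phase⟩ := by
  rw [map_mul, apply_latticeElt, TorusExt.mul_def]
  simp

theorem latticeElt_add (η ζ : IntegralLattice P) :
    latticeElt Φ (η + ζ) = latticeElt Φ η * latticeElt Φ ζ := by
  refine Φ.injective ?_
  rw [apply_latticeElt_mul, apply_latticeElt, apply_latticeElt]
  simp [TorusExt.kappa_one]

theorem latticeElt_zero : latticeElt Φ 0 = 1 := by
  refine Φ.injective ?_
  rw [apply_latticeElt, map_one]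
  rfl

/-- Moving T × U(1) past a lattice element costs only a central phase. This is the source of the
shift of weights under the lattice. -/
theorem torusElt_mul_latticeElt (x : MaximalTorus P × Circle) (η : IntegralLattice P) :
    torusElt Φ x * latticeElt Φ η =
      latticeElt Φ η * torusElt Φ (x.1, TorusExt.kappa η x.1 ^ (-k) * x.2) := by
  refine Φ.injective ?_
  rw [apply_latticeElt_mul, apply_torusElt_mul, apply_latticeElt, apply_torusElt]
  simp

theorem torusElt_comm (x y : MaximalTorus P × Circle) :
    torusElt Φ x * torusElt Φ y = torusElt Φ y * torusElt Φ x := by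
  refine Φ.injective ?_
  rw [apply_torusElt_mul, apply_torusElt_mul, apply_torusElt, apply_torusElt]
  simp [mul_comm]

variable [IsTopologicalGroup G]

open Classical in
/-- A function on `T × U(1)`, transported to a sheet of `G`. -/
def sheetFun (η : IntegralLattice P) : C(MaximalTorus P × Circle, ℂ) →ₗ[ℂ] C_c(G, ℂ) where
  toFun h :=
    { toFun := fun g => (if (Φ g).lattice = η then 1 else 0) * h ((Φ g).torus, (Φ g).phase)
      continuous_toFun := ((continuous_of_discreteTopology
        (f := fun ζ : IntegralLattice P => if ζ = η then (1 : ℂ) else 0)).comp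
        (TorusExt.continuous_lattice.comp Φ.continuous)).mul (h.continuous.comp
        ((TorusExt.continuous_torus.comp Φ.continuous).prodMk
          (TorusExt.continuous_phase.comp Φ.continuous)))
      hasCompactSupport' := HasCompactSupport.intro (isCompact_sheet Φ η) fun g hg => by
        rw [if_neg (show ¬ (Φ g).lattice = η from hg), zero_mul] }
  map_add' h h' := by ext g; exact mul_add _ _ _
  map_smul' c h := by ext g; exact mul_left_comm _ _ _

theorem sheetFun_of_mem {η : IntegralLattice P} {g : G} (hg : (Φ g).lattice = η)
    (h : C(MaximalTorus P × Circle, ℂ)) :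
    sheetFun Φ η h g = h ((Φ g).torus, (Φ g).phase) := by
  classical
  change (if (Φ g).lattice = η then 1 else 0) * h ((Φ g).torus, (Φ g).phase) = _
  rw [if_pos hg, one_mul]

theorem sheetFun_of_notMem {η : IntegralLattice P} {g : G} (hg : (Φ g).lattice ≠ η)
    (h : C(MaximalTorus P × Circle, ℂ)) : sheetFun Φ η h g = 0 := by
  classical
  change (if (Φ g).lattice = η then 1 else 0) * h ((Φ g).torus, (Φ g).phase) = _
  rw [if_neg hg, zero_mul]

/-- The function supported on the sheet of `η` which integrates to the operator taking vectors of
weight `(n, ξ)` to vectors of weight `(n, ξ + n k η)`. -/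
def wave (n : ℤ) (ξ : WeightLattice P) (η : IntegralLattice P) : C_c(G, ℂ) :=
  sheetFun Φ η (star (torusChar n (ξ + (k * n) • flat P η)))

theorem wave_of_mem (n : ℤ) (ξ : WeightLattice P) {η : IntegralLattice P} {g : G}
    (hg : (Φ g).lattice = η) : wave Φ n ξ η g =
      star (torusChar n (ξ + (k * n) • flat P η) ((Φ g).torus, (Φ g).phase)) :=
  sheetFun_of_mem Φ hg _

theorem wave_of_notMem (n : ℤ) (ξ : WeightLattice P) {η : IntegralLattice P} {g : G}
    (hg : (Φ g).lattice ≠ η) : wave Φ n ξ η g = 0 := sheetFun_of_notMem Φ hg _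

/-- The shift of the weight built into `wave` cancels the factor `kappa η ^ k` of the group law.
Hence the waves on other sheets are left translates of the one on the identity sheet, and
`act_integrated` applies. -/
theorem wave_latticeElt_mul (n : ℤ) (ξ : WeightLattice P) (η : IntegralLattice P) (g : G) :
    wave Φ n ξ η (latticeElt Φ η * g) = wave Φ n ξ 0 g := by
  by_cases hg : (Φ g).lattice = 0
  · rw [wave_of_mem Φ n ξ hg, wave_of_mem Φ n ξ (by rw [apply_latticeElt_mul]; simp [hg]),
      apply_latticeElt_mul, torusChar_apply, torusChar_apply]
    congr 2
    simp only [TorusExt.kappa, MaximalTorus.pow_add, MaximalTorus.pow_zsmul, MaximalTorus.pow_neg,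
      map_zero, MaximalTorus.pow_zero, mul_zpow, one_zpow, mul_one, zpow_mul, inv_zpow]
    rw [mul_comm (MaximalTorus.pow _ ξ), mul_assoc, mul_left_comm, inv_mul_cancel_left]
  · rw [wave_of_notMem Φ n ξ hg, wave_of_notMem]
    rw [apply_latticeElt_mul]
    simpa using hg

/-- Characters are eigenfunctions of translations. Through `act_integrated` this puts the range of
the integrated wave into a weight space. -/
theorem wave_torusElt_mul (n : ℤ) (ξ : WeightLattice P) (x : MaximalTorus P × Circle) (g : G) :
    torusChar n ξ x * wave Φ n ξ 0 (torusElt Φ x * g) = wave Φ n ξ 0 g := by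
  by_cases hg : (Φ g).lattice = 0
  · rw [wave_of_mem Φ n ξ hg, wave_of_mem Φ n ξ (by rw [apply_torusElt_mul]; exact hg),
      apply_torusElt_mul, torusChar_apply, torusChar_apply, torusChar_apply]
    simp only [map_zero, smul_zero, add_zero, mul_zpow, MaximalTorus.mul_pow]
    have h : ∀ z w : Circle, (z : ℂ) * star ((z * w : Circle) : ℂ) = star (w : ℂ) := by
      intro z w
      have h1 : (z : ℂ) * star (z : ℂ) = 1 := by
        rw [← starRingEnd_apply, Complex.mul_conj, Circle.normSq_coe, Complex.ofReal_one]
      rw [Circle.coe_mul, star_mul', ← mul_assoc, h1, one_mul]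
    rw [mul_mul_mul_comm, h]
  · rw [wave_of_notMem Φ n ξ hg, wave_of_notMem, mul_zero]
    rw [apply_torusElt_mul]
    exact hg

variable [LocallyCompactSpace G] [MeasurableSpace G] [BorelSpace G]

/-- The volume of the identity sheet `T × U(1)`. -/
def sheetVolume : ℝ := (Measure.haar : Measure G).real (sheet Φ 0)

theorem sheetVolume_pos : 0 < sheetVolume Φ := by
  refine ENNReal.toReal_pos ?_ (isCompact_sheet Φ 0).measure_ne_top
  exact (isOpen_sheet Φ 0).measure_ne_zero _ ⟨1, by simp [sheet, map_one, TorusExt.one_def]⟩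

/-- This bound makes `sheetRep` continuous, so that uniform approximation of functions on a sheet
becomes approximation in the maximal C*-norm. -/
theorem integral_norm_sheetFun_le (η : IntegralLattice P) (h : C(MaximalTorus P × Circle, ℂ)) :
    ∫ g, ‖sheetFun Φ η h g‖ ∂Measure.haar ≤
      (Measure.haar : Measure G).real (sheet Φ η) * ‖h‖ := by
  have hm : MeasurableSet (sheet Φ η) := (isOpen_sheet Φ η).measurableSet
  have h1 : ∫ g, (sheet Φ η).indicator (fun _ => ‖h‖) g ∂(Measure.haar : Measure G) =
      (Measure.haar : Measure G).real (sheet Φ η) * ‖h‖ := by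
    rw [integral_indicator_const _ hm, smul_eq_mul]
  rw [← h1]
  refine integral_mono_of_nonneg (Eventually.of_forall fun _ => norm_nonneg _)
    ((integrable_indicator_iff hm).2 (integrableOn_const (isCompact_sheet Φ η).measure_ne_top))
    (Eventually.of_forall fun g => ?_)
  by_cases hg : (Φ g).lattice = η
  · change ‖sheetFun Φ η h g‖ ≤ _
    rw [Set.indicator_of_mem (show g ∈ sheet Φ η from hg), sheetFun_of_mem Φ hg]
    exact h.norm_coe_le_norm _
  · change ‖sheetFun Φ η h g‖ ≤ _
    rw [sheetFun_of_notMem Φ hg, norm_zero]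
    exact Set.indicator_nonneg (fun _ _ => norm_nonneg _) _

/-- The universal representation of functions on a sheet. -/
def sheetRep (η : IntegralLattice P) :
    C(MaximalTorus P × Circle, ℂ) →L[ℂ] UniversalOperators G :=
  LinearMap.mkContinuous (universalRepLinear ∘ₗ sheetFun Φ η)
    ((Measure.haar : Measure G).real (sheet Φ η))
    fun h => (norm_universalRep_le _).trans (integral_norm_sheetFun_le Φ η h)

theorem sheetRep_apply (η : IntegralLattice P) (h : C(MaximalTorus P × Circle, ℂ)) :
    sheetRep Φ η h = universalRep (sheetFun Φ η h) := rfl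

/-- The normalised operators of the wave functions in the universal representation. -/
def waveUnit (n : ℤ) (ξ : WeightLattice P) (η : IntegralLattice P) : UniversalOperators G :=
  ((sheetVolume Φ : ℂ)⁻¹) • universalRep (wave Φ n ξ η)

end Waves
end

noncomputable section

/-! ## The relations between wave operators -/

section WaveRelations

universe u

variable {ι V : Type*} {W : Type u} [AddCommGroup V] [Module ℝ V] [AddCommGroup W]
  [Module ℝ W] {P : RootPairing ι ℝ V W} [Fintype ι]
  [P.IsCrystallographic] [P.IsReduced] [P.IsIrreducible] {k : ℤ}
  {G : Type u} [Group G] [TopologicalSpace G] (Φ : G ≃ₜ* TorusExt P 0 k)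
  (π : UnitaryRep G)

theorem inv_torusElt (x : MaximalTorus P × Circle) : (torusElt Φ x)⁻¹ = torusElt Φ x⁻¹ := by
  refine inv_eq_of_mul_eq_one_left (Φ.injective ?_)
  rw [apply_torusElt_mul, apply_torusElt, map_one]
  simp [TorusExt.one_def]

theorem inv_latticeElt (η : IntegralLattice P) : (latticeElt Φ η)⁻¹ = latticeElt Φ (-η) :=
  inv_eq_of_mul_eq_one_left (by rw [← latticeElt_add, neg_add_cancel, latticeElt_zero])

/-- Vectors of weight `(n, ξ)` in a representation. -/
def IsWeightVector (n : ℤ) (ξ : WeightLattice P) (v : π.H) : Prop :=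
  ∀ x, (π.act (torusElt Φ x) : π.H →L[ℂ] π.H) v = torusChar n ξ x • v

variable {Φ π} in
theorem IsWeightVector.eq_zero {n m : ℤ} {ξ ζ : WeightLattice P} {v : π.H}
    (h : IsWeightVector Φ π n ξ v) (h' : IsWeightVector Φ π m ζ v) (hne : (n, ξ) ≠ (m, ζ)) :
    v = 0 := by
  obtain ⟨x, hx⟩ := exists_torusChar_ne hne
  have h1 := (h x).symm.trans (h' x)
  rw [← sub_eq_zero, ← sub_smul, smul_eq_zero] at h1
  exact h1.resolve_left (sub_ne_zero.2 hx)

theorem UnitaryRep.act_mul_apply (g h : G) (v : π.H) :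
    (π.act (g * h) : π.H →L[ℂ] π.H) v =
      (π.act g : π.H →L[ℂ] π.H) ((π.act h : π.H →L[ℂ] π.H) v) := by
  rw [map_mul]
  rfl

theorem UnitaryRep.star_act (g : G) :
    star (π.act g : π.H →L[ℂ] π.H) = (π.act g⁻¹ : π.H →L[ℂ] π.H) := by
  rw [map_inv]
  rfl

-- The central phase from `torusElt_mul_latticeElt`, to the power `n`, is the character of the
-- weight `(k * n) • flat P η`.
variable {Φ π} in
theorem IsWeightVector.latticeElt {n : ℤ} {ξ : WeightLattice P} {v : π.H}
    (h : IsWeightVector Φ π n ξ v) (η : IntegralLattice P) :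
    IsWeightVector Φ π n (ξ + (k * n) • flat P η)
      ((π.act (latticeElt Φ η) : π.H →L[ℂ] π.H) v) := by
  intro x
  rw [← π.act_mul_apply, torusElt_mul_latticeElt, π.act_mul_apply, h, map_smul]
  congr 1
  rw [torusChar_apply, torusChar_apply]
  congr 1
  simp only [TorusExt.kappa, MaximalTorus.pow_add, MaximalTorus.pow_zsmul, MaximalTorus.pow_neg,
    mul_zpow, zpow_mul, inv_zpow, zpow_neg, inv_inv]
  rw [mul_comm (x.1.pow ξ), mul_left_comm, mul_assoc]

variable [IsTopologicalGroup G] [LocallyCompactSpace G] [MeasurableSpace G] [BorelSpace G]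

theorem integrated_smul (c : ℂ) (f : C_c(G, ℂ)) : π.integrated (c • f) = c • π.integrated f := by
  rw [← evalRep_universalRep, universalRep_smul, map_smul, evalRep_universalRep]

theorem act_latticeElt_integrated_wave (n : ℤ) (ξ : WeightLattice P) (η : IntegralLattice P)
    (v : π.H) : (π.act (latticeElt Φ η) : π.H →L[ℂ] π.H) (π.integrated (wave Φ n ξ 0) v) =
      π.integrated (wave Φ n ξ η) v :=
  π.act_integrated _ _ _ (wave_latticeElt_mul Φ n ξ η) v

theorem isWeightVector_integrated_wave (n : ℤ) (ξ : WeightLattice P) (v : π.H) :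
    IsWeightVector Φ π n ξ (π.integrated (wave Φ n ξ 0) v) := by
  intro x
  rw [π.act_integrated _ _ (torusChar n ξ x • wave Φ n ξ 0) (wave_torusElt_mul Φ n ξ x),
    integrated_smul]
  rfl

/-- The wave is supported on the identity sheet, whose elements commute with T × U(1). -/
theorem integrated_wave_comm (n : ℤ) (ξ : WeightLattice P) (x : MaximalTorus P × Circle)
    (v : π.H) : π.integrated (wave Φ n ξ 0) ((π.act (torusElt Φ x) : π.H →L[ℂ] π.H) v) =
      (π.act (torusElt Φ x) : π.H →L[ℂ] π.H) (π.integrated (wave Φ n ξ 0) v) := by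
  rw [π.integrated_apply, π.integrated_apply,
    ← ContinuousLinearMap.integral_comp_comm _ (π.integrable_smul_act _ v)]
  refine integral_congr_ae (Eventually.of_forall fun g => ?_)
  by_cases hg : (Φ g).lattice = 0
  · simp only [map_smul]
    rw [← π.act_mul_apply, ← π.act_mul_apply, eq_torusElt Φ hg, torusElt_comm]
  · simp [wave_of_notMem Φ n ξ hg]

-- On a vector of the right weight the conjugate character in the wave cancels the character by
-- which the group acts, and the integrand is constant on the identity sheet.
variable {Φ π} in
theorem IsWeightVector.integrated_wave_same {n : ℤ} {ξ : WeightLattice P} {v : π.H}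
    (h : IsWeightVector Φ π n ξ v) :
    π.integrated (wave Φ n ξ 0) v = (sheetVolume Φ : ℂ) • v := by
  have hm : MeasurableSet (sheet Φ 0) := (isOpen_sheet Φ 0).measurableSet
  have h1 : ∫ g, (sheet Φ 0).indicator (fun _ => v) g ∂(Measure.haar : Measure G) =
      (sheetVolume Φ : ℂ) • v := by
    rw [integral_indicator_const _ hm]
    exact (Complex.coe_smul _ v).symm
  rw [← h1, π.integrated_apply]
  refine integral_congr_ae (Eventually.of_forall fun g => ?_)
  by_cases hg : (Φ g).lattice = 0
  · have h2 : (π.act g : π.H →L[ℂ] π.H) v = torusChar n ξ ((Φ g).torus, (Φ g).phase) • v := by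
      conv_lhs => rw [eq_torusElt Φ hg]
      exact h _
    simp only
    rw [Set.indicator_of_mem (show g ∈ sheet Φ 0 from hg), wave_of_mem Φ n ξ hg, h2, smul_smul,
      map_zero, smul_zero, add_zero, torusChar_apply]
    rw [← starRingEnd_apply, mul_comm, Complex.mul_conj, Circle.normSq_coe, Complex.ofReal_one,
      one_smul]
  · simp only
    rw [Set.indicator_of_notMem (show g ∉ sheet Φ 0 from hg), wave_of_notMem Φ n ξ hg, zero_smul]

-- The image vector has weight `(n, ξ)` as a value of the integrated wave, and weight `(m, ζ)`
-- because the integrated wave commutes with the torus.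
variable {Φ π} in
theorem IsWeightVector.integrated_wave_of_ne {n m : ℤ} {ξ ζ : WeightLattice P} {v : π.H}
    (h : IsWeightVector Φ π m ζ v) (hne : (n, ξ) ≠ (m, ζ)) :
    π.integrated (wave Φ n ξ 0) v = 0 := by
  refine (isWeightVector_integrated_wave Φ π n ξ v).eq_zero (fun x => ?_) hne
  rw [← integrated_wave_comm, h, map_smul]

/-- The projection onto the vectors of weight `(n, ξ)`. -/
def weightProj (n : ℤ) (ξ : WeightLattice P) : π.H →L[ℂ] π.H :=
  ((sheetVolume Φ : ℂ)⁻¹) • π.integrated (wave Φ n ξ 0)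

theorem sheetVolume_ne_zero : (sheetVolume Φ : ℂ) ≠ 0 :=
  Complex.ofReal_ne_zero.2 (sheetVolume_pos Φ).ne'

variable {Φ π} in
theorem IsWeightVector.weightProj_same {n : ℤ} {ξ : WeightLattice P} {v : π.H}
    (h : IsWeightVector Φ π n ξ v) : weightProj Φ π n ξ v = v := by
  change ((sheetVolume Φ : ℂ)⁻¹) • π.integrated (wave Φ n ξ 0) v = v
  rw [h.integrated_wave_same, inv_smul_smul₀ (sheetVolume_ne_zero Φ)]

variable {Φ π} in
theorem IsWeightVector.weightProj_of_ne {n m : ℤ} {ξ ζ : WeightLattice P} {v : π.H}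
    (h : IsWeightVector Φ π m ζ v) (hne : (n, ξ) ≠ (m, ζ)) : weightProj Φ π n ξ v = 0 := by
  change ((sheetVolume Φ : ℂ)⁻¹) • π.integrated (wave Φ n ξ 0) v = 0
  rw [h.integrated_wave_of_ne hne, smul_zero]

theorem isWeightVector_weightProj (n : ℤ) (ξ : WeightLattice P) (v : π.H) :
    IsWeightVector Φ π n ξ (weightProj Φ π n ξ v) := by
  intro x
  change _ = torusChar n ξ x • ((sheetVolume Φ : ℂ)⁻¹) • π.integrated (wave Φ n ξ 0) v
  rw [smul_comm, ← isWeightVector_integrated_wave Φ π n ξ v x, ← map_smul]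
  rfl

theorem weightProj_mul_act (n : ℤ) (ξ : WeightLattice P) (x : MaximalTorus P × Circle) :
    weightProj Φ π n ξ * (π.act (torusElt Φ x) : π.H →L[ℂ] π.H) =
      torusChar n ξ x • weightProj Φ π n ξ := by
  refine ContinuousLinearMap.ext fun v => ?_
  change ((sheetVolume Φ : ℂ)⁻¹) • π.integrated (wave Φ n ξ 0)
    ((π.act (torusElt Φ x) : π.H →L[ℂ] π.H) v) = torusChar n ξ x •
    ((sheetVolume Φ : ℂ)⁻¹) • π.integrated (wave Φ n ξ 0) v
  rw [integrated_wave_comm, isWeightVector_integrated_wave, smul_comm]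

/-- The adjoint of `weightProj_mul_act` shows that p* also maps into the weight space, on which p is
the identity. So p p* = p*, and the left side is self-adjoint. -/
theorem star_weightProj (n : ℤ) (ξ : WeightLattice P) :
    star (weightProj Φ π n ξ) = weightProj Φ π n ξ := by
  have h1 : ∀ v, IsWeightVector Φ π n ξ (star (weightProj Φ π n ξ) v) := by
    intro v x
    have h2 := congrArg star (weightProj_mul_act Φ π n ξ x⁻¹)
    rw [star_mul, star_smul, star_torusChar_inv, π.star_act, inv_torusElt, inv_inv] at h2
    exact DFunLike.congr_fun h2 v
  have h3 : weightProj Φ π n ξ * star (weightProj Φ π n ξ) = star (weightProj Φ π n ξ) :=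
    ContinuousLinearMap.ext fun v => (h1 v).weightProj_same
  have h4 := congrArg star h3
  rw [star_mul, star_star] at h4
  rw [← h3, h4]

theorem weightProj_mul_weightProj_same (n : ℤ) (ξ : WeightLattice P) :
    weightProj Φ π n ξ * weightProj Φ π n ξ = weightProj Φ π n ξ :=
  ContinuousLinearMap.ext fun v => (isWeightVector_weightProj Φ π n ξ v).weightProj_same

theorem weightProj_mul_weightProj_of_ne {n m : ℤ} {ξ ζ : WeightLattice P}
    (hne : (n, ξ) ≠ (m, ζ)) : weightProj Φ π n ξ * weightProj Φ π m ζ = 0 :=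
  ContinuousLinearMap.ext fun v => (isWeightVector_weightProj Φ π m ζ v).weightProj_of_ne hne

theorem act_mul_weightProj (n : ℤ) (ξ : WeightLattice P) (η : IntegralLattice P) :
    (π.act (latticeElt Φ η) : π.H →L[ℂ] π.H) * weightProj Φ π n ξ =
      weightProj Φ π n (ξ + (k * n) • flat P η) * (π.act (latticeElt Φ η) : π.H →L[ℂ] π.H) := by
  have h1 : ∀ (ξ : WeightLattice P) (η : IntegralLattice P),
      weightProj Φ π n (ξ + (k * n) • flat P η) * ((π.act (latticeElt Φ η) : π.H →L[ℂ] π.H) *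
        weightProj Φ π n ξ) = (π.act (latticeElt Φ η) : π.H →L[ℂ] π.H) * weightProj Φ π n ξ :=
    fun ξ η => ContinuousLinearMap.ext fun v =>
      ((isWeightVector_weightProj Φ π n ξ v).latticeElt η).weightProj_same
  -- So far only the inclusion of the translated weight space in the shifted one is known. The
  -- adjoint of the same relation for `-η` is the reverse inclusion.
  have h2 := congrArg star (h1 (ξ + (k * n) • flat P η) (-η))
  rw [map_neg, smul_neg, add_neg_cancel_right] at h2
  simp only [star_mul, star_weightProj, π.star_act, inv_latticeElt, neg_neg] at h2
  rw [← h1, ← mul_assoc, h2]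

/-- An element of the universal algebra is determined by its images in all representations, so this
formula reduces the relations between wave units to those between translations and weight
projections. -/
theorem evalRep_waveUnit (n : ℤ) (ξ : WeightLattice P) (η : IntegralLattice P) :
    evalRep π (waveUnit Φ n ξ η) =
      (π.act (latticeElt Φ η) : π.H →L[ℂ] π.H) * weightProj Φ π n ξ := by
  refine ContinuousLinearMap.ext fun v => ?_
  rw [waveUnit, map_smul, evalRep_universalRep]
  change ((sheetVolume Φ : ℂ)⁻¹) • π.integrated (wave Φ n ξ η) v =
    (π.act (latticeElt Φ η) : π.H →L[ℂ] π.H)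
      (((sheetVolume Φ : ℂ)⁻¹) • π.integrated (wave Φ n ξ 0) v)
  rw [map_smul, act_latticeElt_integrated_wave]

/-- Composition of arrows in the transformation groupoid of Π on the pairs `(n, ξ)`;
`waveUnit_mul_of_ne` and `star_waveUnit` cover the non-composable pairs and the inverses. -/
theorem waveUnit_mul_same (n : ℤ) (ξ : WeightLattice P) (η ζ : IntegralLattice P) :
    waveUnit Φ n (ξ + (k * n) • flat P ζ) η * waveUnit Φ n ξ ζ = waveUnit Φ n ξ (η + ζ) := by
  refine evalRep_ext fun π => ?_
  have h : (π.act (latticeElt Φ (η + ζ)) : π.H →L[ℂ] π.H) =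
      (π.act (latticeElt Φ η) : π.H →L[ℂ] π.H) * (π.act (latticeElt Φ ζ) : π.H →L[ℂ] π.H) := by
    rw [latticeElt_add, map_mul]
    rfl
  rw [map_mul, evalRep_waveUnit, evalRep_waveUnit, evalRep_waveUnit, h, mul_assoc,
    ← mul_assoc (weightProj Φ π n _), ← act_mul_weightProj, mul_assoc _ _ (weightProj Φ π n ξ),
    weightProj_mul_weightProj_same, mul_assoc]

theorem waveUnit_mul_of_ne {n m : ℤ} {ξ μ : WeightLattice P} (η ζ : IntegralLattice P)
    (h : (n, ξ) ≠ (m, μ + (k * m) • flat P ζ)) : waveUnit Φ n ξ η * waveUnit Φ m μ ζ = 0 := by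
  refine evalRep_ext fun π => ?_
  rw [map_mul, evalRep_waveUnit, evalRep_waveUnit, act_mul_weightProj Φ π m, mul_assoc,
    ← mul_assoc (weightProj Φ π n _), weightProj_mul_weightProj_of_ne Φ π h, zero_mul, mul_zero,
    map_zero]

theorem star_waveUnit (n : ℤ) (ξ : WeightLattice P) (η : IntegralLattice P) :
    star (waveUnit Φ n ξ η) = waveUnit Φ n (ξ + (k * n) • flat P η) (-η) := by
  refine evalRep_ext fun π => ?_
  rw [map_star, evalRep_waveUnit, evalRep_waveUnit, star_mul, star_weightProj, π.star_act,
    inv_latticeElt, act_mul_weightProj, map_neg, smul_neg, add_neg_cancel_right]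

end WaveRelations
end

noncomputable section

/-! ## Density of wave functions -/

section Density

/-- The Stone-Weierstrass theorem for a separating *-monoid of functions. -/
theorem mem_closure_span_of_separating {X : Type*} [TopologicalSpace X] [CompactSpace X]
    {J : Type*} (f : J → C(X, ℂ)) (h1 : ∃ j, f j = 1) (hmul : ∀ i j, ∃ l, f i * f j = f l)
    (hstar : ∀ i, ∃ j, star (f i) = f j) (hsep : ∀ x y, x ≠ y → ∃ j, f j x ≠ f j y)
    (g : C(X, ℂ)) : g ∈ closure (Submodule.span ℂ (Set.range f) : Set C(X, ℂ)) := by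
  let A : StarSubalgebra ℂ C(X, ℂ) :=
    { (Submodule.span ℂ (Set.range f)) with
      mul_mem' := fun {a b} ha hb => by
        refine Submodule.span_induction₂ (p := fun a b _ _ =>
          a * b ∈ Submodule.span ℂ (Set.range f)) ?_ ?_ ?_ ?_ ?_ ?_ ?_ ha hb
        · rintro _ _ ⟨i, rfl⟩ ⟨j, rfl⟩
          obtain ⟨l, hl⟩ := hmul i j
          rw [hl]
          exact Submodule.subset_span ⟨l, rfl⟩
        · intro y _; rw [zero_mul]; exact zero_mem _
        · intro y _; rw [mul_zero]; exact zero_mem _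
        · intro x y z _ _ _ hx hy; rw [add_mul]; exact add_mem hx hy
        · intro x y z _ _ _ hx hy; rw [mul_add]; exact add_mem hx hy
        · intro r x y _ _ h; rw [smul_mul_assoc]; exact Submodule.smul_mem _ _ h
        · intro r x y _ _ h; rw [mul_smul_comm]; exact Submodule.smul_mem _ _ h
      algebraMap_mem' := fun c => by
        obtain ⟨j, hj⟩ := h1
        rw [Algebra.algebraMap_eq_smul_one, ← hj]
        exact Submodule.smul_mem _ _ (Submodule.subset_span ⟨j, rfl⟩)
      star_mem' := fun {a} ha => by
        refine Submodule.span_induction (p := fun a _ =>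
          star a ∈ Submodule.span ℂ (Set.range f)) ?_ ?_ ?_ ?_ ha
        · rintro _ ⟨i, rfl⟩
          obtain ⟨j, hj⟩ := hstar i
          rw [hj]
          exact Submodule.subset_span ⟨j, rfl⟩
        · rw [star_zero]; exact zero_mem _
        · intro x y _ _ hx hy; rw [star_add]; exact add_mem hx hy
        · intro r x _ hx; rw [star_smul]; exact Submodule.smul_mem _ _ hx }
  have hA : A.toSubalgebra.SeparatesPoints := fun x y hxy => by
    obtain ⟨j, hj⟩ := hsep x y hxy
    exact ⟨_, ⟨f j, Submodule.subset_span ⟨j, rfl⟩, rfl⟩, hj⟩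
  have h := ContinuousMap.starSubalgebra_topologicalClosure_eq_top_of_separatesPoints A hA
  have h2 : g ∈ A.topologicalClosure := by rw [h]; trivial
  exact h2

/-- The span of a family closed under products and adjoints, as a *-subalgebra. -/
def spanStarSubalgebra {D : Type*} [NonUnitalCStarAlgebra D] {J : Type*} (f : J → D)
    (hmul : ∀ i j, f i * f j ∈ Submodule.span ℂ (Set.range f))
    (hstar : ∀ i, star (f i) ∈ Submodule.span ℂ (Set.range f)) :
    NonUnitalStarSubalgebra ℂ D :=
  { (Submodule.span ℂ (Set.range f)) with
    mul_mem' := fun {a b} ha hb => by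
      refine Submodule.span_induction₂ (p := fun a b _ _ =>
        a * b ∈ Submodule.span ℂ (Set.range f)) ?_ ?_ ?_ ?_ ?_ ?_ ?_ ha hb
      · rintro _ _ ⟨i, rfl⟩ ⟨j, rfl⟩
        exact hmul i j
      · intro y _; rw [zero_mul]; exact zero_mem _
      · intro y _; rw [mul_zero]; exact zero_mem _
      · intro x y z _ _ _ hx hy; rw [add_mul]; exact add_mem hx hy
      · intro x y z _ _ _ hx hy; rw [mul_add]; exact add_mem hx hy
      · intro r x y _ _ h; rw [smul_mul_assoc]; exact Submodule.smul_mem _ _ h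
      · intro r x y _ _ h; rw [mul_smul_comm]; exact Submodule.smul_mem _ _ h
    star_mem' := fun {a} ha => by
      refine Submodule.span_induction (p := fun a _ =>
        star a ∈ Submodule.span ℂ (Set.range f)) ?_ ?_ ?_ ?_ ha
      · rintro _ ⟨i, rfl⟩
        exact hstar i
      · rw [star_zero]; exact zero_mem _
      · intro x y _ _ hx hy; rw [star_add]; exact add_mem hx hy
      · intro r x _ hx; rw [star_smul]; exact Submodule.smul_mem _ _ hx }

universe u

variable {ι V : Type*} {W : Type u} [AddCommGroup V] [Module ℝ V] [AddCommGroup W]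
  [Module ℝ W] {P : RootPairing ι ℝ V W}

theorem torusChar_mul (n m : ℤ) (ξ ζ : WeightLattice P) :
    torusChar n ξ * torusChar m ζ = torusChar (n + m) (ξ + ζ) := by
  ext x
  rw [ContinuousMap.mul_apply, torusChar_apply, torusChar_apply, torusChar_apply, ← Circle.coe_mul,
    zpow_add, MaximalTorus.pow_add, mul_mul_mul_comm]

theorem star_torusChar (n : ℤ) (ξ : WeightLattice P) :
    star (torusChar n ξ) = torusChar (-n) (-ξ) := by
  ext x
  rw [ContinuousMap.star_apply, torusChar_apply, torusChar_apply, ← starRingEnd_apply,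
    ← Circle.coe_inv_eq_conj, zpow_neg, MaximalTorus.pow_neg, mul_inv]

theorem mem_closure_span_torusChar (g : C(MaximalTorus P × Circle, ℂ)) :
    g ∈ closure (Submodule.span ℂ (Set.range fun x : ℤ × WeightLattice P =>
      star (torusChar x.1 x.2)) : Set C(MaximalTorus P × Circle, ℂ)) := by
  refine mem_closure_span_of_separating _ ⟨(0, 0), ?_⟩ ?_ ?_ ?_ g
  · ext x
    simp [torusChar_apply, MaximalTorus.pow_zero]
  · rintro ⟨n, ξ⟩ ⟨m, ζ⟩
    exact ⟨(n + m, ξ + ζ), by simp only [star_torusChar, torusChar_mul]; congr 1 <;> abel⟩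
  · rintro ⟨n, ξ⟩
    exact ⟨(-n, -ξ), by simp only [star_torusChar]⟩
  · rintro ⟨t, z⟩ ⟨s, w⟩ h
    by_cases hzw : z = w
    · have hts : t ≠ s := fun h0 => h (by rw [h0, hzw])
      obtain ⟨ξ, hξ⟩ : ∃ ξ : WeightLattice P, t.pow ξ ≠ s.pow ξ := by
        by_contra hc
        push Not at hc
        exact hts (PontryaginDual.ext fun ξ => hc ξ.toAdd)
      refine ⟨(0, ξ), fun h0 => hξ (Circle.ext ?_)⟩
      have h1 : torusChar 0 ξ (t, z) = torusChar 0 ξ (s, w) := star_injective h0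
      simpa [torusChar_apply] using h1
    · refine ⟨(1, 0), fun h0 => hzw (Circle.ext ?_)⟩
      have h1 : torusChar 1 (0 : WeightLattice P) (t, z) = torusChar 1 0 (s, w) :=
        star_injective h0
      simpa [torusChar_apply, MaximalTorus.pow_zero] using h1

/-- A function on the torus, extended to homogeneity `n` in the circle. -/
def homogExtend (n : ℤ) : C(MaximalTorus P, ℂ) →L[ℂ] C(MaximalTorus P × Circle, ℂ) where
  toFun h := star (torusChar n 0) * h.comp ⟨Prod.fst, continuous_fst⟩
  map_add' _ _ := by ext; exact mul_add _ _ _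
  map_smul' _ _ := by ext; exact mul_left_comm _ _ _
  cont := continuous_const.mul (ContinuousMap.continuous_precomp _)

theorem homogExtend_apply (n : ℤ) (h : C(MaximalTorus P, ℂ)) (x : MaximalTorus P × Circle) :
    homogExtend n h x = star (torusChar n 0 x) * h x.1 := rfl

/-- Stone-Weierstrass is applied on the torus alone and the result is multiplied by a fixed power of
the circle variable, so that the approximants keep the homogeneity `n`. -/
theorem homogExtend_mem_closure (n : ℤ) (h : C(MaximalTorus P, ℂ)) :
    homogExtend n h ∈ closure (Submodule.span ℂ (Set.range fun ξ : WeightLattice P =>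
      star (torusChar n ξ)) : Set C(MaximalTorus P × Circle, ℂ)) := by
  let f : WeightLattice P → C(MaximalTorus P, ℂ) := fun ξ =>
    (star (torusChar 0 ξ)).comp ⟨fun t => (t, 1), continuous_id.prodMk continuous_const⟩
  have hf : ∀ ξ t, f ξ t = star ((t.pow ξ : Circle) : ℂ) := fun ξ t => by
    change star (torusChar 0 ξ (t, 1)) = _
    simp [torusChar_apply]
  have h1 : h ∈ closure (Submodule.span ℂ (Set.range f) : Set C(MaximalTorus P, ℂ)) := by
    refine mem_closure_span_of_separating f ⟨0, ?_⟩ (fun ξ ζ => ⟨ξ + ζ, ?_⟩)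
      (fun ξ => ⟨-ξ, ?_⟩) ?_ h
    · ext t; rw [hf]; simp [MaximalTorus.pow_zero]
    · ext t
      rw [ContinuousMap.mul_apply, hf, hf, hf, MaximalTorus.pow_add, Circle.coe_mul, star_mul']
    · ext t
      rw [ContinuousMap.star_apply, hf, hf, MaximalTorus.pow_neg, Circle.coe_inv_eq_conj,
        starRingEnd_apply]
    · intro t s hts
      by_contra hc
      push Not at hc
      refine hts (PontryaginDual.ext fun ξ => Circle.ext ?_)
      have := hc ξ.toAdd
      rw [hf, hf] at this
      exact star_injective this
  refine closure_mono ?_ (image_closure_subset_closure_image (homogExtend n).continuous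
    ⟨h, h1, rfl⟩)
  rintro _ ⟨g, hg, rfl⟩
  have h2 := Submodule.mem_map_of_mem (f := (homogExtend (P := P) n).toLinearMap) hg
  rw [Submodule.map_span, ← Set.range_comp] at h2
  refine Submodule.span_mono (Set.range_subset_range_iff_exists_comp.2 ⟨id, funext fun ξ => ?_⟩) h2
  ext x
  change homogExtend n (f ξ) x = star (torusChar n ξ x)
  rw [homogExtend_apply, hf, torusChar_apply, torusChar_apply, MaximalTorus.pow_zero, mul_one,
    Circle.coe_mul, star_mul']

variable [Fintype ι] [P.IsCrystallographic] [P.IsReduced] [P.IsIrreducible] {k : ℤ}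
  {G : Type u} [Group G] [TopologicalSpace G] (Φ : G ≃ₜ* TorusExt P 0 k)

/-- The restriction of a function to a sheet, as a function on `T × U(1)`. -/
def slice (f : C_c(G, ℂ)) (η : IntegralLattice P) : C(MaximalTorus P × Circle, ℂ) where
  toFun x := f (Φ.symm ⟨x.1, η, x.2⟩)
  continuous_toFun := f.continuous.comp (Φ.symm.continuous.comp (continuous_induced_rng.2
    (continuous_fst.prodMk (continuous_const.prodMk continuous_snd))))

theorem slice_apply (f : C_c(G, ℂ)) (η : IntegralLattice P) (x : MaximalTorus P × Circle) :
    slice Φ f η x = f (Φ.symm ⟨x.1, η, x.2⟩) := rfl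

/-- Homogeneity prescribes the dependence on the phase, so a slice is determined by its values at
phase 1. -/
theorem slice_of_isHomogeneous {c : Circle →* G}
    (hc : ∀ z, Φ (c z) = TorusExt.central z) {n : ℤ} {f : C_c(G, ℂ)} (hf : IsHomogeneous c n f)
    (η : IntegralLattice P) : slice Φ f η =
      homogExtend n ((slice Φ f η).comp
        ⟨fun t => (t, 1), continuous_id.prodMk continuous_const⟩) := by
  ext ⟨t, z⟩
  rw [homogExtend_apply]
  change f (Φ.symm ⟨t, η, z⟩) = star (torusChar n 0 (t, z)) * f (Φ.symm ⟨t, η, 1⟩)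
  have h1 := hf z⁻¹ (Φ.symm ⟨t, η, 1⟩)
  have h2 : (c z⁻¹)⁻¹ * Φ.symm ⟨t, η, 1⟩ = Φ.symm ⟨t, η, z⟩ := by
    refine Φ.injective ?_
    rw [← map_inv, inv_inv, map_mul, hc, Φ.apply_symm_apply, Φ.apply_symm_apply]
    simp [TorusExt.central, TorusExt.mul_def, TorusExt.kappa_zero]
  rw [← h2, h1, torusChar_apply, MaximalTorus.pow_zero, mul_one, ← starRingEnd_apply,
    ← Circle.coe_inv_eq_conj, inv_zpow]

variable [IsTopologicalGroup G]

theorem isHomogeneous_wave {c : Circle →* G}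
    (hc : ∀ z, Φ (c z) = TorusExt.central z) (n : ℤ) (ξ : WeightLattice P) (η : IntegralLattice P) :
    IsHomogeneous c n (wave Φ n ξ η) := by
  intro z g
  have h1 : Φ ((c z)⁻¹ * g) = ⟨(Φ g).torus, (Φ g).lattice, z⁻¹ * (Φ g).phase⟩ := by
    rw [← map_inv, map_mul, hc]
    simp [TorusExt.central, TorusExt.mul_def, TorusExt.kappa_zero]
  by_cases hg : (Φ g).lattice = η
  · rw [wave_of_mem Φ n ξ hg, wave_of_mem Φ n ξ (by rw [h1]; exact hg), h1, torusChar_apply,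
      torusChar_apply, mul_zpow, mul_assoc, Circle.coe_mul (z⁻¹ ^ n), star_mul', inv_zpow,
      Circle.coe_inv_eq_conj, starRingEnd_apply, star_star]
  · rw [wave_of_notMem Φ n ξ hg, wave_of_notMem Φ n ξ (by rw [h1]; exact hg), mul_zero]

/-- The lattice is discrete, so a compact support meets only finitely many sheets. -/
theorem exists_eq_sum_sheetFun (f : C_c(G, ℂ)) :
    ∃ s : Finset (IntegralLattice P), f = ∑ η ∈ s, sheetFun Φ η (slice Φ f η) := by
  have h1 : ((fun g => (Φ g).lattice) '' tsupport f).Finite :=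
    (f.hasCompactSupport.isCompact.image
      (TorusExt.continuous_lattice.comp Φ.continuous)).finite_of_discrete
  refine ⟨h1.toFinset, ?_⟩
  ext g
  have h2 : ∀ s : Finset (IntegralLattice P), (∑ η ∈ s, sheetFun Φ η (slice Φ f η)) g =
      ∑ η ∈ s, sheetFun Φ η (slice Φ f η) g := fun s => by
    induction s using Finset.cons_induction with
    | empty => rfl
    | cons a s ha ih => rw [Finset.sum_cons, Finset.sum_cons, ← ih]; rfl
  have h3 : sheetFun Φ (Φ g).lattice (slice Φ f (Φ g).lattice) g = f g := by
    rw [sheetFun_of_mem Φ rfl, slice_apply]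
    exact congrArg f (Φ.symm_apply_apply g)
  rw [h2]
  by_cases hg : (Φ g).lattice ∈ h1.toFinset
  · rw [Finset.sum_eq_single_of_mem _ hg fun η _ hη => sheetFun_of_notMem Φ hη.symm _, h3]
  · rw [Finset.sum_eq_zero fun η hη => sheetFun_of_notMem Φ
      (fun h : (Φ g).lattice = η => hg (h ▸ hη)) _]
    by_contra hne
    exact hg (h1.mem_toFinset.2 ⟨g, subset_tsupport _ hne, rfl⟩)

variable [LocallyCompactSpace G] [MeasurableSpace G] [BorelSpace G]

theorem sheetRep_star_torusChar (n : ℤ) (ξ : WeightLattice P) (η : IntegralLattice P) :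
    sheetRep Φ η (star (torusChar n ξ)) =
      (sheetVolume Φ : ℂ) • waveUnit Φ n (ξ - (k * n) • flat P η) η := by
  rw [waveUnit, smul_inv_smul₀ (sheetVolume_ne_zero Φ), sheetRep_apply, wave, sub_add_cancel]

/-- If the slices of a function are approximated by characters, then the function is approximated
by wave functions. -/
theorem universalRep_mem_closure {J : Type*} (n : J → ℤ) (ξ : J → WeightLattice P) (f : C_c(G, ℂ))
    (hf : ∀ η, slice Φ f η ∈ closure (Submodule.span ℂ (Set.range fun j =>
      star (torusChar (n j) (ξ j))) : Set C(MaximalTorus P × Circle, ℂ)))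
    (S : Submodule ℂ (UniversalOperators G))
    (hS : ∀ j η, waveUnit Φ (n j) (ξ j - (k * n j) • flat P η) η ∈ S) :
    universalRep f ∈ closure (S : Set (UniversalOperators G)) := by
  obtain ⟨s, hs⟩ := exists_eq_sum_sheetFun Φ f
  have h1 : universalRep f = ∑ η ∈ s, sheetRep Φ η (slice Φ f η) := by
    conv_lhs => rw [hs]
    exact map_sum universalRepLinear _ _
  rw [h1, ← Submodule.topologicalClosure_coe]
  refine Submodule.sum_mem _ fun η _ => ?_
  rw [← SetLike.mem_coe, Submodule.topologicalClosure_coe]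
  refine closure_mono ?_ (image_closure_subset_closure_image (sheetRep Φ η).continuous
    ⟨_, hf η, rfl⟩)
  rintro _ ⟨g, hg, rfl⟩
  have h2 := Submodule.mem_map_of_mem (f := (sheetRep Φ η).toLinearMap) hg
  rw [Submodule.map_span, ← Set.range_comp] at h2
  refine Submodule.span_le.2 ?_ h2
  rintro _ ⟨j, rfl⟩
  change sheetRep Φ η (star (torusChar (n j) (ξ j))) ∈ S
  rw [sheetRep_star_torusChar]
  exact Submodule.smul_mem _ _ (hS j η)

/-- A product of wave units vanishes or is a wave unit with the weight of its right factor. This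
gives closure under products and the ideal property of the homogeneous parts. -/
theorem waveUnit_mul_mem (n m : ℤ) (ξ ζ : WeightLattice P) (η θ : IntegralLattice P)
    (S : Submodule ℂ (UniversalOperators G)) (hS : ∀ η, waveUnit Φ m ζ η ∈ S) :
    waveUnit Φ n ξ η * waveUnit Φ m ζ θ ∈ S := by
  by_cases h : (n, ξ) = (m, ζ + (k * m) • flat P θ)
  · obtain ⟨rfl, rfl⟩ := Prod.mk.inj h
    rw [waveUnit_mul_same]
    exact hS _
  · rw [waveUnit_mul_of_ne Φ η θ h]
    exact zero_mem _

/-- The wave units are closed under adjoints and, up to zero, under products, so the closure of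
their span is already a C*-algebra. It contains all functions by approximation on sheets. -/
theorem groupCStar_eq_closure : (GroupCStar G : Set (UniversalOperators G)) =
    closure (Submodule.span ℂ (Set.range fun x : ℤ × WeightLattice P × IntegralLattice P =>
      waveUnit Φ x.1 x.2.1 x.2.2) : Set (UniversalOperators G)) := by
  let A := spanStarSubalgebra (fun x : ℤ × WeightLattice P × IntegralLattice P =>
      waveUnit Φ x.1 x.2.1 x.2.2)
    (fun x y => waveUnit_mul_mem Φ _ _ _ _ _ _ _ fun η =>
      Submodule.subset_span ⟨(y.1, y.2.1, η), rfl⟩)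
    (fun x => by rw [star_waveUnit]; exact Submodule.subset_span ⟨(_, _, _), rfl⟩)
  refine Set.Subset.antisymm ?_ ?_
  · change (GroupCStar G : Set (UniversalOperators G)) ⊆ (A.topologicalClosure : Set _)
    refine closure_minimal ?_ (NonUnitalStarSubalgebra.isClosed_topologicalClosure _)
    refine NonUnitalStarAlgebra.adjoin_le ?_
    rintro _ ⟨f, rfl⟩
    exact universalRep_mem_closure Φ (fun x : ℤ × WeightLattice P => x.1) (fun x => x.2) f
      (fun η => mem_closure_span_torusChar _) _
      fun j η => Submodule.subset_span ⟨(_, _, _), rfl⟩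
  · refine closure_mono ?_
    have h : ∀ x : ℤ × WeightLattice P × IntegralLattice P, waveUnit Φ x.1 x.2.1 x.2.2 ∈
        (NonUnitalStarAlgebra.adjoin ℂ (Set.range (universalRep (G := G)))).toSubmodule := by
      intro x
      exact Submodule.smul_mem _ _ (NonUnitalStarAlgebra.subset_adjoin ℂ _ ⟨_, rfl⟩)
    exact Submodule.span_le.2 (Set.range_subset_iff.2 h)

/-- The space of functions of homogeneity `n`. -/
def homogeneousFunctions (c : Circle →* G) (n : ℤ) : Submodule ℂ C_c(G, ℂ) where
  carrier := {f | IsHomogeneous c n f}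
  zero_mem' _ _ := (mul_zero _).symm
  add_mem' {f g} hf hg z x := by
    change f _ + g _ = _ * (f x + g x)
    rw [hf, hg, mul_add]
  smul_mem' a f hf z x := by
    change a * f _ = _ * (a * f x)
    rw [hf, mul_left_comm]

/-- No product is involved here. Combined with `homogIdeal_eq_closure` it shows that the linear
closure of the functions of homogeneity `n` is all of the algebra they generate. -/
theorem closure_homogeneous_eq {c : Circle →* G}
    (hc : ∀ z, Φ (c z) = TorusExt.central z) (n : ℤ) :
    closure (universalRep '' {f | IsHomogeneous c n f}) =
      closure (Submodule.span ℂ (Set.range fun x : WeightLattice P × IntegralLattice P =>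
        waveUnit Φ n x.1 x.2) : Set (UniversalOperators G)) := by
  refine Set.Subset.antisymm (closure_minimal ?_ isClosed_closure) (closure_mono ?_)
  · rintro _ ⟨f, hf, rfl⟩
    refine universalRep_mem_closure Φ (fun _ : WeightLattice P => n) (fun ξ => ξ) f
      (fun η => ?_) _ fun j η => Submodule.subset_span ⟨(_, _), rfl⟩
    rw [slice_of_isHomogeneous Φ hc hf η]
    exact homogExtend_mem_closure n _
  · change _ ⊆ ((homogeneousFunctions c n).map universalRepLinear : Set (UniversalOperators G))
    refine Submodule.span_le.2 (Set.range_subset_iff.2 fun x => ?_)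
    exact Submodule.smul_mem _ _ (Submodule.mem_map_of_mem (isHomogeneous_wave Φ hc n x.1 x.2))

theorem homogIdeal_eq_closure {c : Circle →* G}
    (hc : ∀ z, Φ (c z) = TorusExt.central z) (n : ℤ) :
    (HomogIdeal c n : Set (UniversalOperators G)) =
    closure (Submodule.span ℂ (Set.range fun x : WeightLattice P × IntegralLattice P =>
      waveUnit Φ n x.1 x.2) : Set (UniversalOperators G)) := by
  let A := spanStarSubalgebra (fun x : WeightLattice P × IntegralLattice P =>
      waveUnit Φ n x.1 x.2)
    (fun x y => waveUnit_mul_mem Φ _ _ _ _ _ _ _ fun η => Submodule.subset_span ⟨(y.1, η), rfl⟩)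
    (fun x => by rw [star_waveUnit]; exact Submodule.subset_span ⟨(_, _), rfl⟩)
  refine Set.Subset.antisymm ?_ ?_
  · change _ ⊆ (A.topologicalClosure : Set (UniversalOperators G))
    refine closure_minimal ?_ (NonUnitalStarSubalgebra.isClosed_topologicalClosure _)
    refine NonUnitalStarAlgebra.adjoin_le ?_
    refine subset_closure.trans ?_
    rw [closure_homogeneous_eq Φ hc]
    exact subset_rfl
  · rw [← closure_homogeneous_eq Φ hc]
    exact closure_mono (NonUnitalStarAlgebra.subset_adjoin ℂ _)

end Density
end

noncomputable section

/-! ## Direct sums of orthogonal subalgebras -/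

section OrthogonalSum

variable {I : Type*} {A : I → Type*} [∀ i, NonUnitalCStarAlgebra (A i)] {D : Type*}
  [NonUnitalCStarAlgebra D] (j : ∀ i, A i →⋆ₙₐ[ℂ] D)

/-- The sum of finitely many orthogonal *-homomorphisms. -/
def finiteOrthogonalSum (hj : ∀ i l, i ≠ l → ∀ a b, j i a * j l b = 0) (s : Finset I) :
    (∀ i : s, A i) →⋆ₙₐ[ℂ] D where
  toFun a := ∑ i : s, j i (a i)
  map_smul' c a := by simp [Finset.smul_sum]
  map_zero' := by simp
  map_add' a b := by simp [Finset.sum_add_distrib]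
  map_mul' a b := by
    rw [Finset.sum_mul_sum]
    refine Finset.sum_congr rfl fun i _ => ?_
    rw [Finset.sum_eq_single i, Pi.mul_apply, map_mul]
    · exact fun l _ hl => hj i l (fun h => hl (Subtype.ext h.symm)) _ _
    · exact fun h => absurd (Finset.mem_univ i) h
  map_star' a := by simp [star_sum, map_star]

/-- By orthogonality the finite sum is a *-homomorphism from the product algebra, hence contractive
for the supremum norm. -/
theorem norm_sum_orthogonal_le (hj : ∀ i l, i ≠ l → ∀ a b, j i a * j l b = 0) (s : Finset I)
    (a : ∀ i, A i) {C : ℝ} (hC : 0 ≤ C) (h : ∀ i ∈ s, ‖a i‖ ≤ C) :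
    ‖∑ i ∈ s, j i (a i)‖ ≤ C := by
  have h1 := NonUnitalStarAlgHom.norm_apply_le (finiteOrthogonalSum j hj s) fun i : s => a i
  have h2 : finiteOrthogonalSum j hj s (fun i : s => a i) = ∑ i ∈ s, j i (a i) :=
    Finset.sum_coe_sort s fun i => j i (a i)
  rw [h2] at h1
  exact h1.trans ((pi_norm_le_iff_of_nonneg hC).2 fun i => h i i.2)

/-- The Cauchy criterion holds because a finite sum is bounded by its largest term, and all but
finitely many components are small. -/
theorem summable_orthogonal (hj : ∀ i l, i ≠ l → ∀ a b, j i a * j l b = 0)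
    (x : CStarSumAlgebra A) : Summable fun i => j i (x.component i) := by
  rw [summable_iff_vanishing_norm]
  intro ε hε
  have h1 := x.tendsto_norm.eventually (gt_mem_nhds (half_pos hε))
  refine ⟨(Filter.eventually_cofinite.1 h1).toFinset, fun t ht => ?_⟩
  refine (norm_sum_orthogonal_le j hj t _ (half_pos hε).le fun i hi => ?_).trans_lt
    (half_lt_self hε)
  have h2 := Finset.disjoint_left.1 ht hi
  rw [Set.Finite.mem_toFinset, Set.mem_ofPred_eq, not_not] at h2
  exact h2.le

theorem mul_tsum_orthogonal (hj : ∀ i l, i ≠ l → ∀ a b, j i a * j l b = 0)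
    (x : CStarSumAlgebra A) (i : I) (a : A i) :
    j i a * ∑' l, j l (x.component l) = j i (a * x.component i) := by
  rw [← (summable_orthogonal j hj x).tsum_mul_left, tsum_eq_single i fun l hl =>
    hj i l hl.symm _ _, map_mul]

/-- The *-homomorphism from a direct sum given by orthogonal *-homomorphisms. -/
def orthogonalSum (hj : ∀ i l, i ≠ l → ∀ a b, j i a * j l b = 0) :
    CStarSumAlgebra A →⋆ₙₐ[ℂ] D where
  toFun x := ∑' i, j i (x.component i)
  map_smul' c x := by
    rw [MonoidHom.id_apply, ← (summable_orthogonal j hj x).tsum_const_smul]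
    exact tsum_congr fun i => map_smul (j i) c _
  map_zero' := (tsum_congr fun i => map_zero (j i)).trans tsum_zero
  map_add' x y := by
    rw [← (summable_orthogonal j hj x).tsum_add (summable_orthogonal j hj y)]
    exact tsum_congr fun i => map_add (j i) _ _
  map_mul' x y := by
    rw [← (summable_orthogonal j hj x).tsum_mul_right]
    exact tsum_congr fun i => (mul_tsum_orthogonal j hj y i _).symm
  map_star' x := by
    rw [tsum_star]
    exact tsum_congr fun i => map_star (j i) _

theorem orthogonalSum_apply (hj : ∀ i l, i ≠ l → ∀ a b, j i a * j l b = 0)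
    (x : CStarSumAlgebra A) : orthogonalSum j hj x = ∑' i, j i (x.component i) := rfl

theorem orthogonalSum_of_single (hj : ∀ i l, i ≠ l → ∀ a b, j i a * j l b = 0)
    (x : CStarSumAlgebra A) (i : I) (hx : ∀ l, l ≠ i → x.component l = 0) :
    orthogonalSum j hj x = j i (x.component i) :=
  tsum_eq_single i fun l hl => by rw [hx l hl, map_zero]

/-- Multiplying by the image of x_i* isolates the i-th component, so if the sum is zero then x_i*
x_i = 0. -/
theorem orthogonalSum_injective (hj : ∀ i l, i ≠ l → ∀ a b, j i a * j l b = 0)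
    (hinj : ∀ i, Function.Injective (j i)) : Function.Injective (orthogonalSum j hj) := by
  refine (injective_iff_map_eq_zero _).2 fun x hx => CStarSumAlgebra.ext fun i => ?_
  have h1 := mul_tsum_orthogonal j hj x i (star (x.component i))
  rw [← orthogonalSum_apply j hj, hx, mul_zero] at h1
  have h2 := (injective_iff_map_eq_zero (j i)).1 (hinj i) _ h1.symm
  exact CStarRing.star_mul_self_eq_zero_iff _ |>.1 h2

end OrthogonalSum

/-! ## The decomposition into homogeneous ideals -/

section Homogeneous

universe u

variable {ι V : Type*} {W : Type u} [AddCommGroup V] [Module ℝ V] [AddCommGroup W]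
  [Module ℝ W] {P : RootPairing ι ℝ V W} [Fintype ι] [P.IsCrystallographic] [P.IsReduced]
  [P.IsIrreducible] {k : ℤ} {G : Type u} [Group G] [TopologicalSpace G] [IsTopologicalGroup G]
  [LocallyCompactSpace G] [MeasurableSpace G] [BorelSpace G] (Φ : G ≃ₜ* TorusExt P 0 k)
  {c : Circle →* G}

/-- A bilinear inclusion of spans extends to closures. -/
theorem mul_mem_closure_of_span {D : Type*} [NonUnitalCStarAlgebra D] {S T : Set D}
    {U : Submodule ℂ D} (h : ∀ x ∈ S, ∀ y ∈ T, x * y ∈ U) {x y : D}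
    (hx : x ∈ closure (Submodule.span ℂ S : Set D))
    (hy : y ∈ closure (Submodule.span ℂ T : Set D)) : x * y ∈ closure (U : Set D) := by
  refine map_mem_closure₂ continuous_mul hx hy fun a ha b hb => ?_
  refine Submodule.span_induction₂ (p := fun a b _ _ => a * b ∈ U)
    (fun x y hx hy => h x hx y hy) ?_ ?_ ?_ ?_ ?_ ?_ ha hb
  · intro y _; rw [zero_mul]; exact zero_mem _
  · intro y _; rw [mul_zero]; exact zero_mem _
  · intro x y z _ _ _ hx hy; rw [add_mul]; exact add_mem hx hy
  · intro x y z _ _ _ hx hy; rw [mul_add]; exact add_mem hx hy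
  · intro r x y _ _ h; rw [smul_mul_assoc]; exact Submodule.smul_mem _ _ h
  · intro r x y _ _ h; rw [mul_smul_comm]; exact Submodule.smul_mem _ _ h

theorem homogIdeal_le_groupCStar (hc : ∀ z, Φ (c z) = TorusExt.central z)
    (n : ℤ) : HomogIdeal c n ≤ GroupCStar G := by
  rw [← SetLike.coe_subset_coe, homogIdeal_eq_closure Φ hc, groupCStar_eq_closure Φ]
  exact closure_mono (Submodule.span_mono (Set.range_subset_iff.2 fun x => ⟨(n, x), rfl⟩))

theorem groupCStar_mul_homogIdeal (hc : ∀ z, Φ (c z) = TorusExt.central z)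
    (n : ℤ) {a x : UniversalOperators G} (ha : a ∈ GroupCStar G)
    (hx : x ∈ HomogIdeal c n) : a * x ∈ HomogIdeal c n := by
  rw [← SetLike.mem_coe] at ha hx ⊢
  rw [groupCStar_eq_closure Φ] at ha
  rw [homogIdeal_eq_closure Φ hc] at hx ⊢
  refine mul_mem_closure_of_span ?_ ha hx
  rintro _ ⟨y, rfl⟩ _ ⟨z, rfl⟩
  exact waveUnit_mul_mem Φ _ _ _ _ _ _ _ fun η => Submodule.subset_span ⟨(z.1, η), rfl⟩

theorem homogIdeal_mul_groupCStar (hc : ∀ z, Φ (c z) = TorusExt.central z)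
    (n : ℤ) {a x : UniversalOperators G} (ha : a ∈ GroupCStar G)
    (hx : x ∈ HomogIdeal c n) : x * a ∈ HomogIdeal c n := by
  have h := groupCStar_mul_homogIdeal Φ hc n (star_mem ha) (star_mem hx)
  have h2 := star_mem h
  rwa [star_mul, star_star, star_star] at h2

theorem homogIdeal_orthogonal (hc : ∀ z, Φ (c z) = TorusExt.central z)
    (n m : ℤ) (hnm : n ≠ m) {x y : UniversalOperators G}
    (hx : x ∈ HomogIdeal c n) (hy : y ∈ HomogIdeal c m) : x * y = 0 := by
  rw [← SetLike.mem_coe, homogIdeal_eq_closure Φ hc] at hx hy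
  have h : x * y ∈ closure ((⊥ : Submodule ℂ (UniversalOperators G)) : Set _) := by
    refine mul_mem_closure_of_span ?_ hx hy
    rintro _ ⟨y, rfl⟩ _ ⟨z, rfl⟩
    rw [waveUnit_mul_of_ne Φ _ _ fun h => hnm (congrArg Prod.fst h)]
    exact zero_mem _
  simpa using h

theorem exists_homogeneous_decomposition (hc : ∀ z, Φ (c z) = TorusExt.central z) :
    ∃ Θ : CStarSumAlgebra (fun n : ℤ => HomogAlgebra c n) ≃⋆ₐ[ℂ] GroupCStarAlgebra G,
      ∀ x n, (∀ m, m ≠ n → x.component m = 0) →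
        (Θ x).toOperators = (x.component n).toOperators := by
  have hj : ∀ i l, i ≠ l → ∀ (a : HomogAlgebra c i) (b : HomogAlgebra c l),
      homogInclusion c i a * homogInclusion c l b = 0 :=
    fun i l hil a b => homogIdeal_orthogonal Φ hc i l hil a.2 b.2
  have hinj := orthogonalSum_injective (fun n => homogInclusion c n) hj
    fun n => homogInclusion_injective c n
  have hrange : Set.range (orthogonalSum (fun n => homogInclusion c n) hj) =
      Set.range (groupInclusion G) := by
    have h0 : Set.range (groupInclusion G) = (GroupCStar G : Set (UniversalOperators G)) :=
      Subtype.range_coe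
    rw [h0]
    refine Set.Subset.antisymm ?_ ?_
    · rintro _ ⟨x, rfl⟩
      refine (NonUnitalStarSubalgebra.isClosed_topologicalClosure _).mem_of_tendsto
        (summable_orthogonal (fun n => homogInclusion c n) hj x).hasSum
        (Eventually.of_forall fun s => ?_)
      refine sum_mem (B := NonUnitalStarSubalgebra ℂ (UniversalOperators G)) fun n _ => ?_
      exact homogIdeal_le_groupCStar Φ hc n (x.component n).2
    -- The range of an injective *-homomorphism is closed, so it is enough to reach the wave units,
    -- each of which lies in a single ideal.
    · rw [groupCStar_eq_closure Φ]
      refine closure_minimal ?_ (isClosed_range_of_injective _ hinj)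
      intro y hy
      induction hy using Submodule.span_induction with
      | mem y hy =>
        obtain ⟨⟨n, ξ, η⟩, rfl⟩ := hy
        have hmem : waveUnit Φ n ξ η ∈ HomogIdeal c n := by
          rw [← SetLike.mem_coe, homogIdeal_eq_closure Φ hc]
          exact subset_closure (Submodule.subset_span ⟨(ξ, η), rfl⟩)
        let w : HomogAlgebra c n := ⟨_, hmem⟩
        refine ⟨sumSingle (fun n : ℤ => HomogAlgebra c n) n w, ?_⟩
        rw [orthogonalSum_of_single _ hj _ n fun m hm => sumSingle_component_of_ne hm _,
          sumSingle_component_same]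
        rfl
      | zero => exact ⟨0, map_zero _⟩
      | add y z _ _ hy hz =>
        obtain ⟨y', hy'⟩ := hy
        obtain ⟨z', hz'⟩ := hz
        exact ⟨y' + z', by rw [map_add, hy', hz']⟩
      | smul c y _ hy => obtain ⟨y', hy'⟩ := hy; exact ⟨c • y', by rw [map_smul, hy']⟩
  obtain ⟨Θ, hΘ⟩ := exists_starAlgEquiv_of_range_eq _ (groupInclusion G) hinj
    groupInclusion_injective hrange
  refine ⟨Θ, fun x n hx => ?_⟩
  rw [← groupInclusion_apply, hΘ, orthogonalSum_of_single _ hj _ n hx]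
  rfl

end Homogeneous
end

noncomputable section

/-! ## Compact operators on Hilbert spaces -/

section Compact

open InnerProductSpace

variable {H : Type*} [NormedAddCommGroup H] [InnerProductSpace ℂ H]

theorem isCompactOperator_of_finiteDimensional_range {U : Submodule ℂ H} [FiniteDimensional ℂ U]
    {T : H →L[ℂ] H} (hT : ∀ x, T x ∈ U) : IsCompactOperator T := by
  have h1 : IsCompactOperator (id : U → U) :=
    isCompactOperator_id_iff_locallyCompactSpace.2 inferInstance
  have h2 := (h1.comp_clm (T.codRestrict U hT)).clm_comp U.subtypeL
  exact h2

variable [CompleteSpace H]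

/-- The rank-one operator `z ↦ ⟨y, z⟩ x` as a compact operator. -/
def compactRankOne (x y : H) : CompactAlgebra H :=
  ⟨rankOne ℂ x y, isCompactOperator_of_finiteDimensional_range (U := Submodule.span ℂ {x})
    fun z => by
    rw [rankOne_apply]
    exact Submodule.smul_mem _ _ (Submodule.mem_span_singleton_self x)⟩

@[simp] theorem compactInclusion_rankOne (x y : H) :
    compactInclusion H (compactRankOne x y) = rankOne ℂ x y := rfl

theorem CompactAlgebra.norm_eq (T : CompactAlgebra H) : ‖T‖ = ‖compactInclusion H T‖ := rfl

/-- The orthogonal projection onto a subspace of finite dimension. -/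
def compactProjection (U : Submodule ℂ H) [FiniteDimensional ℂ U] : CompactAlgebra H :=
  ⟨U.starProjection, isCompactOperator_of_finiteDimensional_range (U := U)
    fun x => Submodule.starProjection_apply_mem U x⟩

@[simp] theorem compactInclusion_projection (U : Submodule ℂ H) [FiniteDimensional ℂ U] :
    compactInclusion H (compactProjection U) = U.starProjection := rfl

theorem continuous_compactRankOne :
    Continuous fun x : H × H => compactRankOne x.1 x.2 := by
  have h : Continuous fun x : H × H => (rankOne ℂ x.1 x.2 : H →L[ℂ] H) :=
    (ContinuousLinearMap.toSpanSingletonCLE.continuous.comp continuous_fst).clm_comp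
      ((innerSL ℂ).continuous.comp continuous_snd)
  exact (NonUnitalStarAlgHom.isometry (compactInclusion H)
    (compactInclusion_injective H)).isUniformInducing.isInducing.continuous_iff.2 h

/-- Compact operators are approximated by their compressions to large subspaces of finite
dimension. -/
theorem exists_finiteDimensional_approx (T : CompactAlgebra H) {ε : ℝ} (hε : 0 < ε) :
    ∃ U : Submodule ℂ H, FiniteDimensional ℂ U ∧ ∀ (U' : Submodule ℂ H) [FiniteDimensional ℂ U'],
      U ≤ U' → ‖T - compactProjection U' * T‖ ≤ ε := by
  have h1 := (IsCompactOperator.isCompact_closure_image_closedBall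
    (f := T.toOperator.toLinearMap) T.2 1).totallyBounded.subset subset_closure
  -- A finite net of the image of the unit ball. Projections onto spaces containing the net fix its
  -- points, and the error is at most twice the distance to the net; hence `ε / 2`.
  obtain ⟨t, ht, htc⟩ := Metric.totallyBounded_iff.1 h1 (ε / 2) (half_pos hε)
  refine ⟨Submodule.span ℂ t, FiniteDimensional.span_of_finite ℂ ht, fun U' _ hU => ?_⟩
  rw [CompactAlgebra.norm_eq]
  refine ContinuousLinearMap.opNorm_le_of_unit_norm hε.le fun x hx => ?_
  obtain ⟨y, hy, hxy⟩ := Set.mem_iUnion₂.1 (htc ⟨x, by simp [hx], rfl⟩)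
  have hyU : U'.starProjection y = y :=
    Submodule.starProjection_eq_self_iff.2 (hU (Submodule.subset_span hy))
  have h2 : compactInclusion H (T - compactProjection U' * T) x =
      (T.toOperator x - y) - U'.starProjection (T.toOperator x - y) := by
    rw [map_sub (compactInclusion H), map_mul, map_sub U'.starProjection, hyU]
    change T.toOperator x - U'.starProjection (T.toOperator x) = _
    abel
  rw [h2]
  have h3 : ‖T.toOperator x - y‖ < ε / 2 := by simpa [dist_eq_norm] using hxy
  have h4 := (norm_sub_le (T.toOperator x - y) (U'.starProjection (T.toOperator x - y)))
  have h5 := Submodule.norm_starProjection_apply_le U' (T.toOperator x - y)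
  linarith

theorem compactRankOne_mul (T : CompactAlgebra H) (x y : H) :
    compactRankOne x y * T = compactRankOne x ((star T).toOperator y) :=
  compactInclusion_injective H (by
    rw [map_mul]
    exact rankOne_comp x y _)

theorem compactRankOne_mul_compactRankOne (x y z w : H) :
    compactRankOne x y * compactRankOne z w = (inner ℂ y z : ℂ) • compactRankOne x w := by
  refine compactInclusion_injective H ?_
  rw [map_mul, map_smul]
  exact rankOne_comp_rankOne x y z w

theorem star_compactRankOne (x y : H) : star (compactRankOne x y) = compactRankOne y x :=
  compactInclusion_injective H (adjoint_rankOne x y)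

theorem compactProjection_eq_sum {U : Submodule ℂ H} [FiniteDimensional ℂ U] {J : Type*}
    [Fintype J] (b : OrthonormalBasis J ℂ U) :
    compactProjection U = ∑ j, compactRankOne (b j : H) (b j : H) := by
  refine compactInclusion_injective H ?_
  rw [map_sum, compactInclusion_projection, b.starProjection_eq_sum_rankOne]
  rfl

/-- If `e` has dense span then the operators `e_i e_j*` have dense span in the compact
operators. -/
theorem mem_closure_span_compactRankOne {I : Type*} {e : I → H}
    (he : ∀ x, x ∈ closure (Submodule.span ℂ (Set.range e) : Set H)) (T : CompactAlgebra H) :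
    T ∈ closure (Submodule.span ℂ (Set.range fun x : I × I => compactRankOne (e x.1) (e x.2)) :
      Set (CompactAlgebra H)) := by
  set S := Submodule.span ℂ (Set.range fun x : I × I => compactRankOne (e x.1) (e x.2)) with hS
  have h1 : ∀ x y : H, compactRankOne x y ∈ closure (S : Set (CompactAlgebra H)) := by
    intro x y
    refine map_mem_closure₂ (f := compactRankOne) continuous_compactRankOne (he x) (he y) ?_
    intro a ha b hb
    induction ha using Submodule.span_induction with
    | mem a ha =>
      obtain ⟨i, rfl⟩ := ha
      induction hb using Submodule.span_induction with
      | mem b hb => obtain ⟨j, rfl⟩ := hb; exact Submodule.subset_span ⟨(i, j), rfl⟩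
      | zero =>
        have : compactRankOne (e i) 0 = 0 := compactInclusion_injective H (by simp)
        rw [this]; exact zero_mem _
      | add b c _ _ hb hc =>
        have : compactRankOne (e i) (b + c) = compactRankOne (e i) b + compactRankOne (e i) c :=
          compactInclusion_injective H (by simp)
        rw [this]; exact add_mem hb hc
      | smul r b _ hb =>
        have : compactRankOne (e i) (r • b) = star r • compactRankOne (e i) b :=
          compactInclusion_injective H (by simp)
        rw [this]; exact Submodule.smul_mem _ _ hb
    | zero =>
      have : compactRankOne 0 b = 0 := compactInclusion_injective H (by simp)
      rw [this]; exact zero_mem _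
    | add a c _ _ ha hc =>
      have : compactRankOne (a + c) b = compactRankOne a b + compactRankOne c b :=
        compactInclusion_injective H (by simp)
      rw [this]; exact add_mem ha hc
    | smul r a _ ha =>
      have : compactRankOne (r • a) b = r • compactRankOne a b :=
        compactInclusion_injective H (by simp)
      rw [this]; exact Submodule.smul_mem _ _ ha
  rw [← closure_closure, Metric.mem_closure_iff]
  intro ε hε
  obtain ⟨U, hU, h2⟩ := exists_finiteDimensional_approx T (half_pos hε)
  -- The compression is a finite sum of rank-one operators, each of which lies in the closure by
  -- `h1`.
  refine ⟨compactProjection U * T, ?_, ?_⟩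
  · rw [compactProjection_eq_sum (stdOrthonormalBasis ℂ U), Finset.sum_mul,
      ← Submodule.topologicalClosure_coe]
    refine Submodule.sum_mem _ fun j _ => ?_
    rw [compactRankOne_mul]
    exact h1 _ _
  · rw [dist_eq_norm]
    exact (h2 U le_rfl).trans_lt (half_lt_self hε)

theorem mem_closure_span_single {I : Type*} [DecidableEq I] (v : lp (fun _ : I => ℂ) 2) :
    v ∈ closure (Submodule.span ℂ
      (Set.range fun i : I => (lp.single 2 i (1 : ℂ) : lp (fun _ : I => ℂ) 2)) :
        Set (lp (fun _ : I => ℂ) 2)) := by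
  refine mem_closure_of_tendsto (lp.hasSum_single (by simp) v) (Eventually.of_forall fun s => ?_)
  refine Submodule.sum_mem _ fun i _ => ?_
  have : lp.single 2 i (v i) = v i • (lp.single 2 i (1 : ℂ) : lp (fun _ : I => ℂ) 2) := by
    rw [← lp.single_smul, smul_eq_mul, mul_one]
  rw [this]
  exact Submodule.smul_mem _ _ (Submodule.subset_span ⟨i, rfl⟩)

theorem clm_ext_single {I : Type*} [DecidableEq I] {F : Type*} [NormedAddCommGroup F]
    [NormedSpace ℂ F] {S T : lp (fun _ : I => ℂ) 2 →L[ℂ] F}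
    (h : ∀ i, S (lp.single 2 i 1) = T (lp.single 2 i 1)) : S = T := by
  refine ContinuousLinearMap.ext fun v =>
    ContinuousLinearMap.eqOn_closure_span ?_ (mem_closure_span_single v)
  rintro _ ⟨i, rfl⟩
  exact h i

end Compact
end

noncomputable section

/-! ## The Schrödinger representations -/

section Schrodinger

universe u

variable {ι V : Type*} {W : Type u} [AddCommGroup V] [Module ℝ V] [AddCommGroup W]
  [Module ℝ W] {P : RootPairing ι ℝ V W} [Fintype ι]
  [P.IsCrystallographic] [P.IsReduced] [P.IsIrreducible]

theorem levelQuotient_add {ℓ : ℤ} (μ : WeightLattice P) (η : IntegralLattice P) :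
    ((μ + ℓ • flat P η : WeightLattice P) : LevelQuotient P ℓ) = μ := by
  refine (QuotientAddGroup.eq.2 ?_).symm
  rw [neg_add_cancel_left]
  exact ⟨η, rfl⟩

theorem exists_eq_add_of_levelQuotient_eq {ℓ : ℤ} {μ ν : WeightLattice P}
    (h : (ν : LevelQuotient P ℓ) = μ) : ∃ η, ν = μ + ℓ • flat P η := by
  obtain ⟨η, hη⟩ := QuotientAddGroup.eq.1 h.symm
  refine ⟨η, ?_⟩
  have h1 : ℓ • flat P η = -μ + ν := hη
  rw [h1, add_neg_cancel_left]

/-- Translation of a coset by elements of the lattice. -/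
def cosetShift {ℓ : ℤ} (q : LevelQuotient P ℓ) (η : IntegralLattice P)
    (μ : {μ : WeightLattice P // (μ : LevelQuotient P ℓ) = q}) :
    {μ : WeightLattice P // (μ : LevelQuotient P ℓ) = q} :=
  ⟨μ.1 + ℓ • flat P η, (levelQuotient_add μ.1 η).trans μ.2⟩

variable {k : ℤ} {G : Type u} [Group G] [TopologicalSpace G] (Φ : G ≃ₜ* TorusExt P 0 k)
  {n ℓ : ℤ} (hℓ : k * n = ℓ) (q : LevelQuotient P ℓ)

theorem apply_mul_lattice (g h : G) : (Φ (g * h)).lattice = (Φ g).lattice + (Φ h).lattice := by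
  rw [map_mul]
  rfl

/-- The Schrödinger representation on `L²` of a coset, as a monomial representation. -/
def schrodingerData :
    MonomialData G {μ : WeightLattice P // (μ : LevelQuotient P ℓ) = q} where
  perm := MonoidHom.toHomPerm
    { toFun := fun g => cosetShift q (Φ g).lattice
      map_one' := by
        funext μ
        refine Subtype.ext ?_
        change μ.1 + ℓ • flat P (Φ 1).lattice = μ.1
        rw [map_one, TorusExt.one_def]
        simp
      map_mul' := fun g h => by
        funext μ
        refine Subtype.ext ?_
        change μ.1 + ℓ • flat P (Φ (g * h)).lattice = μ.1 + ℓ • flat P _ + ℓ • flat P _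
        rw [apply_mul_lattice, map_add, smul_add, add_comm (ℓ • flat P (Φ g).lattice), add_assoc] }
  coeff g μ := (Φ g).phase ^ n * (Φ g).torus.pow (μ.1 + ℓ • flat P (Φ g).lattice)
  coeff_mul g h μ := by
    change _ = (Φ g).phase ^ n * (Φ g).torus.pow (μ.1 + ℓ • flat P (Φ h).lattice +
      ℓ • flat P (Φ g).lattice) * ((Φ h).phase ^ n *
      (Φ h).torus.pow (μ.1 + ℓ • flat P (Φ h).lattice))
    -- This is where `k * n = ℓ` enters: the cocycle phase `kappa ^ k`, to the power `n`, cancels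
    -- the value of the torus part of `h` on the shift of the weight by `g`.
    have h2 : ∀ x : Circle, x ^ ℓ = (x ^ k) ^ n := fun x => by rw [← hℓ, zpow_mul]
    rw [map_mul, TorusExt.mul_def]
    simp only [h2, TorusExt.kappa, MaximalTorus.pow_add, MaximalTorus.pow_zsmul,
      MaximalTorus.pow_neg,
      map_add, smul_add, LinearMap.zero_apply, mul_zero, zpow_zero, mul_one, mul_zpow, inv_zpow,
      MaximalTorus.mul_pow]
    generalize (Φ g).torus.pow μ.1 = x₁
    generalize (Φ h).torus.pow μ.1 = x₂
    generalize (((Φ h).torus.pow (flat P (Φ g).lattice)) ^ k) ^ n = y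
    generalize (((Φ h).torus.pow (flat P (Φ h).lattice)) ^ k) ^ n = y'
    generalize (((Φ g).torus.pow (flat P (Φ h).lattice)) ^ k) ^ n = y₁
    generalize (((Φ g).torus.pow (flat P (Φ g).lattice)) ^ k) ^ n = y₂
    have h1 : y⁻¹ * y = 1 := inv_mul_cancel y
    calc _ = (y⁻¹ * y) * ((Φ g).phase ^ n * (x₁ * y₁ * y₂) * ((Φ h).phase ^ n * (x₂ * y'))) := by
          ac_rfl
      _ = _ := by rw [h1, one_mul]

theorem schrodingerData_perm (g : G) (μ) :
    (schrodingerData Φ hℓ q).perm g μ = cosetShift q (Φ g).lattice μ := rfl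

theorem schrodingerData_coeff (g : G) (μ) : (schrodingerData Φ hℓ q).coeff g μ =
    (Φ g).phase ^ n * (Φ g).torus.pow (μ.1 + ℓ • flat P (Φ g).lattice) := rfl

theorem continuous_schrodingerData
    [DecidableEq {μ : WeightLattice P // (μ : LevelQuotient P ℓ) = q}] (μ) :
    Continuous fun g => (schrodingerData Φ hℓ q).linear g (lp.single 2 μ 1) := by
  have h2 : ∀ (h : C(MaximalTorus P × Circle, ℂ)) (v : CosetL2 q), Continuous fun x => h x • v :=
    fun h v => h.continuous.smul continuous_const
  have h1 : Continuous fun x : IntegralLattice P × (MaximalTorus P × Circle) =>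
      torusChar n (μ.1 + ℓ • flat P x.1) x.2 •
        (lp.single 2 (cosetShift q x.1 μ) (1 : ℂ) : CosetL2 q) :=
    continuous_prod_of_discrete_left.2 fun η =>
      h2 (torusChar n (μ.1 + ℓ • flat P η)) (lp.single 2 (cosetShift q η μ) (1 : ℂ))
  refine (h1.comp ((TorusExt.continuous_lattice.comp Φ.continuous).prodMk
    ((TorusExt.continuous_torus.comp Φ.continuous).prodMk
      (TorusExt.continuous_phase.comp Φ.continuous)))).congr fun g => ?_
  rw [MonomialData.linear_single, schrodingerData_perm, schrodingerData_coeff]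
  simp only [Function.comp_apply, torusChar_apply]
  rfl

open Classical in
/-- The Schrödinger representation `(t, η, z) δ_μ = zⁿ t^(μ + ℓη) δ_(μ + ℓη)` on `L²` of a
coset. -/
def schrodingerRep : UnitaryRep G :=
  (schrodingerData Φ hℓ q).rep (continuous_schrodingerData Φ hℓ q)

/-- The operators of the Schrödinger representation. -/
def schrodingerOp (g : G) : CosetL2 q →L[ℂ] CosetL2 q :=
  ((schrodingerRep Φ hℓ q).act g :
    (schrodingerRep Φ hℓ q).H →L[ℂ] (schrodingerRep Φ hℓ q).H)

/-- The Schrödinger representation of the universal operators. -/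
def schrodingerEval [IsTopologicalGroup G] [LocallyCompactSpace G] [MeasurableSpace G]
    [BorelSpace G] : UniversalOperators G →⋆ₙₐ[ℂ] (CosetL2 q →L[ℂ] CosetL2 q) :=
  evalRep (schrodingerRep Φ hℓ q)

theorem schrodingerEval_waveUnit [IsTopologicalGroup G] [LocallyCompactSpace G] [MeasurableSpace G]
    [BorelSpace G]
    (μ : WeightLattice P) (η : IntegralLattice P) (v : CosetL2 q) :
    schrodingerEval Φ hℓ q (waveUnit Φ n μ η) v = schrodingerOp Φ hℓ q (latticeElt Φ η)
      (weightProj Φ (schrodingerRep Φ hℓ q) n μ v : CosetL2 q) :=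
  DFunLike.congr_fun (evalRep_waveUnit Φ (schrodingerRep Φ hℓ q) n μ η) v

variable [DecidableEq {μ : WeightLattice P // (μ : LevelQuotient P ℓ) = q}]

theorem schrodingerOp_single (g : G)
    (μ : {μ : WeightLattice P // (μ : LevelQuotient P ℓ) = q}) :
    schrodingerOp Φ hℓ q g (lp.single 2 μ 1) =
      torusChar n (μ.1 + ℓ • flat P (Φ g).lattice) ((Φ g).torus, (Φ g).phase) •
        (lp.single 2 (cosetShift q (Φ g).lattice μ) (1 : ℂ) : CosetL2 q) :=
  (schrodingerData Φ hℓ q).linear_single g μ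

theorem isWeightVector_single (μ : {μ : WeightLattice P // (μ : LevelQuotient P ℓ) = q}) :
    IsWeightVector Φ (schrodingerRep Φ hℓ q) n μ.1 (lp.single 2 μ (1 : ℂ) : CosetL2 q) := by
  intro x
  refine (schrodingerOp_single Φ hℓ q _ μ).trans ?_
  rw [apply_torusElt]
  have h : cosetShift q 0 μ = μ := Subtype.ext (by simp [cosetShift])
  simp only [h, map_zero, smul_zero, add_zero]
  rfl

theorem schrodingerOp_coeff (g : G)
    (μ ν : {μ : WeightLattice P // (μ : LevelQuotient P ℓ) = q}) :
    schrodingerOp Φ hℓ q g (lp.single 2 μ 1) ν =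
      schrodingerCoeff ℓ n (Φ g) μ ν := by
  rw [schrodingerOp_single, lp.coeFn_smul, Pi.smul_apply, schrodingerCoeff]
  by_cases h : ν.1 = μ.1 + ℓ • flat P (Φ g).lattice
  · have h1 : ν = cosetShift q (Φ g).lattice μ := Subtype.ext h
    rw [if_pos h, ← h, ← h1]
    simp [torusChar_apply]
  · have h1 : ν ≠ cosetShift q (Φ g).lattice μ := fun h1 => h (congrArg Subtype.val h1)
    rw [if_neg h]
    simp [lp.single_apply, h1]

theorem inner_single_single (μ ν : {μ : WeightLattice P // (μ : LevelQuotient P ℓ) = q}) :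
    inner ℂ (lp.single 2 μ (1 : ℂ) : CosetL2 q) (lp.single 2 ν (1 : ℂ)) =
      if μ = ν then 1 else 0 := by
  rw [lp.inner_single_left]
  by_cases h : μ = ν
  · subst h; simp
  · simp [lp.single_apply, h]

variable [IsTopologicalGroup G] [LocallyCompactSpace G] [MeasurableSpace G] [BorelSpace G]

/-- A coordinate is a bounded functional and passes under the vector-valued integral. This matches
the integrated representation with the formula in `IsDeterminedBy`. -/
theorem schrodingerEval_universalRep (f : C_c(G, ℂ))
    (μ ν : {μ : WeightLattice P // (μ : LevelQuotient P ℓ) = q}) :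
    schrodingerEval Φ hℓ q (universalRep f) (lp.single 2 μ 1) ν =
      ∫ g, f g * schrodingerCoeff ℓ n (Φ g) μ ν ∂Measure.haar := by
  have h1 : ∀ v : CosetL2 q, v ν = innerSL ℂ (lp.single 2 ν (1 : ℂ) : CosetL2 q) v := by
    intro v
    rw [innerSL_apply_apply, lp.inner_single_left]
    simp
  rw [h1]
  refine (ContinuousLinearMap.integral_comp_comm
    (innerSL ℂ (lp.single 2 ν (1 : ℂ) : CosetL2 q))
    ((schrodingerRep Φ hℓ q).integrable_smul_act f
      (lp.single 2 μ (1 : ℂ) : CosetL2 q))).symm.trans ?_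
  refine integral_congr_ae (Eventually.of_forall fun g => ?_)
  change innerSL ℂ (lp.single 2 ν (1 : ℂ) : CosetL2 q)
    (f g • schrodingerOp Φ hℓ q g (lp.single 2 μ 1)) = _
  rw [map_smul, smul_eq_mul, ← h1, schrodingerOp_coeff]

/-- Wave operators act by matrix units. -/
theorem schrodingerEval_waveUnit_same
    (μ : {μ : WeightLattice P // (μ : LevelQuotient P ℓ) = q}) (η : IntegralLattice P) :
    schrodingerEval Φ hℓ q (waveUnit Φ n μ.1 η) =
      InnerProductSpace.rankOne ℂ (lp.single 2 (cosetShift q η μ) (1 : ℂ) : CosetL2 q)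
        (lp.single 2 μ (1 : ℂ) : CosetL2 q) := by
  refine clm_ext_single fun ν => ?_
  rw [InnerProductSpace.rankOne_apply, inner_single_single, schrodingerEval_waveUnit]
  by_cases h : μ = ν
  · subst h
    rw [(isWeightVector_single Φ hℓ q μ).weightProj_same, schrodingerOp_single,
      apply_latticeElt, if_pos rfl, torusChar_apply]
    simp [MaximalTorus.one_pow]
  · rw [(isWeightVector_single Φ hℓ q ν).weightProj_of_ne
      (fun h1 => h (Subtype.ext (Prod.ext_iff.1 h1).2)), if_neg h, zero_smul]
    exact map_zero _

/-- All basis vectors have weights in the coset `q`, so the projection to a weight outside it is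
zero. -/
theorem schrodingerEval_waveUnit_of_ne {μ : WeightLattice P}
    (hμ : (μ : LevelQuotient P ℓ) ≠ q) (η : IntegralLattice P) :
    schrodingerEval Φ hℓ q (waveUnit Φ n μ η) = 0 := by
  refine clm_ext_single fun ν => ?_
  rw [schrodingerEval_waveUnit, (isWeightVector_single Φ hℓ q ν).weightProj_of_ne
    fun h1 => hμ ((congrArg (fun x : ℤ × WeightLattice P => (x.2 : LevelQuotient P ℓ))
      h1).trans ν.2)]
  exact map_zero _

end Schrodinger
end

noncomputable section

/-! ## The block decomposition of the homogeneous ideals -/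

section BlockDecomposition

universe u

variable {ι V : Type*} {W : Type u} [AddCommGroup V] [Module ℝ V] [AddCommGroup W]
  [Module ℝ W] {P : RootPairing ι ℝ V W} [Fintype ι]
  [P.IsCrystallographic] [P.IsReduced] [P.IsIrreducible]
  {k : ℤ} {G : Type u} [Group G] [TopologicalSpace G] (Φ : G ≃ₜ* TorusExt P 0 k)
  {n ℓ : ℤ} (hℓ : k * n = ℓ)
  [IsTopologicalGroup G] [LocallyCompactSpace G] [MeasurableSpace G] [BorelSpace G]

/-- If all products `a x b`, `a` and `b` in a generating set of a C*-algebra, vanish, then so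
does `x`. -/
theorem eq_zero_of_mul_mul_eq_zero {D J : Type*} [NonUnitalCStarAlgebra D] {f : J → D} {x : D}
    (hs : star x ∈ closure (Submodule.span ℂ (Set.range f) : Set D))
    (h : ∀ i j, f i * x * f j = 0) : x = 0 := by
  have h1 : ∀ i, ∀ y ∈ closure (Submodule.span ℂ (Set.range f) : Set D), f i * x * y = 0 := by
    intro i y hy
    refine closure_minimal (t := {y | f i * x * y = 0}) ?_
      (isClosed_eq (continuous_const.mul continuous_id) continuous_const) hy
    intro y hy
    induction hy using Submodule.span_induction with
    | mem y hy => obtain ⟨j, rfl⟩ := hy; exact h i j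
    | zero => exact mul_zero _
    | add a b _ _ ha hb =>
      change f i * x * (a + b) = 0
      rw [mul_add, ha, hb, add_zero]
    | smul r a _ ha =>
      change f i * x * (r • a) = 0
      rw [mul_smul_comm, ha, smul_zero]
  -- By density both outer factors can be replaced by x*. From x* x x* = 0 the C*-identity, applied
  -- twice, gives x = 0.
  have h2 : star x * x * star x = 0 := by
    refine closure_minimal (t := {y | y * x * star x = 0}) ?_
      (isClosed_eq ((continuous_id.mul continuous_const).mul continuous_const)
        continuous_const) hs
    intro y hy
    induction hy using Submodule.span_induction with
    | mem y hy => obtain ⟨j, rfl⟩ := hy; exact h1 j _ hs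
    | zero => change 0 * x * star x = 0; rw [zero_mul, zero_mul]
    | add a b _ _ ha hb =>
      change (a + b) * x * star x = 0
      rw [add_mul, add_mul, ha, hb, add_zero]
    | smul r a _ ha =>
      change (r • a) * x * star x = 0
      rw [smul_mul_assoc, smul_mul_assoc, ha, smul_zero]
  have h3 : star (star x * x) * (star x * x) = 0 := by
    rw [star_mul, star_star, ← mul_assoc, h2, zero_mul]
  exact CStarRing.star_mul_self_eq_zero_iff x |>.1 (CStarRing.star_mul_self_eq_zero_iff _ |>.1 h3)

/-- A wave operator as an element of the homogeneous ideal. -/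
def waveElt {c : Circle →* G} (hc : ∀ z, Φ (c z) = TorusExt.central z) (n : ℤ)
    (ξ : WeightLattice P) (η : IntegralLattice P) : HomogAlgebra c n :=
  ((sheetVolume Φ : ℂ)⁻¹) • homogeneousElement c n (wave Φ n ξ η) (isHomogeneous_wave Φ hc n ξ η)

theorem homogInclusion_waveElt {c : Circle →* G} (hc : ∀ z, Φ (c z) = TorusExt.central z) (n : ℤ)
    (ξ : WeightLattice P) (η : IntegralLattice P) :
    homogInclusion c n (waveElt Φ hc n ξ η) = waveUnit Φ n ξ η := rfl

/-- The inclusion of the ideal is isometric, so density of the wave units inside the universal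
algebra is density in the ideal itself. -/
theorem mem_closure_span_waveElt {c : Circle →* G} (hc : ∀ z, Φ (c z) = TorusExt.central z)
    (a : HomogAlgebra c n) :
    a ∈ closure (Submodule.span ℂ (Set.range fun x : WeightLattice P × IntegralLattice P =>
      waveElt Φ hc n x.1 x.2) : Set (HomogAlgebra c n)) := by
  rw [(NonUnitalStarAlgHom.isometry (homogInclusion c n)
    (homogInclusion_injective c n)).isUniformInducing.isInducing.closure_eq_preimage_closure_image]
  have h1 : homogInclusion c n a ∈ (HomogIdeal c n : Set (UniversalOperators G)) := a.2
  rw [homogIdeal_eq_closure Φ hc] at h1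
  refine closure_mono ?_ h1
  intro x hx
  induction hx using Submodule.span_induction with
  | mem x hx => obtain ⟨j, rfl⟩ := hx; exact ⟨_, Submodule.subset_span ⟨j, rfl⟩, rfl⟩
  | zero => exact ⟨0, zero_mem _, map_zero _⟩
  | add x y _ _ hx hy =>
    obtain ⟨x', hx', rfl⟩ := hx
    obtain ⟨y', hy', rfl⟩ := hy
    exact ⟨x' + y', add_mem hx' hy', map_add _ _ _⟩
  | smul r x _ hx =>
    obtain ⟨x', hx', rfl⟩ := hx
    exact ⟨r • x', Submodule.smul_mem _ _ hx', map_smul _ _ _⟩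

/-- The wave elements with `η = 0` are the source and range projections of the partial isometries,
and serve as local units. -/
theorem waveElt_eq_mul_mul {c : Circle →* G} (hc : ∀ z, Φ (c z) = TorusExt.central z)
    (μ : WeightLattice P) (η : IntegralLattice P) :
    waveElt Φ hc n (μ + (k * n) • flat P η) 0 * waveElt Φ hc n μ η = waveElt Φ hc n μ η ∧
      waveElt Φ hc n μ η * waveElt Φ hc n μ 0 = waveElt Φ hc n μ η := by
  constructor <;> refine homogInclusion_injective c n ?_
  · rw [map_mul]
    simp only [homogInclusion_waveElt]
    rw [waveUnit_mul_same, zero_add]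
  · have h := waveUnit_mul_same Φ n μ η 0
    rw [map_zero, smul_zero, add_zero, add_zero] at h
    rw [map_mul]
    exact h

theorem waveElt_mul_waveElt_of_ne {c : Circle →* G} (hc : ∀ z, Φ (c z) = TorusExt.central z)
    {μ ν : WeightLattice P} (η ζ : IntegralLattice P) (h : μ ≠ ν + (k * n) • flat P ζ) :
    waveElt Φ hc n μ η * waveElt Φ hc n ν ζ = 0 := by
  refine homogInclusion_injective c n ?_
  rw [map_mul, map_zero]
  exact waveUnit_mul_of_ne Φ η ζ fun h1 => h (Prod.ext_iff.1 h1).2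

open Classical in
/-- Cutting down an element of the homogeneous ideal by weights. -/
theorem waveElt_mul_mul_waveElt [P.IsRootSystem] (h0 : ℓ ≠ 0) {c : Circle →* G}
    (hc : ∀ z, Φ (c z) = TorusExt.central z) {q : LevelQuotient P ℓ}
    (μ : {μ : WeightLattice P // (μ : LevelQuotient P ℓ) = q}) (η : IntegralLattice P)
    (a : HomogAlgebra c n) :
    waveElt Φ hc n (cosetShift q η μ).1 0 * a *
    waveElt Φ hc n μ.1 0 =
      (inner ℂ (lp.single 2 (cosetShift q η μ) (1 : ℂ) : CosetL2 q)
        (schrodingerEval Φ hℓ q (homogInclusion c n a) (lp.single 2 μ (1 : ℂ))) : ℂ) •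
        waveElt Φ hc n μ.1 η := by
  have hcont : Continuous fun a : HomogAlgebra c n =>
      schrodingerEval Φ hℓ q (homogInclusion c n a) (lp.single 2 μ (1 : ℂ)) :=
    ((continuous_starAlgHom (schrodingerEval Φ hℓ q)).comp
      (continuous_starAlgHom (homogInclusion c n))).clm_apply continuous_const
  have hcont' : Continuous fun a : HomogAlgebra c n =>
      (inner ℂ (lp.single 2 (cosetShift q η μ) (1 : ℂ) : CosetL2 q)
        (schrodingerEval Φ hℓ q (homogInclusion c n a) (lp.single 2 μ (1 : ℂ))) : ℂ) :=
    continuous_const.inner hcont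
  -- Both sides are continuous and linear in `a`, so it suffices to compare them on wave elements.
  refine closure_minimal (t := {a | waveElt Φ hc n (cosetShift q η μ).1 0 * a *
    waveElt Φ hc n μ.1 0 =
      (inner ℂ (lp.single 2 (cosetShift q η μ) (1 : ℂ) : CosetL2 q)
        (schrodingerEval Φ hℓ q (homogInclusion c n a) (lp.single 2 μ (1 : ℂ))) : ℂ) •
        waveElt Φ hc n μ.1 η}) ?_ (isClosed_eq
    ((continuous_const.mul continuous_id).mul continuous_const)
    (hcont'.smul continuous_const)) (mem_closure_span_waveElt Φ hc a)
  intro a ha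
  induction ha using Submodule.span_induction with
  | mem a ha =>
    obtain ⟨⟨ν, ζ⟩, rfl⟩ := ha
    change waveElt Φ hc n (cosetShift q η μ).1 0 * waveElt Φ hc n ν ζ * waveElt Φ hc n μ.1 0 = _
    simp only [homogInclusion_waveElt]
    by_cases h1 : ν = μ.1
    · subst h1
      rw [schrodingerEval_waveUnit_same, InnerProductSpace.rankOne_apply, inner_single_single,
        if_pos rfl, one_smul, inner_single_single]
      by_cases h2 : η = ζ
      · subst h2
        rw [if_pos rfl, one_smul]
        have h3 := waveElt_eq_mul_mul Φ hc (n := n) μ.1 η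
        rw [hℓ] at h3
        rw [mul_assoc, h3.2]
        exact h3.1
      -- Different lattice elements move `μ` to different weights because `ℓ ≠ 0`, and then both
      -- sides vanish.
      · have h3 : cosetShift q η μ ≠ cosetShift q ζ μ := fun h3 =>
          h2 (level_flat_injective P h0 (add_left_cancel (congrArg Subtype.val h3)))
        rw [if_neg h3, zero_smul, waveElt_mul_waveElt_of_ne, zero_mul]
        rw [hℓ]
        exact fun h4 => h3 (Subtype.ext h4)
    · have h2 : schrodingerEval Φ hℓ q (waveUnit Φ n ν ζ) (lp.single 2 μ (1 : ℂ)) = 0 := by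
        by_cases hν : (ν : LevelQuotient P ℓ) = q
        · have h3 := schrodingerEval_waveUnit_same Φ hℓ q ⟨ν, hν⟩ ζ
          simp only at h3
          rw [h3, InnerProductSpace.rankOne_apply, inner_single_single,
            if_neg (fun h4 => h1 (congrArg Subtype.val h4)), zero_smul]
        · rw [schrodingerEval_waveUnit_of_ne Φ hℓ q hν]
          rfl
      rw [h2, inner_zero_right, zero_smul, mul_assoc, waveElt_mul_waveElt_of_ne, mul_zero]
      simpa using h1
  | zero =>
    change _ * 0 * _ = _
    simp
  | add a b _ _ ha hb =>
    change _ * (a + b) * _ = _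
    rw [mul_add, add_mul, ha, hb]
    simp only [map_add, add_apply, inner_add_right, add_smul]
  | smul r a _ ha =>
    change _ * (r • a) * _ = _
    rw [mul_smul_comm, smul_mul_assoc, ha]
    simp only [map_smul, smul_apply, inner_smul_right, smul_smul]

/-- Joint faithfulness. A corner between two weights of one coset is a Schrödinger matrix
coefficient times a wave element, and a corner between different cosets is always zero. If all
corners of `a` vanish, so do all products of `a` with wave elements on both sides. -/
theorem eq_zero_of_schrodingerEval_eq_zero [P.IsRootSystem] (h0 : ℓ ≠ 0) {c : Circle →* G}
    (hc : ∀ z, Φ (c z) = TorusExt.central z) {a : HomogAlgebra c n}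
    (h : ∀ q : LevelQuotient P ℓ, schrodingerEval Φ hℓ q (homogInclusion c n a) = 0) : a = 0 := by
  have h1 : ∀ μ ν : WeightLattice P, waveElt Φ hc n ν 0 * a * waveElt Φ hc n μ 0 = 0 := by
    intro μ ν
    by_cases hμν : (ν : LevelQuotient P ℓ) = μ
    · obtain ⟨η, rfl⟩ := exists_eq_add_of_levelQuotient_eq hμν
      have h2 := waveElt_mul_mul_waveElt Φ hℓ h0 hc
        (q := (μ : LevelQuotient P ℓ)) ⟨μ, rfl⟩ η a
      rw [h] at h2
      refine h2.trans ?_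
      rw [zero_apply, inner_zero_right, zero_smul]
    · refine closure_minimal (t := {a | waveElt Φ hc n ν 0 * a * waveElt Φ hc n μ 0 = 0}) ?_
        (isClosed_eq ((continuous_const.mul continuous_id).mul continuous_const)
          continuous_const) (mem_closure_span_waveElt Φ hc a)
      intro a ha
      induction ha using Submodule.span_induction with
      | mem a ha =>
        obtain ⟨⟨ξ, ζ⟩, rfl⟩ := ha
        change waveElt Φ hc n ν 0 * waveElt Φ hc n ξ ζ * waveElt Φ hc n μ 0 = 0
        by_cases h1 : ξ = μ
        · subst h1
          rw [waveElt_mul_waveElt_of_ne, zero_mul]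
          rw [hℓ]
          rintro rfl
          exact hμν (levelQuotient_add _ _)
        · rw [mul_assoc, waveElt_mul_waveElt_of_ne, mul_zero]
          simpa using h1
      | zero =>
        change _ * 0 * _ = _
        rw [mul_zero, zero_mul]
      | add a b _ _ ha hb =>
        change _ * (a + b) * _ = _
        rw [mul_add, add_mul, ha, hb, add_zero]
      | smul r a _ ha =>
        change _ * (r • a) * _ = _
        rw [mul_smul_comm, smul_mul_assoc, ha, smul_zero]
  refine eq_zero_of_mul_mul_eq_zero (mem_closure_span_waveElt Φ hc (star a)) ?_
  rintro ⟨μ, η⟩ ⟨ν, ζ⟩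
  simp only
  -- Inserting the source projection on the left and the range projection on the right exposes a
  -- corner of `a`.
  rw [← (waveElt_eq_mul_mul Φ hc μ η).2, ← (waveElt_eq_mul_mul Φ hc ν ζ).1]
  have h2 := h1 (ν + (k * n) • flat P ζ) μ
  calc _ = waveElt Φ hc n μ η * (waveElt Φ hc n μ 0 * a *
        waveElt Φ hc n (ν + (k * n) • flat P ζ) 0) * waveElt Φ hc n ν ζ := by
        simp only [mul_assoc]
    _ = 0 := by rw [h2, mul_zero, zero_mul]

open Classical in
/-- Matrix units in the block algebra. -/
def blockUnit (ℓ : ℤ) (μ : WeightLattice P) (η : IntegralLattice P) : BlockAlgebra P ℓ :=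
  sumSingle (fun q : LevelQuotient P ℓ => CompactAlgebra (CosetL2 q)) (μ : LevelQuotient P ℓ)
    (compactRankOne (lp.single 2 (cosetShift (μ : LevelQuotient P ℓ) η ⟨μ, rfl⟩) (1 : ℂ))
      (lp.single 2 ⟨μ, rfl⟩ (1 : ℂ)))

/-- Two weights of one coset differ by some `ℓη`, so the block units exhaust all matrix units of all
blocks. -/
theorem mem_closure_span_blockUnit (x : BlockAlgebra P ℓ) :
    x ∈ closure (Submodule.span ℂ (Set.range fun x : WeightLattice P × IntegralLattice P =>
      blockUnit ℓ x.1 x.2) : Set (BlockAlgebra P ℓ)) := by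
  classical
  refine closure_minimal ?_ isClosed_closure (mem_closure_span_sumSingle x)
  rw [← Submodule.topologicalClosure_coe]
  refine SetLike.coe_subset_coe.2 (Submodule.span_le.2 ?_)
  rintro _ ⟨q, T, rfl⟩
  have h1 := mem_closure_span_compactRankOne (H := CosetL2 q)
    (e := fun μ => lp.single 2 μ (1 : ℂ)) mem_closure_span_single T
  refine map_mem_closure (continuous_starAlgHom (sumSingle
    (fun q : LevelQuotient P ℓ => CompactAlgebra (CosetL2 q)) q)) h1 ?_
  intro T hT
  induction hT using Submodule.span_induction with
  | mem T hT =>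
    obtain ⟨⟨⟨ν, hν⟩, ⟨μ, hμ⟩⟩, rfl⟩ := hT
    subst hμ
    obtain ⟨η, rfl⟩ := exists_eq_add_of_levelQuotient_eq hν
    refine Submodule.subset_span ⟨(μ, η), ?_⟩
    simp only [blockUnit, cosetShift]
  | zero => rw [map_zero]; exact zero_mem _
  | add S T _ _ hS hT => rw [map_add]; exact add_mem hS hT
  | smul r T _ hT => rw [map_smul]; exact Submodule.smul_mem _ _ hT

open Classical in
theorem schrodingerEval_eq_blockUnit (q : LevelQuotient P ℓ) (μ : WeightLattice P)
    (η : IntegralLattice P) :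
    schrodingerEval Φ hℓ q (waveUnit Φ n μ η) =
      compactInclusion (CosetL2 q) ((blockUnit ℓ μ η).component q) := by
  by_cases hq : q = μ
  · subst hq
    rw [blockUnit, sumSingle_component_same]
    exact schrodingerEval_waveUnit_same Φ hℓ (μ : LevelQuotient P ℓ) ⟨μ, rfl⟩ η
  · rw [blockUnit, sumSingle_component_of_ne hq, map_zero,
      schrodingerEval_waveUnit_of_ne Φ hℓ q (Ne.symm hq)]

variable (P ℓ) in
/-- Bounded families of operators on the spaces `L²` of the cosets. -/
def BlockOperators : Type _ := lp (fun q : LevelQuotient P ℓ => CosetL2 q →L[ℂ] CosetL2 q) ∞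

instance : NonUnitalCStarAlgebra (BlockOperators P ℓ) :=
  lpInftyCStarAlgebra fun q : LevelQuotient P ℓ => CosetL2 q →L[ℂ] CosetL2 q

/-- The operator on `L²` of a coset. -/
def BlockOperators.eval (x : BlockOperators P ℓ) (q : LevelQuotient P ℓ) :
    CosetL2 q →L[ℂ] CosetL2 q := x.1 q

theorem BlockOperators.ext {x y : BlockOperators P ℓ} (h : ∀ q, x.eval q = y.eval q) : x = y :=
  lp.ext (funext h)

variable (P ℓ) in
/-- The inclusion of the block algebra into families of bounded operators. -/
def blockInclusion : BlockAlgebra P ℓ →⋆ₙₐ[ℂ] BlockOperators P ℓ :=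
  lpLift fun q => (compactInclusion (CosetL2 q)).comp (sumComponent _ q)

theorem blockInclusion_apply (x : BlockAlgebra P ℓ) (q : LevelQuotient P ℓ) :
    (blockInclusion P ℓ x).eval q = compactInclusion (CosetL2 q) (x.component q) := rfl

theorem blockInclusion_injective : Function.Injective (blockInclusion P ℓ) :=
  fun x y hxy => CStarSumAlgebra.ext fun q => compactInclusion_injective _ (by
    rw [← blockInclusion_apply, hxy, blockInclusion_apply])

/-- The family of Schrödinger representations of the homogeneous ideal. -/
def schrodingerFamily (c : Circle →* G) : HomogAlgebra c n →⋆ₙₐ[ℂ] BlockOperators P ℓ :=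
  lpLift fun q => (schrodingerEval Φ hℓ q).comp (homogInclusion c n)

theorem schrodingerFamily_apply {c : Circle →* G} (a : HomogAlgebra c n) (q : LevelQuotient P ℓ) :
    (schrodingerFamily Φ hℓ c a).eval q = schrodingerEval Φ hℓ q (homogInclusion c n a) := rfl

theorem schrodingerFamily_injective [P.IsRootSystem] (h0 : ℓ ≠ 0) {c : Circle →* G}
    (hc : ∀ z, Φ (c z) = TorusExt.central z) :
    Function.Injective (schrodingerFamily Φ hℓ c) := by
  refine fun a b hab => sub_eq_zero.1
    (eq_zero_of_schrodingerEval_eq_zero Φ hℓ h0 hc fun q => ?_)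
  rw [map_sub, map_sub, sub_eq_zero, ← schrodingerFamily_apply, hab, schrodingerFamily_apply]

/-- The homogeneous ideal of weight `n ≠ 0` is a direct sum of algebras of compact operators. -/
theorem exists_blockIso [P.IsRootSystem] (h0 : ℓ ≠ 0) {c : Circle →* G}
    (hc : ∀ z, Φ (c z) = TorusExt.central z) :
    ∃ φ : HomogAlgebra c n ≃⋆ₐ[ℂ] BlockAlgebra P ℓ,
      (∀ a q, blockComponent (φ a) q = schrodingerEval Φ hℓ q (homogInclusion c n a)) ∧
      ∀ μ η, φ (waveElt Φ hc n μ η) = blockUnit ℓ μ η := by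
  have h1 : ∀ x : WeightLattice P × IntegralLattice P,
      schrodingerFamily Φ hℓ c (waveElt Φ hc n x.1 x.2) =
        blockInclusion P ℓ (blockUnit ℓ x.1 x.2) := fun x =>
    BlockOperators.ext fun q => schrodingerEval_eq_blockUnit Φ hℓ q x.1 x.2
  obtain ⟨φ, hφ⟩ := exists_starAlgEquiv_of_dense (schrodingerFamily Φ hℓ c) (blockInclusion P ℓ)
    (schrodingerFamily_injective Φ hℓ h0 hc) blockInclusion_injective _ _ h1
    (mem_closure_span_waveElt Φ hc) mem_closure_span_blockUnit
  refine ⟨φ, fun a q => ?_, fun μ η => blockInclusion_injective ?_⟩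
  · rw [← schrodingerFamily_apply, ← hφ]
    rfl
  · rw [hφ]
    exact h1 (μ, η)

end BlockDecomposition
end

noncomputable section

/-! ## The homogeneous ideal of weight zero -/

section WeightZero

universe u

/-- Characters separate the points of a commutative C*-algebra. -/
theorem exists_character_ne_zero {A : Type*} [NonUnitalCStarAlgebra A]
    (hcomm : ∀ a b : A, a * b = b * a) {a : A} (ha : a ≠ 0) : ∃ φ : A →⋆ₙₐ[ℂ] ℂ, φ a ≠ 0 := by
  let _ : NonUnitalCommCStarAlgebra A :=
    { (inferInstance : NonUnitalCStarAlgebra A) with mul_comm := hcomm }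
  have h1 : (a : Unitization ℂ A) ≠ 0 := fun h => ha (Unitization.inr_injective
    (h.trans (Unitization.inr_zero ℂ).symm))
  -- Gelfand duality is used for the unitization; the character found there is restricted to `A`.
  have h2 : WeakDual.gelfandTransform ℂ (Unitization ℂ A) a ≠ 0 := fun h =>
    h1 ((gelfandTransform_isometry (Unitization ℂ A)).injective (h.trans (map_zero _).symm))
  obtain ⟨φ, hφ⟩ := DFunLike.ne_iff.1 h2
  refine ⟨{ toFun := fun x => φ (x : Unitization ℂ A), map_smul' := ?_, map_zero' := ?_,
            map_add' := ?_, map_mul' := ?_, map_star' := ?_ }, hφ⟩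
  · exact fun c x => by rw [Unitization.inr_smul, map_smul]; rfl
  · rw [Unitization.inr_zero, map_zero]
  · exact fun x y => by rw [Unitization.inr_add, map_add]
  · exact fun x y => by rw [Unitization.inr_mul, map_mul]
  · exact fun x => by rw [Unitization.inr_star, map_star]

/-- The vector state of a unit vector spanning the Hilbert space. -/
def vectorState {H : Type*} [NormedAddCommGroup H] [InnerProductSpace ℂ H] [CompleteSpace H]
    {v : H} (hv : ∀ w, w = (inner ℂ v w : ℂ) • v) : (H →L[ℂ] H) →⋆ₙₐ[ℂ] ℂ where
  toFun T := inner ℂ v (T v)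
  map_smul' c T := by rw [smul_apply, inner_smul_right]; rfl
  map_zero' := by rw [zero_apply, inner_zero_right]
  map_add' S T := by rw [add_apply, inner_add_right]
  map_mul' S T := by
    rw [mul_apply_eq_comp, hv (T v), map_smul, inner_smul_right, mul_comm, ← hv (T v)]
  map_star' T := by
    rw [ContinuousLinearMap.star_eq_adjoint, ContinuousLinearMap.adjoint_inner_right,
      ← inner_conj_symm]
    rfl

variable {ι V : Type*} {W : Type u} [AddCommGroup V] [Module ℝ V] [AddCommGroup W]
  [Module ℝ W] {P : RootPairing ι ℝ V W}

/-- The character `χ ↦ χ(η)` of the dual torus. -/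
def dualChar (η : IntegralLattice P) : C(DualTorus P, ℂ) where
  toFun χ := (χ (Multiplicative.ofAdd η) : Circle)
  continuous_toFun := continuous_subtype_val.comp
    ((continuous_eval_const (F := C(Multiplicative (IntegralLattice P), Circle))
      (Multiplicative.ofAdd η)).comp
      (ContinuousMonoidHom.isInducing_toContinuousMap (Multiplicative (IntegralLattice P))
        Circle).continuous)

theorem dualChar_apply (η : IntegralLattice P) (χ : DualTorus P) :
    dualChar η χ = (χ (Multiplicative.ofAdd η) : Circle) := rfl

theorem mem_closure_span_dualChar (g : C(DualTorus P, ℂ)) :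
    g ∈ closure (Submodule.span ℂ (Set.range (dualChar (P := P))) : Set C(DualTorus P, ℂ)) := by
  refine mem_closure_span_of_separating _ ⟨0, ?_⟩ (fun η ζ => ⟨η + ζ, ?_⟩) (fun η => ⟨-η, ?_⟩)
    (fun χ χ' h => ?_) g
  · ext χ
    rw [dualChar_apply, ofAdd_zero, map_one]
    rfl
  · ext χ
    rw [ContinuousMap.mul_apply, dualChar_apply, dualChar_apply, dualChar_apply, ofAdd_add,
      map_mul]
    rfl
  · ext χ
    rw [ContinuousMap.star_apply, dualChar_apply, dualChar_apply, ofAdd_neg, map_inv,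
      Circle.coe_inv_eq_conj]
    rfl
  · obtain ⟨η, hη⟩ := DFunLike.ne_iff.1 h
    exact ⟨η.toAdd, fun h1 => hη (Circle.ext h1)⟩

open Classical in
/-- The extension by zero of a function on the dual torus, placed over one weight. -/
def weightSlice (μ : WeightLattice P) : C(DualTorus P, ℂ) →ₗ[ℂ]
    C₀(WeightLattice P × DualTorus P, ℂ) where
  toFun h :=
    { toFun := fun x => (if x.1 = μ then 1 else 0) * h x.2
      continuous_toFun := ((continuous_of_discreteTopology
        (f := fun ξ : WeightLattice P => if ξ = μ then (1 : ℂ) else 0)).comp continuous_fst).mul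
          (h.continuous.comp continuous_snd)
      zero_at_infty' := by
        have h1 : IsCompact (({μ} : Set (WeightLattice P)) ×ˢ (Set.univ : Set (DualTorus P))) :=
          isCompact_singleton.prod isCompact_univ
        refine tendsto_const_nhds.congr' ?_
        filter_upwards [h1.compl_mem_cocompact] with x hx
        have h2 : x.1 ≠ μ := fun h => hx ⟨h, Set.mem_univ _⟩
        rw [if_neg h2, zero_mul] }
  map_add' h h' := by ext x; exact mul_add _ _ _
  map_smul' c h := by ext x; exact mul_left_comm _ _ _

theorem weightSlice_same (μ : WeightLattice P) (h : C(DualTorus P, ℂ)) (χ : DualTorus P) :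
    weightSlice μ h (μ, χ) = h χ := by
  classical
  change (if μ = μ then 1 else 0) * h χ = _
  rw [if_pos rfl, one_mul]

theorem weightSlice_of_ne {μ ξ : WeightLattice P} (hξ : ξ ≠ μ) (h : C(DualTorus P, ℂ))
    (χ : DualTorus P) : weightSlice μ h (ξ, χ) = 0 := by
  classical
  change (if ξ = μ then 1 else 0) * h χ = _
  rw [if_neg hξ, zero_mul]

/-- Evaluation of functions vanishing at infinity. -/
def zeroAtInftyEval {X : Type*} [TopologicalSpace X] (x : X) : C₀(X, ℂ) →⋆ₙₐ[ℂ] ℂ where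
  toFun f := f x
  map_smul' _ _ := rfl
  map_zero' := rfl
  map_add' _ _ := rfl
  map_mul' _ _ := rfl
  map_star' _ := rfl

theorem zeroAtInftyEval_apply {X : Type*} [TopologicalSpace X] (x : X) (f : C₀(X, ℂ)) :
    zeroAtInftyEval x f = f x := rfl

theorem norm_c0_le {X : Type*} [TopologicalSpace X] {f : C₀(X, ℂ)} {C : ℝ} (hC : 0 ≤ C)
    (h : ∀ x, ‖f x‖ ≤ C) : ‖f‖ ≤ C :=
  (BoundedContinuousFunction.norm_le (f := f.toBCF) hC).2 h

theorem norm_weightSlice_le (μ : WeightLattice P) (h : C(DualTorus P, ℂ)) :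
    ‖weightSlice μ h‖ ≤ ‖h‖ := by
  refine norm_c0_le (norm_nonneg _) ?_
  rintro ⟨ξ, χ⟩
  by_cases hξ : ξ = μ
  · subst hξ
    rw [weightSlice_same]
    exact h.norm_coe_le_norm _
  · rw [weightSlice_of_ne hξ, norm_zero]
    exact norm_nonneg _

/-- A function vanishing at infinity is small off a compact set, which lies over finitely many
weights. Over each of them the characters of the dual torus are dense by Stone-Weierstrass. -/
theorem mem_closure_span_weightSlice (F : C₀(WeightLattice P × DualTorus P, ℂ)) :
    F ∈ closure (Submodule.span ℂ (Set.range fun x : WeightLattice P × IntegralLattice P =>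
      weightSlice x.1 (dualChar x.2)) : Set C₀(WeightLattice P × DualTorus P, ℂ)) := by
  set S := Submodule.span ℂ (Set.range fun x : WeightLattice P × IntegralLattice P =>
      weightSlice x.1 (dualChar x.2)) with hS
  have h1 : ∀ (μ : WeightLattice P) (h : C(DualTorus P, ℂ)),
      weightSlice μ h ∈ closure (S : Set C₀(WeightLattice P × DualTorus P, ℂ)) := by
    intro μ h
    have hc : Continuous (weightSlice (P := P) μ) :=
      AddMonoidHomClass.continuous_of_bound (weightSlice (P := P) μ) 1
        fun h => by rw [one_mul]; exact norm_weightSlice_le μ h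
    refine map_mem_closure hc (mem_closure_span_dualChar h) fun h hh => ?_
    induction hh using Submodule.span_induction with
    | mem h hh => obtain ⟨η, rfl⟩ := hh; exact Submodule.subset_span ⟨(μ, η), rfl⟩
    | zero => rw [map_zero]; exact zero_mem _
    | add h h' _ _ ha hb => rw [map_add]; exact add_mem ha hb
    | smul c h _ ha => rw [map_smul]; exact Submodule.smul_mem _ _ ha
  rw [← closure_closure, Metric.mem_closure_iff]
  intro ε hε
  have h2 : ∀ᶠ x in cocompact (WeightLattice P × DualTorus P), ‖F x‖ < ε / 2 := by
    have h3 := (zero_at_infty F).norm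
    rw [norm_zero] at h3
    exact h3.eventually (gt_mem_nhds (half_pos hε))
  obtain ⟨K, hK, hKF⟩ := Filter.mem_cocompact.1 h2
  have hfin : (Prod.fst '' K).Finite := (hK.image continuous_fst).finite_of_discrete
  let slice : WeightLattice P → C(DualTorus P, ℂ) := fun μ =>
    ⟨fun χ => F (μ, χ), F.continuous.comp (continuous_const.prodMk continuous_id)⟩
  refine ⟨∑ μ ∈ hfin.toFinset, weightSlice μ (slice μ), ?_, ?_⟩
  · rw [← Submodule.topologicalClosure_coe]
    exact Submodule.sum_mem _ fun μ _ => h1 _ _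
  · rw [dist_eq_norm]
    refine (norm_c0_le (half_pos hε).le ?_).trans_lt (half_lt_self hε)
    rintro ⟨ξ, χ⟩
    have h4 : (F - ∑ μ ∈ hfin.toFinset, weightSlice μ (slice μ)) (ξ, χ) =
        F (ξ, χ) - ∑ μ ∈ hfin.toFinset, weightSlice μ (slice μ) (ξ, χ) := by
      simp only [← zeroAtInftyEval_apply, map_sub, map_sum]
    rw [h4]
    by_cases hξ : ξ ∈ hfin.toFinset
    · rw [Finset.sum_eq_single_of_mem ξ hξ fun μ _ hμ => weightSlice_of_ne hμ.symm _ _,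
        weightSlice_same]
      change ‖F (ξ, χ) - F (ξ, χ)‖ ≤ _
      rw [sub_self, norm_zero]
      exact (half_pos hε).le
    · rw [Finset.sum_eq_zero fun μ hμ => weightSlice_of_ne (fun h : ξ = μ => hξ (h ▸ hμ)) _ _,
        sub_zero]
      refine (show ‖F (ξ, χ)‖ < ε / 2 from hKF fun h5 => hξ ?_).le
      rw [Set.Finite.mem_toFinset]
      exact ⟨_, h5, rfl⟩

variable [Fintype ι] [P.IsCrystallographic] [P.IsReduced] [P.IsIrreducible]
  {k : ℤ} {G : Type u} [Group G] [TopologicalSpace G] (Φ : G ≃ₜ* TorusExt P 0 k)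

/-- The character `(t, η, z) ↦ t^ξ χ(η)`. -/
def characterData (ξ : WeightLattice P) (χ : DualTorus P) : MonomialData G PUnit.{u + 1} where
  perm := 1
  coeff g _ := (Φ g).torus.pow ξ * χ (Multiplicative.ofAdd (Φ g).lattice)
  coeff_mul g h _ := by
    have h1 : (Φ (g * h)).torus = (Φ g).torus * (Φ h).torus := by rw [map_mul]; rfl
    rw [h1, apply_mul_lattice, ofAdd_add, map_mul, MaximalTorus.mul_pow, mul_mul_mul_comm]

theorem continuous_characterCoeff (ξ : WeightLattice P) (χ : DualTorus P) :
    Continuous fun g => (((Φ g).torus.pow ξ * χ (Multiplicative.ofAdd (Φ g).lattice) : Circle) :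
      ℂ) := by
  have h1 : Continuous fun η : IntegralLattice P => χ (Multiplicative.ofAdd η) :=
    continuous_of_discreteTopology
  exact continuous_subtype_val.comp (((MaximalTorus.continuous_pow ξ).comp
    (TorusExt.continuous_torus.comp Φ.continuous)).mul
      (h1.comp (TorusExt.continuous_lattice.comp Φ.continuous)))

theorem linear_characterData (ξ : WeightLattice P) (χ : DualTorus P) (g : G)
    (v : lp (fun _ : PUnit.{u + 1} => ℂ) 2) : (characterData Φ ξ χ).linear g v =
      (((Φ g).torus.pow ξ * χ (Multiplicative.ofAdd (Φ g).lattice) : Circle) : ℂ) • v :=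
  lp.ext (funext fun _ => rfl)

/-- The one-dimensional representation `(t, η, z) ↦ t^ξ χ(η)`. -/
def characterRep (ξ : WeightLattice P) (χ : DualTorus P) : UnitaryRep G :=
  (characterData Φ ξ χ).rep fun _ => by
    simp only [linear_characterData]
    exact (continuous_characterCoeff Φ ξ χ).smul continuous_const

/-- The character `(t, η, z) ↦ t^ξ χ(η)` on universal operators. -/
def characterEval (ξ : WeightLattice P) (χ : DualTorus P) : UniversalOperators G →⋆ₙₐ[ℂ] ℂ :=
  (vectorState (v := (lp.single 2 PUnit.unit (1 : ℂ) : lp (fun _ : PUnit.{u + 1} => ℂ) 2))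
    fun w => by
      rw [lp.inner_single_left]
      refine lp.ext (funext fun j => ?_)
      rw [lp.coeFn_smul, Pi.smul_apply]
      simp).comp (evalRep (characterRep Φ ξ χ))

theorem characterEval_apply (ξ : WeightLattice P) (χ : DualTorus P) (x : UniversalOperators G) :
    characterEval Φ ξ χ x = inner ℂ
      (lp.single 2 PUnit.unit (1 : ℂ) : lp (fun _ : PUnit.{u + 1} => ℂ) 2)
      (evalRep (characterRep Φ ξ χ) x (lp.single 2 PUnit.unit (1 : ℂ) :
        lp (fun _ : PUnit.{u + 1} => ℂ) 2) : lp (fun _ : PUnit.{u + 1} => ℂ) 2) := rfl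

variable [IsTopologicalGroup G] [LocallyCompactSpace G] [MeasurableSpace G] [BorelSpace G]

theorem characterEval_universalRep (ξ : WeightLattice P) (χ : DualTorus P) (f : C_c(G, ℂ)) :
    characterEval Φ ξ χ (universalRep f) = ∫ g, f g *
      (((Φ g).torus.pow ξ * χ (Multiplicative.ofAdd (Φ g).lattice) : Circle) : ℂ)
        ∂Measure.haar := by
  rw [characterEval_apply, evalRep_universalRep]
  refine (ContinuousLinearMap.integral_comp_comm
    (innerSL ℂ (lp.single 2 PUnit.unit (1 : ℂ) : lp (fun _ : PUnit.{u + 1} => ℂ) 2))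
    ((characterRep Φ ξ χ).integrable_smul_act f
      (lp.single 2 PUnit.unit (1 : ℂ) : lp (fun _ : PUnit.{u + 1} => ℂ) 2))).symm.trans ?_
  refine integral_congr_ae (Eventually.of_forall fun g => ?_)
  change innerSL ℂ (lp.single 2 PUnit.unit (1 : ℂ) : lp (fun _ : PUnit.{u + 1} => ℂ) 2)
    (f g • (characterData Φ ξ χ).linear g (lp.single 2 PUnit.unit (1 : ℂ))) = _
  rw [linear_characterData, map_smul, map_smul, innerSL_apply_apply, lp.inner_single_left]
  simp

/-- The one-dimensional representation has the single weight `(0, ξ)`, and the lattice acts on it by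
`χ`. -/
theorem characterEval_waveUnit (ξ : WeightLattice P) (χ : DualTorus P) (μ : WeightLattice P)
    (η : IntegralLattice P) : characterEval Φ ξ χ (waveUnit Φ 0 μ η) =
      weightSlice μ (dualChar η) (ξ, χ) := by
  have hw : IsWeightVector Φ (characterRep Φ ξ χ) 0 ξ
      (lp.single 2 PUnit.unit (1 : ℂ) : lp (fun _ : PUnit.{u + 1} => ℂ) 2) := by
    intro x
    refine (linear_characterData Φ ξ χ _ _).trans ?_
    rw [apply_torusElt, torusChar_apply]
    simp
    rfl
  have h1 : evalRep (characterRep Φ ξ χ) (waveUnit Φ 0 μ η)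
      (lp.single 2 PUnit.unit (1 : ℂ) : lp (fun _ : PUnit.{u + 1} => ℂ) 2) =
      (characterData Φ ξ χ).linear (latticeElt Φ η)
        (weightProj Φ (characterRep Φ ξ χ) 0 μ
          (lp.single 2 PUnit.unit (1 : ℂ) : lp (fun _ : PUnit.{u + 1} => ℂ) 2)) :=
    DFunLike.congr_fun (evalRep_waveUnit Φ (characterRep Φ ξ χ) 0 μ η) _
  rw [characterEval_apply, h1]
  by_cases h : ξ = μ
  · subst h
    rw [hw.weightProj_same, weightSlice_same, linear_characterData, inner_smul_right,
      apply_latticeElt, lp.inner_single_left, dualChar_apply]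
    simp [MaximalTorus.one_pow]
  · rw [hw.weightProj_of_ne fun h1 => h (Prod.ext_iff.1 h1).2.symm, weightSlice_of_ne h]
    refine (congrArg _ (map_zero _)).trans (inner_zero_right _)

variable {c : Circle →* G}

/-- For `n = 0` the lattice fixes all weights, so over each weight the wave elements multiply like
the group Π. Hence the ideal is commutative and its spectrum over each weight is the dual of Π. -/
theorem waveElt_zero_mul_same (hc : ∀ z, Φ (c z) = TorusExt.central z)
    (μ : WeightLattice P) (η ζ : IntegralLattice P) :
    waveElt Φ hc 0 μ η * waveElt Φ hc 0 μ ζ = waveElt Φ hc 0 μ (η + ζ) := by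
  refine homogInclusion_injective c 0 ?_
  have h := waveUnit_mul_same Φ 0 μ η ζ
  rw [mul_zero, zero_smul, add_zero] at h
  rw [map_mul]
  exact h

theorem waveElt_zero_mul_of_ne (hc : ∀ z, Φ (c z) = TorusExt.central z)
    {μ ν : WeightLattice P} (h : μ ≠ ν) (η ζ : IntegralLattice P) :
    waveElt Φ hc 0 μ η * waveElt Φ hc 0 ν ζ = 0 :=
  waveElt_mul_waveElt_of_ne Φ hc η ζ (by simpa using h)

theorem star_waveElt_zero (hc : ∀ z, Φ (c z) = TorusExt.central z)
    (μ : WeightLattice P) (η : IntegralLattice P) :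
    star (waveElt Φ hc 0 μ η) = waveElt Φ hc 0 μ (-η) := by
  refine homogInclusion_injective c 0 ?_
  have h := star_waveUnit Φ 0 μ η
  rw [mul_zero, zero_smul, add_zero] at h
  rw [map_star]
  exact h

theorem homogAlgebra_zero_mul_comm (hc : ∀ z, Φ (c z) = TorusExt.central z)
    (a b : HomogAlgebra c 0) : a * b = b * a := by
  have h : ∀ a b : HomogAlgebra c 0, (∀ μ η, Commute (waveElt Φ hc 0 μ η) b) → Commute a b := by
    intro a b hb
    refine closure_minimal (t := {a | a * b = b * a}) ?_ (isClosed_eq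
      (continuous_id.mul continuous_const) (continuous_const.mul continuous_id))
      (mem_closure_span_waveElt Φ hc a)
    intro a ha
    change Commute a b
    induction ha using Submodule.span_induction with
    | mem a ha => obtain ⟨⟨μ, η⟩, rfl⟩ := ha; exact hb μ η
    | zero => exact Commute.zero_left _
    | add x y _ _ hx hy => exact hx.add_left hy
    | smul r x _ hx => exact hx.smul_left r
  -- The reduction to generators is used twice, once in each factor.
  refine h a b fun μ η => (h b _ fun ν ζ => ?_).symm
  change _ = _
  by_cases hμν : ν = μ
  · subst hμν
    rw [waveElt_zero_mul_same, waveElt_zero_mul_same, add_comm]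
  · rw [waveElt_zero_mul_of_ne Φ hc hμν, waveElt_zero_mul_of_ne Φ hc (Ne.symm hμν)]

/-- Every nonzero character of the homogeneous ideal of weight zero comes from a character of the
group. -/
theorem exists_eq_characterEval (hc : ∀ z, Φ (c z) = TorusExt.central z)
    {φ : HomogAlgebra c 0 →⋆ₙₐ[ℂ] ℂ} {a : HomogAlgebra c 0}
    (ha : φ a ≠ 0) : ∃ ξ χ, ∀ x, φ x = characterEval Φ ξ χ (homogInclusion c 0 x) := by
  obtain ⟨μ, η, hμ⟩ : ∃ μ η, φ (waveElt Φ hc 0 μ η) ≠ 0 := by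
    by_contra! h
    refine ha (closure_minimal (t := {a | φ a = 0}) ?_ (isClosed_eq (continuous_starAlgHom φ)
      continuous_const) (mem_closure_span_waveElt Φ hc a))
    intro a ha
    change φ a = 0
    induction ha using Submodule.span_induction with
    | mem a ha => obtain ⟨⟨μ, η⟩, rfl⟩ := ha; exact h μ η
    | zero => exact map_zero _
    | add x y _ _ hx hy => rw [map_add, hx, hy, add_zero]
    | smul r x _ hx => rw [map_smul, hx, smul_zero]
  have hmul : ∀ η ζ, φ (waveElt Φ hc 0 μ η) * φ (waveElt Φ hc 0 μ ζ) =
      φ (waveElt Φ hc 0 μ (η + ζ)) := fun η ζ => by rw [← map_mul, waveElt_zero_mul_same]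
  -- The weight projection is a unit for the wave elements over `μ`, one of which has nonzero value.
  have hone : φ (waveElt Φ hc 0 μ 0) = 1 := by
    have h := hmul η 0
    rw [add_zero] at h
    exact mul_left_cancel₀ hμ (h.trans (mul_one _).symm)
  -- The wave element of `-η` is both the adjoint and the inverse over the weight `μ`, so the values
  -- are unimodular and define a character of Π.
  have hnorm : ∀ η, ‖φ (waveElt Φ hc 0 μ η)‖ = 1 := by
    intro η
    have h := hmul (-η) η
    rw [neg_add_cancel, hone, ← star_waveElt_zero, map_star] at h
    have h1 := CStarRing.norm_star_mul_self (x := φ (waveElt Φ hc 0 μ η))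
    rw [h, norm_one] at h1
    nlinarith [norm_nonneg (φ (waveElt Φ hc 0 μ η))]
  let χ : DualTorus P := (⟨MonoidHom.mk' (fun η => (⟨φ (waveElt Φ hc 0 μ η.toAdd),
      mem_sphere_zero_iff_norm.2 (hnorm _)⟩ : Circle)) fun η ζ => Circle.ext (hmul _ _).symm,
      continuous_of_discreteTopology⟩ : Multiplicative (IntegralLattice P) →ₜ* Circle)
  refine ⟨μ, χ, fun x => ?_⟩
  refine closure_minimal (t := {x | φ x = characterEval Φ μ χ (homogInclusion c 0 x)}) ?_
    (isClosed_eq (continuous_starAlgHom φ) ((continuous_starAlgHom _).comp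
      (continuous_starAlgHom _))) (mem_closure_span_waveElt Φ hc x)
  intro x hx
  change φ x = characterEval Φ μ χ (homogInclusion c 0 x)
  induction hx using Submodule.span_induction with
  | mem x hx =>
    obtain ⟨⟨ν, ζ⟩, rfl⟩ := hx
    simp only
    rw [homogInclusion_waveElt, characterEval_waveUnit]
    by_cases h : μ = ν
    · subst h
      rw [weightSlice_same]
      rfl
    · rw [weightSlice_of_ne h]
      -- The projection for `μ` has value 1 and is orthogonal to the wave elements over any other
      -- weight, which must therefore have value 0.
      have h1 := congrArg φ (waveElt_zero_mul_of_ne Φ hc h 0 ζ)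
      rwa [map_mul, hone, one_mul, map_zero] at h1
  | zero => simp only [map_zero]
  | add x y _ _ hx hy => simp only [map_add, hx, hy]
  | smul r x _ hx => simp only [map_smul, hx]

/-- The homogeneous ideal of weight zero is commutative, with spectrum `Π* × T^∨`. -/
theorem exists_weightZeroIso (hc : ∀ z, Φ (c z) = TorusExt.central z) :
    ∃ φ : HomogAlgebra c 0 ≃⋆ₐ[ℂ] C₀(WeightLattice P × DualTorus P, ℂ),
    ∀ a ξ χ, φ a (ξ, χ) = characterEval Φ ξ χ (homogInclusion c 0 a) := by
  let ψ : HomogAlgebra c 0 →⋆ₙₐ[ℂ] lp (fun _ : WeightLattice P × DualTorus P => ℂ) ∞ :=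
    lpLift fun x => (characterEval Φ x.1 x.2).comp (homogInclusion c 0)
  let i : C₀(WeightLattice P × DualTorus P, ℂ) →⋆ₙₐ[ℂ]
      lp (fun _ : WeightLattice P × DualTorus P => ℂ) ∞ := lpLift fun x => zeroAtInftyEval x
  -- Characters separate the points of a commutative C*-algebra, and by `exists_eq_characterEval`
  -- all of them are already components of `ψ`.
  have hψ : Function.Injective ψ := by
    refine (injective_iff_map_eq_zero ψ).2 fun a ha => ?_
    by_contra h0
    obtain ⟨φ, hφ⟩ := exists_character_ne_zero (homogAlgebra_zero_mul_comm Φ hc) h0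
    obtain ⟨ξ, χ, h⟩ := exists_eq_characterEval Φ hc hφ
    exact hφ ((h a).trans (congrFun (congrArg Subtype.val ha) (ξ, χ)))
  have hi : Function.Injective i := fun f g h => ZeroAtInftyContinuousMap.ext fun x =>
    congrFun (congrArg Subtype.val h) x
  obtain ⟨φ, hφ⟩ := exists_starAlgEquiv_of_dense ψ i hψ hi
    (fun x : WeightLattice P × IntegralLattice P => waveElt Φ hc 0 x.1 x.2)
    (fun x => weightSlice x.1 (dualChar x.2))
    (fun x => lp.ext (funext fun y => characterEval_waveUnit Φ y.1 y.2 x.1 x.2))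
    (mem_closure_span_waveElt Φ hc) mem_closure_span_weightSlice
  exact ⟨φ, fun a ξ χ => congrFun (congrArg Subtype.val (hφ a)) (ξ, χ)⟩

end WeightZero
end

noncomputable section

/-! ## Murray-von Neumann equivalence and classes of projections -/

section MurrayVonNeumann

open scoped Matrix

variable {R S : Type*} [Ring R] [StarRing R] [Ring S] [StarRing S] {m n l m' n' : Type*}
  [Fintype m] [Fintype n] [Fintype l] [Fintype m'] [Fintype n']

/-- Murray-von Neumann equivalence of projections in matrix algebras of any finite sizes. -/
def MvNEquiv (p : Matrix m m R) (q : Matrix n n R) : Prop :=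
  ∃ v : Matrix n m R, vᴴ * v = p ∧ v * vᴴ = q

theorem IsStarProjection.conjTranspose_eq {p : Matrix m m R} (hp : IsStarProjection p) : pᴴ = p :=
  hp.isSelfAdjoint

theorem IsStarProjection.mul_self {p : Matrix m m R} (hp : IsStarProjection p) : p * p = p :=
  hp.isIdempotentElem

theorem isStarProjection_matrix {p : Matrix m m R} (h1 : pᴴ = p) (h2 : p * p = p) :
    IsStarProjection p := ⟨h2, h1⟩

theorem IsStarProjection.submatrix {p : Matrix m m R} (hp : IsStarProjection p) (e : n ≃ m) :
    IsStarProjection (p.submatrix e e) := by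
  refine isStarProjection_matrix ?_ ?_
  · rw [Matrix.conjTranspose_submatrix, hp.conjTranspose_eq]
  · rw [Matrix.submatrix_mul_equiv, hp.mul_self]

theorem IsStarProjection.fromBlocks {p : Matrix m m R} {q : Matrix n n R} (hp : IsStarProjection p)
    (hq : IsStarProjection q) : IsStarProjection (Matrix.fromBlocks p 0 0 q) := by
  refine isStarProjection_matrix ?_ ?_
  · rw [Matrix.fromBlocks_conjTranspose, hp.conjTranspose_eq, hq.conjTranspose_eq,
      Matrix.conjTranspose_zero, Matrix.conjTranspose_zero]
  · rw [Matrix.fromBlocks_multiply, hp.mul_self, hq.mul_self]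
    simp

namespace MvNEquiv

theorem refl {p : Matrix m m R} (hp : IsStarProjection p) : MvNEquiv p p :=
  ⟨p, by rw [hp.conjTranspose_eq, hp.mul_self], by rw [hp.conjTranspose_eq, hp.mul_self]⟩

theorem symm {p : Matrix m m R} {q : Matrix n n R} (h : MvNEquiv p q) : MvNEquiv q p := by
  obtain ⟨v, h1, h2⟩ := h
  exact ⟨vᴴ, by rwa [Matrix.conjTranspose_conjTranspose],
    by rwa [Matrix.conjTranspose_conjTranspose]⟩

theorem trans {p : Matrix m m R} {q : Matrix n n R} {r : Matrix l l R} (h : MvNEquiv p q)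
    (h' : MvNEquiv q r) (hp : IsStarProjection p) (hr : IsStarProjection r) : MvNEquiv p r := by
  obtain ⟨v, h1, h2⟩ := h
  obtain ⟨w, h3, h4⟩ := h'
  refine ⟨w * v, ?_, ?_⟩
  · calc (w * v)ᴴ * (w * v) = vᴴ * (wᴴ * w) * v := by
          rw [Matrix.conjTranspose_mul]; simp only [Matrix.mul_assoc]
      _ = (vᴴ * v) * (vᴴ * v) := by rw [h3, ← h2]; simp only [Matrix.mul_assoc]
      _ = p := by rw [h1, hp.mul_self]
  · calc (w * v) * (w * v)ᴴ = w * (v * vᴴ) * wᴴ := by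
          rw [Matrix.conjTranspose_mul]; simp only [Matrix.mul_assoc]
      _ = (w * wᴴ) * (w * wᴴ) := by rw [h2, ← h3]; simp only [Matrix.mul_assoc]
      _ = r := by rw [h4, hr.mul_self]

theorem submatrix {p : Matrix m m R} (hp : IsStarProjection p) (e : n ≃ m) :
    MvNEquiv p (p.submatrix e e) := by
  refine ⟨p.submatrix e id, ?_, ?_⟩
  · rw [Matrix.conjTranspose_submatrix, Matrix.submatrix_mul_equiv, hp.conjTranspose_eq,
      hp.mul_self, Matrix.submatrix_id_id]
  · rw [Matrix.conjTranspose_submatrix, hp.conjTranspose_eq]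
    exact (Matrix.submatrix_mul_equiv p p e (Equiv.refl m) e).trans (by rw [hp.mul_self])

theorem fromBlocks {p : Matrix m m R} {q : Matrix n n R} {p' : Matrix m' m' R}
    {q' : Matrix n' n' R} (h : MvNEquiv p p') (h' : MvNEquiv q q') :
    MvNEquiv (Matrix.fromBlocks p 0 0 q) (Matrix.fromBlocks p' 0 0 q') := by
  obtain ⟨v, h1, h2⟩ := h
  obtain ⟨w, h3, h4⟩ := h'
  refine ⟨Matrix.fromBlocks v 0 0 w, ?_, ?_⟩
  · rw [Matrix.fromBlocks_conjTranspose, Matrix.fromBlocks_multiply, h1, h3]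
    simp
  · rw [Matrix.fromBlocks_conjTranspose, Matrix.fromBlocks_multiply, h2, h4]
    simp

/-- Orthogonal projections: `diag(p, q)` is equivalent to `p + q`. -/
theorem add {p q : Matrix m m R} (hp : IsStarProjection p) (hq : IsStarProjection q)
    (h : p * q = 0) : MvNEquiv (p + q) (Matrix.fromBlocks p 0 0 q) := by
  have h' : q * p = 0 := by
    have h1 := congrArg Matrix.conjTranspose h
    rwa [Matrix.conjTranspose_mul, hp.conjTranspose_eq, hq.conjTranspose_eq,
      Matrix.conjTranspose_zero] at h1
  refine ⟨Matrix.fromRows p q, ?_, ?_⟩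
  · rw [Matrix.conjTranspose_fromRows_eq_fromCols_conjTranspose, Matrix.fromCols_mul_fromRows,
      hp.conjTranspose_eq, hq.conjTranspose_eq, hp.mul_self, hq.mul_self]
  · rw [Matrix.conjTranspose_fromRows_eq_fromCols_conjTranspose, Matrix.fromRows_mul_fromCols,
      hp.conjTranspose_eq, hq.conjTranspose_eq, hp.mul_self, hq.mul_self, h, h']

end MvNEquiv

/-- The projection in the algebra of matrices indexed by `Fin`. -/
def MatrixProjection.of (p : Matrix m m R) (hp : IsStarProjection p) : MatrixProjection R where
  size := Fintype.card m
  mat := p.submatrix (Fintype.equivFin m).symm (Fintype.equivFin m).symm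
  isStarProjection := hp.submatrix _

theorem MatrixProjection.of_equivalent {p : Matrix m m R} {q : Matrix n n R}
    (hp : IsStarProjection p) (hq : IsStarProjection q) (h : MvNEquiv p q) :
    (MatrixProjection.of p hp).Equivalent (MatrixProjection.of q hq) :=
  ((MvNEquiv.submatrix hp _).symm.trans h (hp.submatrix _) hq).trans (MvNEquiv.submatrix hq _)
    (hp.submatrix _) (hq.submatrix _)

open Classical in
/-- The class in `K₀` of a projection in a matrix algebra, with value `0` on other matrices. -/
def kClass (p : Matrix m m R) : KZeroUnital R :=
  if hp : IsStarProjection p then KZeroUnital.mk (MatrixProjection.of p hp) else 0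

theorem kClass_eq {p : Matrix m m R} (hp : IsStarProjection p) :
    kClass p = KZeroUnital.mk (MatrixProjection.of p hp) := dif_pos hp

theorem kClass_eq_of_equiv {p : Matrix m m R} {q : Matrix n n R} (hp : IsStarProjection p)
    (hq : IsStarProjection q) (h : MvNEquiv p q) : kClass p = kClass q := by
  rw [kClass_eq hp, kClass_eq hq]
  exact KZeroUnital.mk_eq (MatrixProjection.of_equivalent hp hq h)

theorem mk_eq_kClass (p : MatrixProjection R) : KZeroUnital.mk p = kClass p.mat := by
  rw [kClass_eq p.isStarProjection]
  exact KZeroUnital.mk_eq (MvNEquiv.submatrix p.isStarProjection _)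

theorem kClass_zero : kClass (0 : Matrix m m R) = 0 := by
  rw [kClass_eq (isStarProjection_matrix Matrix.conjTranspose_zero (mul_zero _))]
  exact KZeroUnital.mk_eq_zero rfl

theorem kClass_fromBlocks {p : Matrix m m R} {q : Matrix n n R} (hp : IsStarProjection p)
    (hq : IsStarProjection q) : kClass (Matrix.fromBlocks p 0 0 q) = kClass p + kClass q := by
  rw [kClass_eq hp, kClass_eq hq, ← KZeroUnital.mk_blockSum, mk_eq_kClass]
  refine kClass_eq_of_equiv (hp.fromBlocks hq) (MatrixProjection.isStarProjection _) ?_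
  exact (MvNEquiv.fromBlocks (MvNEquiv.submatrix hp _) (MvNEquiv.submatrix hq _)).trans
    (MvNEquiv.submatrix ((hp.submatrix _).fromBlocks (hq.submatrix _)) _) (hp.fromBlocks hq)
    (((hp.submatrix _).fromBlocks (hq.submatrix _)).submatrix _)

theorem IsStarProjection.add_of_mul_eq_zero {p q : Matrix m m R} (hp : IsStarProjection p)
    (hq : IsStarProjection q) (h : p * q = 0) : IsStarProjection (p + q) := by
  have h' : q * p = 0 := by
    have h1 := congrArg Matrix.conjTranspose h
    rwa [Matrix.conjTranspose_mul, hp.conjTranspose_eq, hq.conjTranspose_eq,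
      Matrix.conjTranspose_zero] at h1
  refine isStarProjection_matrix ?_ ?_
  · rw [Matrix.conjTranspose_add, hp.conjTranspose_eq, hq.conjTranspose_eq]
  · rw [add_mul, mul_add, mul_add, h, h', hp.mul_self, hq.mul_self, add_zero, zero_add]

theorem kClass_add {p q : Matrix m m R} (hp : IsStarProjection p) (hq : IsStarProjection q)
    (h : p * q = 0) : kClass (p + q) = kClass p + kClass q := by
  rw [← kClass_fromBlocks hp hq]
  exact kClass_eq_of_equiv (hp.add_of_mul_eq_zero hq h) (hp.fromBlocks hq) (MvNEquiv.add hp hq h)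

theorem kClass_sum {J : Type*} (s : Finset J) {p : J → Matrix m m R}
    (hp : ∀ j ∈ s, IsStarProjection (p j)) (h : ∀ i ∈ s, ∀ j ∈ s, i ≠ j → p i * p j = 0) :
    IsStarProjection (∑ j ∈ s, p j) ∧ kClass (∑ j ∈ s, p j) = ∑ j ∈ s, kClass (p j) := by
  classical
  induction s using Finset.induction_on with
  | empty =>
    exact ⟨isStarProjection_matrix Matrix.conjTranspose_zero (mul_zero _), kClass_zero⟩
  | insert a s ha ih =>
    obtain ⟨h1, h2⟩ := ih (fun j hj => hp j (Finset.mem_insert_of_mem hj))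
      fun i hi j hj => h i (Finset.mem_insert_of_mem hi) j (Finset.mem_insert_of_mem hj)
    have h3 := hp a (Finset.mem_insert_self a s)
    have h4 : p a * ∑ j ∈ s, p j = 0 := by
      rw [Finset.mul_sum]
      exact Finset.sum_eq_zero fun j hj => h a (Finset.mem_insert_self a s) j
        (Finset.mem_insert_of_mem hj) fun h5 => ha (h5 ▸ hj)
    rw [Finset.sum_insert ha, Finset.sum_insert ha, kClass_add h3 h1 h4, h2]
    exact ⟨h3.add_of_mul_eq_zero h1 h4, rfl⟩

theorem IsStarProjection.map_matrix {p : Matrix m m R} (hp : IsStarProjection p) (f : R →+* S)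
    (hf : ∀ x, f (star x) = star (f x)) : IsStarProjection (p.map f) := by
  refine isStarProjection_matrix ?_ ?_
  · rw [← Matrix.conjTranspose_map f hf, hp.conjTranspose_eq]
  · rw [← Matrix.map_mul, hp.mul_self]

theorem map_mk (f : R →+* S) (hf : ∀ x, f (star x) = star (f x)) (p : MatrixProjection R) :
    KZeroUnital.map f hf (KZeroUnital.mk p) = KZeroUnital.mk (p.map f hf) := by
  simp [KZeroUnital.map, KZeroUnital.mk]

theorem map_kClass (f : R →+* S) (hf : ∀ x, f (star x) = star (f x)) {p : Matrix m m R}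
    (hp : IsStarProjection p) : KZeroUnital.map f hf (kClass p) = kClass (p.map f) := by
  rw [kClass_eq hp, kClass_eq (hp.map_matrix f hf), map_mk]
  rfl

theorem KZeroUnital.induction {C : KZeroUnital R → Prop} (h1 : ∀ p, C (KZeroUnital.mk p))
    (hadd : ∀ x y, C x → C y → C (x + y)) (hneg : ∀ x, C x → C (-x)) (h0 : C 0)
    (x : KZeroUnital R) : C x := by
  obtain ⟨y, rfl⟩ := QuotientAddGroup.mk_surjective x
  induction y using FreeAbelianGroup.induction_on with
  | zero => exact h0
  | of p => exact h1 p
  | neg p hp => exact hneg _ hp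
  | add x y hx hy => exact hadd _ _ hx hy

end MurrayVonNeumann
end

noncomputable section

/-! ## Stable equivalence of projections with the same class -/

section StableEquivalence

open scoped Matrix

variable {R : Type*} [Ring R] [StarRing R]

variable (R) in
/-- Murray-von Neumann equivalence as an equivalence relation. -/
def matrixProjectionSetoid : Setoid (MatrixProjection R) where
  r p q := MvNEquiv p.mat q.mat
  iseqv :=
    { refl := fun p => MvNEquiv.refl p.isStarProjection
      symm := fun h => h.symm
      trans := fun {p _ r} h h' => h.trans h' p.isStarProjection r.isStarProjection }

variable (R) in
/-- The monoid of equivalence classes of projections in matrix algebras. -/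
def ProjectionClass : Type _ := Quotient (matrixProjectionSetoid R)

/-- The equivalence class of a projection. -/
def ProjectionClass.mk (p : MatrixProjection R) : ProjectionClass R :=
  Quotient.mk (matrixProjectionSetoid R) p

theorem ProjectionClass.mk_eq_iff {p q : MatrixProjection R} :
    ProjectionClass.mk p = ProjectionClass.mk q ↔ MvNEquiv p.mat q.mat :=
  Quotient.eq (r := matrixProjectionSetoid R)

theorem blockSum_equiv (p q : MatrixProjection R) :
    MvNEquiv (Matrix.fromBlocks p.mat 0 0 q.mat) (p.blockSum q).mat :=
  MvNEquiv.submatrix (p.isStarProjection.fromBlocks q.isStarProjection) finSumFinEquiv.symm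

theorem mvnEquiv_comm {m n : Type*} [Fintype m] [Fintype n] {p : Matrix m m R} {q : Matrix n n R}
    (hp : IsStarProjection p) (hq : IsStarProjection q) :
    MvNEquiv (Matrix.fromBlocks p 0 0 q) (Matrix.fromBlocks q 0 0 p) := by
  have h := MvNEquiv.submatrix (hp.fromBlocks hq) (Equiv.sumComm n m)
  have h1 : (Matrix.fromBlocks p 0 0 q).submatrix (Equiv.sumComm n m) (Equiv.sumComm n m) =
      Matrix.fromBlocks q 0 0 p := by
    ext (i | i) (j | j) <;> rfl
  rwa [h1] at h

theorem mvnEquiv_assoc {m n l : Type*} [Fintype m] [Fintype n] [Fintype l] {p : Matrix m m R}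
    {q : Matrix n n R} {r : Matrix l l R} (hp : IsStarProjection p) (hq : IsStarProjection q)
    (hr : IsStarProjection r) :
    MvNEquiv (Matrix.fromBlocks (Matrix.fromBlocks p 0 0 q) 0 0 r)
      (Matrix.fromBlocks p 0 0 (Matrix.fromBlocks q 0 0 r)) := by
  have h := MvNEquiv.submatrix ((hp.fromBlocks hq).fromBlocks hr) (Equiv.sumAssoc m n l).symm
  have h1 : (Matrix.fromBlocks (Matrix.fromBlocks p 0 0 q) 0 0 r).submatrix
      (Equiv.sumAssoc m n l).symm (Equiv.sumAssoc m n l).symm =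
      Matrix.fromBlocks p 0 0 (Matrix.fromBlocks q 0 0 r) := by
    ext (i | i | i) (j | j | j) <;> rfl
  rwa [h1] at h

theorem mvnEquiv_zero_fromBlocks {m n : Type*} [Fintype m] [Fintype n] {q : Matrix n n R}
    (hq : IsStarProjection q) : MvNEquiv (Matrix.fromBlocks (0 : Matrix m m R) 0 0 q) q := by
  have h0 : MvNEquiv (q : Matrix n n R) (Matrix.fromBlocks (0 : Matrix m m R) 0 0 q) := by
    refine ⟨Matrix.fromRows 0 q, ?_, ?_⟩
    · rw [Matrix.conjTranspose_fromRows_eq_fromCols_conjTranspose, Matrix.fromCols_mul_fromRows,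
        hq.conjTranspose_eq, hq.mul_self, Matrix.mul_zero, zero_add]
    · rw [Matrix.conjTranspose_fromRows_eq_fromCols_conjTranspose, Matrix.fromRows_mul_fromCols,
        hq.conjTranspose_eq, hq.mul_self]
      simp
  exact h0.symm

instance : Add (ProjectionClass R) where
  add := Quotient.map₂ MatrixProjection.blockSum fun p p' h q q' h' =>
    ((blockSum_equiv p q).symm.trans (h.fromBlocks h')
      (MatrixProjection.isStarProjection _)
      (p'.isStarProjection.fromBlocks q'.isStarProjection)).trans (blockSum_equiv p' q')
        (MatrixProjection.isStarProjection _) (MatrixProjection.isStarProjection _)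

instance : Zero (ProjectionClass R) where
  zero := ProjectionClass.mk ⟨0, 0, isStarProjection_matrix Matrix.conjTranspose_zero (mul_zero _)⟩

instance : AddCommMonoid (ProjectionClass R) where
  nsmul := nsmulRec
  zero_add := by
    rintro ⟨p⟩
    refine ProjectionClass.mk_eq_iff.2 ?_
    exact (blockSum_equiv _ _).symm.trans (mvnEquiv_zero_fromBlocks p.isStarProjection)
      (MatrixProjection.isStarProjection _) p.isStarProjection
  add_zero := by
    rintro ⟨p⟩
    refine ProjectionClass.mk_eq_iff.2 ?_
    refine (blockSum_equiv _ _).symm.trans ?_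
      (MatrixProjection.isStarProjection _) p.isStarProjection
    exact (mvnEquiv_comm p.isStarProjection (MatrixProjection.isStarProjection _)).trans
      (mvnEquiv_zero_fromBlocks p.isStarProjection)
      (p.isStarProjection.fromBlocks (MatrixProjection.isStarProjection _)) p.isStarProjection
  add_comm := by
    rintro ⟨p⟩ ⟨q⟩
    refine ProjectionClass.mk_eq_iff.2 ?_
    exact ((blockSum_equiv p q).symm.trans (mvnEquiv_comm p.isStarProjection q.isStarProjection)
      (MatrixProjection.isStarProjection _)
      (q.isStarProjection.fromBlocks p.isStarProjection)).trans (blockSum_equiv q p)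
      (MatrixProjection.isStarProjection _) (MatrixProjection.isStarProjection _)
  add_assoc := by
    rintro ⟨p⟩ ⟨q⟩ ⟨r⟩
    refine ProjectionClass.mk_eq_iff.2 ?_
    have hp := p.isStarProjection
    have hq := q.isStarProjection
    have hr := r.isStarProjection
    have h1 : MvNEquiv ((p.blockSum q).blockSum r).mat
        (Matrix.fromBlocks (Matrix.fromBlocks p.mat 0 0 q.mat) 0 0 r.mat) :=
      (blockSum_equiv _ _).symm.trans ((blockSum_equiv p q).symm.fromBlocks (MvNEquiv.refl hr))
        (MatrixProjection.isStarProjection _) ((hp.fromBlocks hq).fromBlocks hr)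
    have h2 : MvNEquiv (Matrix.fromBlocks p.mat 0 0 (Matrix.fromBlocks q.mat 0 0 r.mat))
        (p.blockSum (q.blockSum r)).mat :=
      ((MvNEquiv.refl hp).fromBlocks (blockSum_equiv q r)).trans (blockSum_equiv _ _)
        (hp.fromBlocks (hq.fromBlocks hr)) (MatrixProjection.isStarProjection _)
    exact (h1.trans (mvnEquiv_assoc hp hq hr) (MatrixProjection.isStarProjection _)
      (hp.fromBlocks (hq.fromBlocks hr))).trans h2 (MatrixProjection.isStarProjection _)
        (MatrixProjection.isStarProjection _)

theorem ProjectionClass.mk_blockSum (p q : MatrixProjection R) :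
    ProjectionClass.mk (p.blockSum q) = ProjectionClass.mk p + ProjectionClass.mk q := rfl

variable (R) in
/-- The map from `K₀`, given by generators and relations, to the Grothendieck group. -/
def kZeroToGrothendieck :
    KZeroUnital R →+ Algebra.GrothendieckAddGroup (ProjectionClass R) :=
  QuotientAddGroup.lift (kRelations R) (FreeAbelianGroup.lift fun p =>
      Algebra.GrothendieckAddGroup.of (ProjectionClass.mk p)) <| by
    refine (AddSubgroup.closure_le _).2 ?_
    rintro _ (⟨p, q, rfl⟩ | ⟨p, q, h, rfl⟩)
    · simp [ProjectionClass.mk_blockSum]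
    · have h1 : ProjectionClass.mk p = ProjectionClass.mk q := ProjectionClass.mk_eq_iff.2 h
      simp [h1]

/-- Projections with the same class in `K₀` are stably equivalent. -/
theorem exists_stable_equiv {p q : MatrixProjection R}
    (h : KZeroUnital.mk p = KZeroUnital.mk q) : ∃ r : MatrixProjection R,
      MvNEquiv (Matrix.fromBlocks p.mat 0 0 r.mat) (Matrix.fromBlocks q.mat 0 0 r.mat) := by
  have h0 : ∀ p, kZeroToGrothendieck R (KZeroUnital.mk p) =
      Algebra.GrothendieckAddGroup.of (ProjectionClass.mk p) := fun p => by
    simp [kZeroToGrothendieck, KZeroUnital.mk]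
  have h1 := congrArg (kZeroToGrothendieck R) h
  rw [h0, h0] at h1
  -- Two elements of a commutative monoid agree in its Grothendieck group exactly when they agree
  -- after adding a common element.
  obtain ⟨⟨c, _⟩, hc⟩ := (AddLocalization.addMonoidOf ⊤).eq_iff_exists.1 h1
  obtain ⟨r, rfl⟩ := Quotient.exists_rep c
  have h2 : ProjectionClass.mk (p.blockSum r) = ProjectionClass.mk (q.blockSum r) := by
    rw [ProjectionClass.mk_blockSum, ProjectionClass.mk_blockSum, add_comm,
      add_comm (ProjectionClass.mk q)]
    exact hc
  have h3 := ProjectionClass.mk_eq_iff.1 h2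
  have hp := p.isStarProjection.fromBlocks r.isStarProjection
  have hq := q.isStarProjection.fromBlocks r.isStarProjection
  exact ⟨r, ((blockSum_equiv p r).trans h3 hp (MatrixProjection.isStarProjection _)).trans
    (blockSum_equiv q r).symm hp hq⟩

/-- If the class of a projection vanishes, then it can be absorbed by an identity matrix. -/
theorem exists_absorbing {m : Type*} [Fintype m] {p : Matrix m m R} (hp : IsStarProjection p)
    (h : kClass p = 0) : ∃ N : ℕ, MvNEquiv
      (Matrix.fromBlocks p 0 0 (1 : Matrix (Fin N) (Fin N) R)) (1 : Matrix (Fin N) (Fin N) R) := by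
  rw [kClass_eq hp, ← KZeroUnital.mk_eq_zero (p := ⟨0, 0,
    isStarProjection_matrix Matrix.conjTranspose_zero (mul_zero _)⟩) rfl] at h
  obtain ⟨r, hr⟩ := exists_stable_equiv h
  have hpr := hp.fromBlocks r.isStarProjection
  have h1 : MvNEquiv (Matrix.fromBlocks p 0 0 r.mat) r.mat :=
    ((((MvNEquiv.submatrix hp _).fromBlocks (MvNEquiv.refl r.isStarProjection)).trans hr hpr
      ((MatrixProjection.isStarProjection _).fromBlocks r.isStarProjection)).trans
      (mvnEquiv_zero_fromBlocks r.isStarProjection) hpr r.isStarProjection)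
  have hr' : IsStarProjection (1 - r.mat) := r.isStarProjection.one_sub
  -- Adding the complement of `r` turns stabilisation by `r` into stabilisation by an identity
  -- matrix.
  have h2 : MvNEquiv (1 : Matrix (Fin r.size) (Fin r.size) R)
      (Matrix.fromBlocks r.mat 0 0 (1 - r.mat)) := by
    have h3 := MvNEquiv.add r.isStarProjection hr'
      (by rw [mul_sub, r.isStarProjection.mul_self, mul_one, sub_self])
    rwa [add_sub_cancel] at h3
  have hone : IsStarProjection (1 : Matrix (Fin r.size) (Fin r.size) R) :=
    isStarProjection_matrix Matrix.conjTranspose_one (mul_one _)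
  refine ⟨r.size, ?_⟩
  have h4 := ((MvNEquiv.refl hp).fromBlocks h2).trans
    (mvnEquiv_assoc hp r.isStarProjection hr').symm (hp.fromBlocks hone) (hpr.fromBlocks hr')
  exact (h4.trans (h1.fromBlocks (MvNEquiv.refl hr')) (hp.fromBlocks hone)
    (r.isStarProjection.fromBlocks hr')).trans h2.symm (hp.fromBlocks hone) hone

end StableEquivalence

/-! ## Partial isometries from almost commuting projections -/

section PartialIsometry

/-- If the projection `r` is nearly dominated by `P`, then it is equivalent to a projection below
`P`. -/
theorem exists_partialIsometry {M : Type*} [CStarAlgebra M] {P r : M} (hP : IsStarProjection P)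
    (hr : IsStarProjection r) (h : ‖r * P * r - r‖ < 1) : ∃ v : M, star v * v = r ∧ P * v = v := by
  let _ := CStarAlgebra.spectralOrder M
  have _ := CStarAlgebra.spectralOrderedRing M
  have hPP : P * P = P := hP.isIdempotentElem
  have hrr : r * r = r := hr.isIdempotentElem
  have hPs : star P = P := hP.isSelfAdjoint
  have hrs : star r = r := hr.isSelfAdjoint
  -- This element is positive, invertible and commutes with `r`. The partial isometry is the polar
  -- part of P r, namely P r Y^(-1/2), since Y^(-1/2) r P r Y^(-1/2) = r.
  set Y : M := r * P * r + (1 - r) with hY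
  have hunit : IsUnit Y := by
    have h1 : Y = 1 - (r - r * P * r) := by rw [hY]; abel
    rw [h1]
    exact isUnit_one_sub_of_norm_lt_one (by rwa [norm_sub_rev])
  have hpos : 0 ≤ Y := by
    refine add_nonneg ?_ ?_
    · have h1 : r * P * r = star (P * r) * (P * r) := by
        rw [star_mul, hPs, hrs, ← mul_assoc, mul_assoc r P P, hPP]
      rw [h1]
      exact star_mul_self_nonneg _
    · exact hr.one_sub.nonneg
  have hstrict : IsStrictlyPositive Y := ⟨hpos, hunit⟩
  have hrY : r * Y = r * P * r := by
    rw [hY, mul_add, mul_sub, mul_one, hrr, sub_self, add_zero, ← mul_assoc, ← mul_assoc, hrr]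
  have hYr : Y * r = r * P * r := by
    rw [hY, add_mul, sub_mul, one_mul, hrr, sub_self, add_zero, mul_assoc, hrr]
  set Z : M := Y ^ (-(1 / 2) : ℝ) with hZ
  have hZs : star Z = Z := (IsSelfAdjoint.of_nonneg CFC.rpow_nonneg).star_eq
  have hZY : Z * Y * Z = 1 := CFC.conjugate_rpow_neg_one_half Y
  have hZr : Commute Z r := by
    rw [hZ, CFC.rpow_def]
    exact Commute.cfc_nnreal (show Commute Y r from hYr.trans hrY.symm) _
  refine ⟨P * r * Z, ?_, ?_⟩
  · calc star (P * r * Z) * (P * r * Z) = Z * (r * (P * P) * r) * Z := by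
          rw [star_mul, star_mul, hPs, hrs, hZs]; simp only [mul_assoc]
      _ = Z * r * Y * Z := by rw [hPP, ← hrY]; simp only [mul_assoc]
      _ = r * (Z * Y * Z) := by rw [hZr.eq]; simp only [mul_assoc]
      _ = r := by rw [hZY, mul_one]
  · rw [← mul_assoc, ← mul_assoc, hPP]

end PartialIsometry
end

noncomputable section

/-! ## Finiteness of matrices over the unitization of the compact operators -/

section Finiteness

open scoped Matrix

variable {H : Type*} [NormedAddCommGroup H] [InnerProductSpace ℂ H] {m : Type*} [Fintype m]
  [DecidableEq m]

/-- The action of a matrix of operators on vectors. -/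
def matrixOp (M : Matrix m m (H →L[ℂ] H)) : (m → H) →L[ℂ] (m → H) :=
  ∑ i, ∑ j, (ContinuousLinearMap.single ℂ (fun _ : m => H) i) ∘L (M i j) ∘L
    (ContinuousLinearMap.proj j : (m → H) →L[ℂ] H)

theorem matrixOp_apply (M : Matrix m m (H →L[ℂ] H)) (x : m → H) (i : m) :
    matrixOp M x i = ∑ j, M i j (x j) := by
  have h : ∀ k, (∑ j, (ContinuousLinearMap.single ℂ (fun _ : m => H) k) ∘L (M k j) ∘L
      (ContinuousLinearMap.proj j : (m → H) →L[ℂ] H)) x i =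
      if i = k then ∑ j, M i j (x j) else 0 := by
    intro k
    rw [sum_apply, Finset.sum_apply]
    by_cases hk : i = k
    · subst hk
      simp
    · simp [hk]
  rw [matrixOp, sum_apply, Finset.sum_apply]
  simp only [h]
  simp

theorem matrixOp_mul (M N : Matrix m m (H →L[ℂ] H)) :
    matrixOp (M * N) = matrixOp M * matrixOp N := by
  refine ContinuousLinearMap.ext fun x => funext fun i => ?_
  rw [mul_apply_eq_comp, matrixOp_apply, matrixOp_apply]
  simp only [matrixOp_apply, Matrix.mul_apply, sum_apply, map_sum]
  rw [Finset.sum_comm]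
  rfl

theorem matrixOp_add (M N : Matrix m m (H →L[ℂ] H)) :
    matrixOp (M + N) = matrixOp M + matrixOp N := by
  refine ContinuousLinearMap.ext fun x => funext fun i => ?_
  rw [add_apply, Pi.add_apply, matrixOp_apply, matrixOp_apply, matrixOp_apply,
    ← Finset.sum_add_distrib]
  rfl

theorem matrixOp_one : matrixOp (1 : Matrix m m (H →L[ℂ] H)) = 1 := by
  refine ContinuousLinearMap.ext fun x => funext fun i => ?_
  rw [matrixOp_apply, Finset.sum_eq_single i]
  · rw [Matrix.one_apply_eq]
    rfl
  · intro j _ hj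
    rw [Matrix.one_apply_ne hj.symm]
    rfl
  · exact fun h => absurd (Finset.mem_univ i) h

theorem matrixOp_injective : Function.Injective (matrixOp (H := H) (m := m)) := by
  intro M N h
  ext i j x
  have h1 := congrFun (DFunLike.congr_fun h (Pi.single j x)) i
  rw [matrixOp_apply, matrixOp_apply, Finset.sum_eq_single j, Finset.sum_eq_single j] at h1
  · simpa using h1
  · intro k _ hk; simp [hk]
  · exact fun h => absurd (Finset.mem_univ j) h
  · intro k _ hk; simp [hk]
  · exact fun h => absurd (Finset.mem_univ j) h

theorem isCompactOperator_matrixOp {M : Matrix m m (H →L[ℂ] H)}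
    (hM : ∀ i j, IsCompactOperator (M i j)) : IsCompactOperator (matrixOp M) := by
  have h : ∀ (s : Finset (m × m)), IsCompactOperator (∑ x ∈ s,
      (ContinuousLinearMap.single ℂ (fun _ : m => H) x.1) ∘L (M x.1 x.2) ∘L
        (ContinuousLinearMap.proj x.2 : (m → H) →L[ℂ] H) : (m → H) →L[ℂ] (m → H)) := by
    intro s
    induction s using Finset.induction_on with
    | empty => exact isCompactOperator_zero
    | insert a s ha ih =>
      rw [Finset.sum_insert ha]
      exact (((hM a.1 a.2).comp_clm (ContinuousLinearMap.proj a.2 : (m → H) →L[ℂ] H)).clm_comp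
        (ContinuousLinearMap.single ℂ (fun _ : m => H) a.1)).add ih
  have h1 := h Finset.univ
  rw [← Finset.univ_product_univ, Finset.sum_product] at h1
  exact h1

variable [CompleteSpace H]

variable (H) in
/-- The unitization of the compact operators, acting on the Hilbert space. -/
def unitizationRep : Unitization ℂ (CompactAlgebra H) →⋆ₐ[ℂ] (H →L[ℂ] H) :=
  Unitization.starLift (compactInclusion H)

theorem unitizationRep_apply (x : Unitization ℂ (CompactAlgebra H)) :
    unitizationRep H x = x.fst • (1 : H →L[ℂ] H) + compactInclusion H x.snd := by
  rw [← Algebra.algebraMap_eq_smul_one]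
  rfl

/-- Left inverses of matrices over the unitization of the compact operators are right inverses. -/
theorem mul_eq_one_of_mul_eq_one {X Y : Matrix m m (Unitization ℂ (CompactAlgebra H))}
    (h : X * Y = 1) : (Y * X).map (unitizationRep H) = 1 := by
  set ρ : Unitization ℂ (CompactAlgebra H) →+* (H →L[ℂ] H) :=
    RingHomClass.toRingHom (unitizationRep H)
  have hρ : (Y * X).map (unitizationRep H) = Y.map ρ * X.map ρ := Matrix.map_mul
  set τ : Unitization ℂ (CompactAlgebra H) →+* ℂ :=
    (Unitization.fstHom ℂ (CompactAlgebra H) : Unitization ℂ (CompactAlgebra H) →+* ℂ)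
  set κ : ℂ →+* (H →L[ℂ] H) := algebraMap ℂ (H →L[ℂ] H)
  have h1 : X.map ρ * Y.map ρ = 1 := by
    rw [← Matrix.map_mul, h, Matrix.map_one _ (map_zero ρ) (map_one ρ)]
  have h2 : X.map τ * Y.map τ = 1 := by
    rw [← Matrix.map_mul, h, Matrix.map_one _ (map_zero τ) (map_one τ)]
  -- The scalar parts are square matrices over a field, where one-sided inverses are two-sided.
  have h3 : Y.map τ * X.map τ = 1 := mul_eq_one_comm.1 h2
  set A := (X.map τ).map κ
  set B := (Y.map τ).map κ
  have hAB : A * B = 1 := by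
    rw [← Matrix.map_mul, h2, Matrix.map_one _ (map_zero κ) (map_one κ)]
  have hBA : B * A = 1 := by
    rw [← Matrix.map_mul, h3, Matrix.map_one _ (map_zero κ) (map_one κ)]
  set K : Matrix m m (H →L[ℂ] H) := Y.map fun x => compactInclusion H x.snd
  have hY : Y.map ρ = B + K := by
    ext1 i j
    exact (unitizationRep_apply (Y i j)).trans
      (congrArg (· + _) (Algebra.algebraMap_eq_smul_one _).symm)
  have hC : IsCompactOperator (matrixOp (A * K)) := by
    refine isCompactOperator_matrixOp fun i j => ?_
    have h4 : (A * K) i j = compactInclusion H (∑ l, (X i l).fst • (Y l j).snd) := by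
      rw [Matrix.mul_apply, map_sum]
      refine Finset.sum_congr rfl fun l _ => ?_
      rw [map_smul]
      exact (Algebra.smul_def (X i l).fst (compactInclusion H (Y l j).snd)).symm
    rw [h4]
    exact Subtype.prop (p := (· ∈ CompactOperators H)) _
  -- Multiplying by the scalar part of `X` turns `Y` into a compact perturbation of the identity.
  have h5 : matrixOp A * matrixOp (Y.map ρ) = 1 + matrixOp (A * K) := by
    rw [← matrixOp_mul, hY, mul_add, hAB, matrixOp_add, matrixOp_one]
  have hinj : Function.Injective (matrixOp A * matrixOp (Y.map ρ)) := by
    have h6 : Function.Injective (matrixOp A) := Function.LeftInverse.injective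
      (g := matrixOp B) fun x => by
        rw [← mul_apply_eq_comp, ← matrixOp_mul, hBA, matrixOp_one]; rfl
    have h7 : Function.Injective (matrixOp (Y.map ρ)) := Function.LeftInverse.injective
      (g := matrixOp (X.map ρ)) fun x => by
        rw [← mul_apply_eq_comp, ← matrixOp_mul, h1, matrixOp_one]; rfl
    exact h6.comp h7
  have hunit : IsUnit (matrixOp A * matrixOp (Y.map ρ)) := by
    -- Fredholm alternative: injectivity rules out the eigenvalue -1 of the compact part, so the
    -- operator is invertible.
    rcases hC.hasEigenvalue_or_mem_resolventSet (μ := -1) (by simp) with h6 | h6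
    · obtain ⟨x, hx⟩ := h6.exists_hasEigenvector
      refine absurd (hinj (a₁ := x) (a₂ := 0) ?_) hx.2
      rw [h5, map_zero, add_apply]
      have h7 : matrixOp (A * K) x = (-1 : ℂ) • x := hx.apply_eq_smul
      rw [h7]
      simp
    · have h7 : algebraMap ℂ ((m → H) →L[ℂ] (m → H)) (-1) - matrixOp (A * K) =
          -(matrixOp A * matrixOp (Y.map ρ)) := by
        rw [h5, map_neg, map_one]
        abel
      have h8 : IsUnit (algebraMap ℂ ((m → H) →L[ℂ] (m → H)) (-1) - matrixOp (A * K)) := h6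
      rw [h7] at h8
      exact IsUnit.neg_iff _ |>.1 h8
  have h9 : matrixOp (Y.map ρ) * matrixOp (X.map ρ) = 1 := by
    obtain ⟨U, hU⟩ := hunit
    have h10 : matrixOp (X.map ρ) * matrixOp (Y.map ρ) = 1 := by
      rw [← matrixOp_mul, h1, matrixOp_one]
    have h11 : matrixOp B * matrixOp A = 1 := by rw [← matrixOp_mul, hBA, matrixOp_one]
    have h12 : matrixOp (Y.map ρ) = matrixOp B * U := by
      rw [hU, ← mul_assoc, h11, one_mul]
    have h13 : matrixOp (Y.map ρ) * ((↑U⁻¹ : (m → H) →L[ℂ] (m → H)) * matrixOp A) = 1 := by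
      rw [h12, ← mul_assoc, mul_assoc (matrixOp B), Units.mul_inv, mul_one, h11]
    rw [left_inv_eq_right_inv h10 h13, h13]
  rw [hρ]
  refine matrixOp_injective ?_
  rw [matrixOp_mul, h9, matrixOp_one]

/-- A projection which is absorbed by an identity matrix vanishes. -/
theorem map_eq_zero_of_absorbing {n : Type*} [Fintype n]
    {p : Matrix n n (Unitization ℂ (CompactAlgebra H))} (hp : IsStarProjection p)
    (h : MvNEquiv (Matrix.fromBlocks p 0 0 (1 : Matrix m m (Unitization ℂ (CompactAlgebra H))))
      (1 : Matrix m m (Unitization ℂ (CompactAlgebra H)))) :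
    p.map (unitizationRep H) = 0 := by
  obtain ⟨v, h1, h2⟩ := h
  -- With v = (a b) the equivalence says a* a = p, b* b = 1 and a a* + b b* = 1. Finiteness makes b
  -- b* act as 1, hence a a* as 0, and p = a* (a a*) a. Only images under `unitizationRep` are
  -- controlled, as it is not injective for finite-dimensional `H`.
  obtain ⟨a, b, rfl⟩ : ∃ a b, v = Matrix.fromCols a b :=
    ⟨v.toCols₁, v.toCols₂, (Matrix.fromCols_toCols v).symm⟩
  rw [Matrix.conjTranspose_fromCols_eq_fromRows_conjTranspose, Matrix.fromRows_mul_fromCols,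
    Matrix.fromBlocks_inj] at h1
  rw [Matrix.conjTranspose_fromCols_eq_fromRows_conjTranspose, Matrix.fromCols_mul_fromRows] at h2
  obtain ⟨h3, -, -, h4⟩ := h1
  set ρ : Unitization ℂ (CompactAlgebra H) →+* (H →L[ℂ] H) :=
    RingHomClass.toRingHom (unitizationRep H)
  have h5 := mul_eq_one_of_mul_eq_one h4
  have h6 : (a * aᴴ).map ρ = 0 := by
    have h7 := congrArg (fun M => Matrix.map M ρ) h2
    simp only [Matrix.map_add ρ (map_add ρ), Matrix.map_one _ (map_zero ρ) (map_one ρ)] at h7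
    change _ + (b * bᴴ).map (unitizationRep H) = 1 at h7
    rwa [h5, add_eq_right] at h7
  have h8 : p = aᴴ * (a * aᴴ) * a := by
    rw [← hp.mul_self, ← h3]
    simp only [Matrix.mul_assoc]
  change p.map ρ = 0
  rw [h8, Matrix.map_mul, Matrix.map_mul, h6, Matrix.mul_zero, Matrix.zero_mul]

end Finiteness
end

noncomputable section

/-! ## Classes of projections in a non-unital C*-algebra -/

section ElementClass

open scoped Matrix

/-- The rows are partial isometries with range projections `e j` and mutually orthogonal source
projections, so the class of the sum splits. -/
theorem kClass_eq_sum_of_rows {R : Type*} [Ring R] [StarRing R] {J m k : Type*} [Fintype J]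
    [Fintype m] [Fintype k] {e : J → Matrix k k R} (he : ∀ j, IsStarProjection (e j))
    {w : J → Matrix k m R} (hw : ∀ j, w j * (w j)ᴴ = e j) (hew : ∀ j, e j * w j = w j)
    (horth : ∀ i j, i ≠ j → w i * (w j)ᴴ = 0) :
    kClass (∑ j, (w j)ᴴ * w j) = ∑ j, kClass (e j) := by
  have h1 : ∀ j, IsStarProjection ((w j)ᴴ * w j) := fun j => by
    refine isStarProjection_matrix ?_ ?_
    · rw [Matrix.conjTranspose_mul, Matrix.conjTranspose_conjTranspose]
    · rw [Matrix.mul_assoc, ← Matrix.mul_assoc (w j), hw, hew]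
  rw [(kClass_sum Finset.univ (fun j _ => h1 j) fun i _ j _ hij => by
    rw [Matrix.mul_assoc, ← Matrix.mul_assoc (w i), horth i j hij, Matrix.zero_mul,
      Matrix.mul_zero]).2]
  exact Finset.sum_congr rfl fun j _ => kClass_eq_of_equiv (h1 j) (he j) ⟨w j, rfl, hw j⟩

variable {A B : Type*} [NonUnitalCStarAlgebra A] [NonUnitalCStarAlgebra B]

/-- The class of a projection in a C*-algebra, in `K₀` of the unitization. -/
def elementClass (p : A) : KZeroUnital (Unitization ℂ A) :=
  kClass (Matrix.of fun _ _ : Fin 1 => (p : Unitization ℂ A))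

theorem isStarProjection_of_element {p : A} (hp : IsStarProjection p) :
    IsStarProjection (Matrix.of fun _ _ : Fin 1 => (p : Unitization ℂ A)) := by
  refine isStarProjection_matrix (Matrix.ext fun i j => ?_) (Matrix.ext fun i j => ?_)
  · rw [Matrix.conjTranspose_apply, Matrix.of_apply, ← Unitization.inr_star,
      hp.isSelfAdjoint.star_eq, Matrix.of_apply]
  · rw [Matrix.mul_apply, Fin.sum_univ_one, Matrix.of_apply, Matrix.of_apply,
      ← Unitization.inr_mul, hp.isIdempotentElem.eq, Matrix.of_apply]

theorem KZero.coe_mk {p : A} (hp : IsStarProjection p) :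
    (KZero.mk p hp : KZeroUnital (Unitization ℂ A)) = elementClass p := mk_eq_kClass _

theorem elementClass_zero : elementClass (0 : A) = 0 := by
  rw [elementClass, ← kClass_zero (m := Fin 1)]
  exact congrArg _ (Matrix.ext fun _ _ => Unitization.inr_zero ℂ)

theorem star_starMap (f : A →⋆ₙₐ[ℂ] B) (x : Unitization ℂ A) :
    RingHomClass.toRingHom (Unitization.starMap f) (star x) =
      star (RingHomClass.toRingHom (Unitization.starMap f) x) :=
  map_star (Unitization.starMap f) x

/-- Functoriality of `K₀` of the unitization. -/
def kMap (f : A →⋆ₙₐ[ℂ] B) : KZeroUnital (Unitization ℂ A) →+ KZeroUnital (Unitization ℂ B) :=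
  KZeroUnital.map (RingHomClass.toRingHom (Unitization.starMap f)) (star_starMap f)

theorem kMap_elementClass (f : A →⋆ₙₐ[ℂ] B) {p : A} (hp : IsStarProjection p) :
    kMap f (elementClass p) = elementClass (f p) := by
  rw [kMap, elementClass, map_kClass _ _ (isStarProjection_of_element hp)]
  refine congrArg _ (Matrix.ext fun i j => ?_)
  exact Unitization.starMap_inr f p

theorem kClass_single {R : Type*} [Ring R] [StarRing R] {n : Type*} [Fintype n] [DecidableEq n]
    {e : R} (he : IsStarProjection e) (j : n) : IsStarProjection (Matrix.single j j e) ∧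
      kClass (Matrix.single j j e) = kClass (Matrix.of fun _ _ : Fin 1 => e) := by
  have h1 : star e = e := he.isSelfAdjoint
  have h2 : e * e = e := he.isIdempotentElem
  have h3 : IsStarProjection (Matrix.single j j e) := by
    refine isStarProjection_matrix ?_ ?_
    · rw [Matrix.conjTranspose_single, h1]
    · rw [Matrix.single_mul_single_same, h2]
  have h4 : (Matrix.of fun _ _ : Fin 1 => e) = Matrix.single 0 0 e := by
    refine Matrix.ext fun i j => ?_
    rw [Subsingleton.elim i 0, Subsingleton.elim j 0, Matrix.single_apply_same, Matrix.of_apply]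
  refine ⟨h3, ?_⟩
  rw [h4]
  refine kClass_eq_of_equiv h3 (isStarProjection_matrix ?_ ?_) ⟨Matrix.single 0 j e, ?_, ?_⟩
  · rw [Matrix.conjTranspose_single, h1]
  · rw [Matrix.single_mul_single_same, h2]
  · rw [Matrix.conjTranspose_single, h1, Matrix.single_mul_single_same, h2]
  · rw [Matrix.conjTranspose_single, h1, Matrix.single_mul_single_same, h2]

theorem isStarProjection_inr {p : A} (hp : IsStarProjection p) :
    IsStarProjection (p : Unitization ℂ A) :=
  ⟨by rw [IsIdempotentElem, ← Unitization.inr_mul, hp.isIdempotentElem.eq],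
   by rw [isSelfAdjoint_iff, ← Unitization.inr_star, hp.isSelfAdjoint.star_eq]⟩

end ElementClass

/-! ## Rank one projections are of infinite order -/

section InfiniteOrder

open scoped Matrix

variable {H : Type*} [NormedAddCommGroup H] [InnerProductSpace ℂ H] [CompleteSpace H]

theorem isStarProjection_compactRankOne {x : H} (hx : ‖x‖ = 1) :
    IsStarProjection (compactRankOne x x) :=
  ⟨by rw [IsIdempotentElem, compactRankOne_mul_compactRankOne, inner_self_eq_norm_sq_to_K, hx]
      simp,
   by rw [isSelfAdjoint_iff, star_compactRankOne]⟩

/-- A vanishing multiple is the class of a diagonal matrix with `n` copies of the projection. It is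
absorbed by an identity matrix, so it acts as zero; but for n > 0 its first entry acts as a nonzero
rank-one operator. -/
theorem eq_zero_of_nsmul_elementClass_eq_zero {x : H} (hx : ‖x‖ = 1) {n : ℕ}
    (h : n • elementClass (compactRankOne x x) = 0) : n = 0 := by
  by_contra hn
  set e : Unitization ℂ (CompactAlgebra H) := Unitization.inr (compactRankOne x x) with he
  have hep : IsStarProjection e := isStarProjection_inr (isStarProjection_compactRankOne hx)
  have h1 := kClass_sum (Finset.univ : Finset (Fin n))
    (p := fun j => Matrix.single j j e) (fun j _ => (kClass_single hep j).1)
    fun i _ j _ hij => Matrix.single_mul_single_of_ne _ _ _ _ hij _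
  have h2 : kClass (∑ j : Fin n, Matrix.single j j e) = 0 := by
    rw [h1.2, Finset.sum_congr rfl fun j _ => (kClass_single hep j).2, Finset.sum_const,
      Finset.card_univ, Fintype.card_fin]
    exact h
  obtain ⟨N, hN⟩ := exists_absorbing h1.1 h2
  have h3 := map_eq_zero_of_absorbing h1.1 hN
  let i : Fin n := ⟨0, Nat.pos_of_ne_zero hn⟩
  have h4 : (∑ j : Fin n, Matrix.single j j e) i i = e := by
    rw [Matrix.sum_apply, Finset.sum_eq_single i, Matrix.single_apply_same]
    · intro j _ hj
      exact Matrix.single_apply_of_ne _ _ _ _ _ (fun h => hj h.1)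
    · exact fun h => absurd (Finset.mem_univ i) h
  have h5 : unitizationRep H e = 0 := by
    rw [← h4]
    exact congrFun (congrFun h3 i) i
  rw [unitizationRep_apply, he, Unitization.fst_inr, Unitization.snd_inr, zero_smul, zero_add,
    compactInclusion_rankOne] at h5
  have h6 := DFunLike.congr_fun h5 x
  rw [InnerProductSpace.rankOne_apply, inner_self_eq_norm_sq_to_K, hx] at h6
  have h7 : x = 0 := by simpa using h6
  rw [h7, norm_zero] at hx
  exact zero_ne_one hx

end InfiniteOrder

/-! ## Projections over a direct sum of algebras of compact operators -/

section BlockProjections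

open scoped Matrix

variable {Q : Type*} {H : Q → Type*} [∀ q, NormedAddCommGroup (H q)]
  [∀ q, InnerProductSpace ℂ (H q)] [∀ q, CompleteSpace (H q)]

/-- The operator `y ↦ ⟨v, y⟩ u` in the summand of index `q`. -/
def blockRankOne (q : Q) (u v : H q) : CStarSumAlgebra fun q => CompactAlgebra (H q) :=
  sumSingle _ q (compactRankOne u v)

theorem star_blockRankOne (q : Q) (u v : H q) :
    star (blockRankOne q u v) = blockRankOne q v u := by
  rw [blockRankOne, ← map_star, star_compactRankOne]; rfl

theorem blockRankOne_mul (q : Q) (u v u' v' : H q) :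
    blockRankOne q u v * blockRankOne q u' v' = (inner ℂ v u' : ℂ) • blockRankOne q u v' := by
  rw [blockRankOne, blockRankOne, ← map_mul, compactRankOne_mul_compactRankOne, map_smul]; rfl

theorem blockRankOne_mul_of_ne {q q' : Q} (h : q ≠ q') (u v : H q) (u' v' : H q') :
    blockRankOne q u v * blockRankOne q' u' v' = 0 := by
  refine CStarSumAlgebra.ext fun i => ?_
  rw [← sumComponent_apply, ← sumComponent_apply, map_mul, map_zero, sumComponent_apply,
    sumComponent_apply]
  by_cases hi : i = q
  · subst hi
    rw [blockRankOne, blockRankOne, sumSingle_component_of_ne (A := fun q => CompactAlgebra (H q)) h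
      (compactRankOne u' v'), mul_zero]
  · rw [blockRankOne, sumSingle_component_of_ne hi, zero_mul]

theorem isStarProjection_blockRankOne (q : Q) {x : H q} (hx : ‖x‖ = 1) :
    IsStarProjection (blockRankOne q x x) :=
  ⟨by rw [IsIdempotentElem, blockRankOne_mul, inner_self_eq_norm_sq_to_K, hx]; simp,
   by rw [isSelfAdjoint_iff, star_blockRankOne]⟩

variable {x : ∀ q, H q} [Fintype Q]

/-- Functoriality under projection to the block `q` kills all terms but one, and rank-one classes
have infinite order. -/
theorem eq_zero_of_sum_zsmul_elementClass_eq_zero (hx : ∀ q, ‖x q‖ = 1)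
    {a : Q → ℤ}
    (h : ∑ q, a q • elementClass (blockRankOne q (x q) (x q)) = 0) : a = 0 := by
  funext q
  have h1 := congrArg (kMap (sumComponent (fun q => CompactAlgebra (H q)) q)) h
  rw [map_zero, map_sum, Finset.sum_eq_single q] at h1
  · rw [map_zsmul, kMap_elementClass _ (isStarProjection_blockRankOne q (hx q)),
      sumComponent_apply, blockRankOne, sumSingle_component_same] at h1
    rcases Int.natAbs_eq (a q) with h2 | h2
    · rw [h2, natCast_zsmul] at h1
      rw [h2, eq_zero_of_nsmul_elementClass_eq_zero (hx q) h1]; rfl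
    · rw [h2, neg_smul, natCast_zsmul, neg_eq_zero] at h1
      rw [h2, eq_zero_of_nsmul_elementClass_eq_zero (hx q) h1]; rfl
  · intro q' _ hq'
    rw [map_zsmul, kMap_elementClass _ (isStarProjection_blockRankOne q' (hx q')),
      sumComponent_apply, blockRankOne, sumSingle_component_of_ne hq'.symm, elementClass_zero,
      smul_zero]
  · exact fun h => absurd (Finset.mem_univ q) h

/-- Here `b q j` are orthonormal vectors of the power of `H q` indexed by `m`, and `p` projects onto
their span in every block. The row w_j with entries "y ↦ ⟨b_j(l), y⟩ x_q" is a partial isometry from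
the line of b_j to the line of x_q. -/
theorem kClass_eq_sum_of_orthonormal (hx : ∀ q, ‖x q‖ = 1) {m : Type*} [Fintype m]
    {J : Q → Type*} [∀ q, Fintype (J q)]
    {b : ∀ q, J q → m → H q}
    (hb : ∀ q i j, ∑ l, (inner ℂ (b q i l) (b q j l) : ℂ) =
      open Classical in if i = j then 1 else 0)
    {p : Matrix m m (CStarSumAlgebra fun q => CompactAlgebra (H q))}
    (hp : ∀ q k l, (p k l).component q = ∑ j, compactRankOne (b q j k) (b q j l)) :
    kClass (p.map (Unitization.inr (R := ℂ))) =
      ∑ q, Fintype.card (J q) • elementClass (blockRankOne q (x q) (x q)) := by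
  classical
  set w : (Σ q, J q) → Matrix (Fin 1) m (Unitization ℂ (CStarSumAlgebra fun q =>
      CompactAlgebra (H q))) := fun j => Matrix.of fun _ l =>
    (blockRankOne j.1 (x j.1) (b j.1 j.2 l) : Unitization ℂ _)
  have hwa : ∀ j k l, w j k l = (blockRankOne j.1 (x j.1) (b j.1 j.2 l) : Unitization ℂ _) :=
    fun _ _ _ => rfl
  have h1 : ∀ i j k l, (w i * (w j)ᴴ) k l = ((∑ l, blockRankOne i.1 (x i.1) (b i.1 i.2 l) *
      blockRankOne j.1 (b j.1 j.2 l) (x j.1) : CStarSumAlgebra fun q => CompactAlgebra (H q)) :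
      Unitization ℂ _) := by
    intro i j k l
    rw [Matrix.mul_apply]
    refine Eq.trans (Finset.sum_congr rfl fun l' _ => ?_)
      (map_sum (Unitization.inrNonUnitalStarAlgHom ℂ _) _ _).symm
    rw [Matrix.conjTranspose_apply, hwa, hwa, ← Unitization.inr_star,
      star_blockRankOne, ← Unitization.inr_mul]
    rfl
  have h2 : ∑ j, (w j)ᴴ * w j = p.map (Unitization.inr (R := ℂ)) := by
    refine Matrix.ext fun k l => ?_
    rw [Matrix.sum_apply, Matrix.map_apply]
    have h3 : p k l = ∑ j : Σ q, J q, blockRankOne j.1 (b j.1 j.2 k) (b j.1 j.2 l) := by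
      refine CStarSumAlgebra.ext fun q => ?_
      rw [hp, ← sumComponent_apply, map_sum, Fintype.sum_sigma, Finset.sum_eq_single q]
      · refine Finset.sum_congr rfl fun j _ => ?_
        rw [sumComponent_apply, blockRankOne, sumSingle_component_same]
      · intro q' _ hq'
        refine Finset.sum_eq_zero fun j _ => ?_
        rw [sumComponent_apply, blockRankOne, sumSingle_component_of_ne hq'.symm]
      · exact fun h => absurd (Finset.mem_univ q) h
    rw [h3]
    refine Eq.trans (Finset.sum_congr rfl fun j _ => ?_)
      (map_sum (Unitization.inrNonUnitalStarAlgHom ℂ _) _ _).symm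
    rw [Matrix.mul_apply, Fin.sum_univ_one, Matrix.conjTranspose_apply, hwa, hwa,
      ← Unitization.inr_star, star_blockRankOne, ← Unitization.inr_mul,
      blockRankOne_mul, inner_self_eq_norm_sq_to_K, hx]
    simp
  rw [← h2, kClass_eq_sum_of_rows (e := fun j : Σ q, J q => Matrix.of fun _ _ : Fin 1 =>
    (blockRankOne j.1 (x j.1) (x j.1) : Unitization ℂ _))
    (fun j => isStarProjection_of_element (isStarProjection_blockRankOne _ (hx _))),
    Fintype.sum_sigma]
  · refine Finset.sum_congr rfl fun q _ => ?_
    change ∑ _ : J q, elementClass (blockRankOne q (x q) (x q)) = _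
    rw [Finset.sum_const, Finset.card_univ]
  · intro j
    refine Matrix.ext fun k l => ?_
    rw [h1, Matrix.of_apply]
    refine congrArg _ ?_
    rw [Finset.sum_congr rfl fun l _ => blockRankOne_mul _ _ _ _ _, ← Finset.sum_smul, hb,
      if_pos rfl, one_smul]
  · intro j
    refine Matrix.ext fun k l => ?_
    rw [Matrix.mul_apply, Fin.sum_univ_one, hwa, hwa, Matrix.of_apply,
      ← Unitization.inr_mul, blockRankOne_mul, inner_self_eq_norm_sq_to_K, hx]
    simp
  · rintro ⟨q, i⟩ ⟨q', j⟩ hij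
    refine Matrix.ext fun k l => ?_
    rw [h1, Matrix.zero_apply, ← Unitization.inr_zero ℂ]
    refine congrArg _ ?_
    by_cases hq : q = q'
    · subst hq
      have hij' : i ≠ j := fun h => hij (by rw [h])
      rw [Finset.sum_congr rfl fun l _ => blockRankOne_mul _ _ _ _ _, ← Finset.sum_smul, hb,
        if_neg hij', zero_smul]
    · exact Finset.sum_eq_zero fun l _ => blockRankOne_mul_of_ne hq _ _ _ _

end BlockProjections
end

noncomputable section

/-! ## Compact projections are of finite rank -/

section FiniteRank

open scoped Matrix
open InnerProductSpace

variable {H : Type*} [NormedAddCommGroup H] [InnerProductSpace ℂ H]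

/-- The range of an idempotent is closed and the operator is the identity on it; a compact identity
forces finite dimension. -/
theorem finiteDimensional_range_of_isCompactOperator {T : H →L[ℂ] H} (hT : IsCompactOperator T)
    (h : T * T = T) : FiniteDimensional ℂ T.range := by
  have h1 : ∀ x ∈ T.range, T x = x := by
    rintro _ ⟨y, rfl⟩
    exact DFunLike.congr_fun h y
  have h2 : IsClosed (T.range : Set H) := by
    have h3 : (T.range : Set H) = {x | T x = x} :=
      Set.ext fun x => ⟨h1 x, fun hx => ⟨x, hx⟩⟩
    rw [h3]
    exact isClosed_eq T.continuous continuous_id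
  have h4 := (hT.comp_clm T.range.subtypeL).codRestrict (V := T.range)
    (fun x => ⟨x.1, rfl⟩) h2
  refine FiniteDimensional.of_isCompactOperator_id (𝕜 := ℂ) ?_
  have h5 : (id : T.range → T.range) = Set.codRestrict (T ∘L T.range.subtypeL) T.range
      (fun x => ⟨x.1, rfl⟩) := by
    refine funext fun x => Subtype.ext ?_
    exact (h1 x.1 x.2).symm
  rw [h5]
  exact h4

variable [CompleteSpace H]

/-- A compact projection is the sum of the projections onto the lines of an orthonormal basis of its
range. -/
theorem exists_orthonormalBasis_of_isStarProjection {T : H →L[ℂ] H} (hT : IsCompactOperator T)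
    (h : IsStarProjection T) : ∃ b : Fin (Module.finrank ℂ T.range) → H, Orthonormal ℂ b ∧
      T = ∑ j, rankOne ℂ (b j) (b j) := by
  have _ := finiteDimensional_range_of_isCompactOperator hT h.isIdempotentElem
  obtain ⟨_, h1⟩ := isStarProjection_iff_eq_starProjection_range.1 h
  set c := stdOrthonormalBasis ℂ T.range
  refine ⟨fun j => c j, c.orthonormal.comp_linearIsometry T.range.subtypeₗᵢ, ?_⟩
  rw [← c.starProjection_eq_sum_rankOne]
  exact h1

variable {m : Type*} [Fintype m]

/-- A projection matrix of compact operators is a compact projection on the Hilbert sum of copies of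
`H`, so it has finite rank. Its entries are read off from an orthonormal basis of its range. -/
theorem exists_orthonormal_of_isStarProjection {p : Matrix m m (CompactAlgebra H)}
    (hp : IsStarProjection p) : ∃ (d : ℕ) (b : Fin d → m → H),
      (∀ i j, ∑ l, (inner ℂ (b i l) (b j l) : ℂ) = if i = j then 1 else 0) ∧
      ∀ k l, p k l = ∑ j, compactRankOne (b j k) (b j l) := by
  classical
  set M : Matrix m m (H →L[ℂ] H) := p.map (compactInclusion H) with hM
  set e := PiLp.continuousLinearEquiv 2 ℂ (fun _ : m => H)
  set T : PiLp 2 (fun _ : m => H) →L[ℂ] PiLp 2 (fun _ : m => H) :=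
    (e.symm : (m → H) →L[ℂ] PiLp 2 (fun _ : m => H)) ∘L matrixOp M ∘L
      (e : PiLp 2 (fun _ : m => H) →L[ℂ] (m → H)) with hTdef
  have hTa : ∀ x k, T x k = ∑ l, M k l (x l) := fun x k => matrixOp_apply M (e x) k
  have hT : IsCompactOperator T := ((isCompactOperator_matrixOp (M := M) fun i j =>
    Subtype.prop (p := (· ∈ CompactOperators H)) (p i j)).comp_clm
      (e : PiLp 2 (fun _ : m => H) →L[ℂ] (m → H))).clm_comp
        (e.symm : (m → H) →L[ℂ] PiLp 2 (fun _ : m => H))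
  have hMM : M * M = M := by
    rw [hM, ← Matrix.map_mul, show p * p = p from hp.isIdempotentElem]
  have hMs : ∀ k l, star (M k l) = M l k := by
    intro k l
    have h1 : pᴴ = p := hp.isSelfAdjoint
    rw [hM, Matrix.map_apply, Matrix.map_apply, ← map_star, ← Matrix.conjTranspose_apply, h1]
  have h1 : IsStarProjection T := by
    constructor
    · refine ContinuousLinearMap.ext fun x => ?_
      change e.symm (matrixOp M (e (e.symm (matrixOp M (e x))))) = e.symm (matrixOp M (e x))
      rw [e.apply_symm_apply, ← mul_apply_eq_comp, ← matrixOp_mul, hMM]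
    · rw [ContinuousLinearMap.isSelfAdjoint_iff_isSymmetric]
      intro x y
      change inner ℂ (T x) y = inner ℂ x (T y)
      rw [PiLp.inner_apply, PiLp.inner_apply]
      simp only [hTa, sum_inner, inner_sum]
      rw [Finset.sum_comm]
      refine Finset.sum_congr rfl fun l _ => Finset.sum_congr rfl fun k _ => ?_
      rw [← hMs l k, ContinuousLinearMap.star_eq_adjoint, ContinuousLinearMap.adjoint_inner_left]
  obtain ⟨d, b, hb, hTb⟩ : ∃ (d : ℕ) (b : Fin d → PiLp 2 fun _ : m => H), Orthonormal ℂ b ∧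
      T = ∑ j, rankOne ℂ (b j) (b j) :=
    ⟨_, exists_orthonormalBasis_of_isStarProjection hT h1⟩
  refine ⟨d, fun j k => b j k, fun i j => ?_, fun k l => ?_⟩
  · rw [← PiLp.inner_apply]
    exact orthonormal_iff_ite.1 hb i j
  · refine compactInclusion_injective H (ContinuousLinearMap.ext fun x => ?_)
    have h2 : T (PiLp.single 2 l x) k = M k l x := by
      rw [hTa, Finset.sum_eq_single l]
      · simp
      · intro j _ hj
        simp [hj]
      · exact fun h => absurd (Finset.mem_univ l) h
    change M k l x = _
    rw [← h2, hTb, map_sum, sum_apply, sum_apply, WithLp.ofLp_sum, Finset.sum_apply]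
    refine Finset.sum_congr rfl fun j _ => ?_
    rw [rankOne_apply, compactInclusion_rankOne, rankOne_apply, PiLp.smul_apply, PiLp.inner_apply,
      Finset.sum_eq_single l]
    · simp
    · intro i _ hi
      simp [hi]
    · exact fun h => absurd (Finset.mem_univ l) h

end FiniteRank

/-! ## Classes of projections over a direct sum of algebras of compact operators -/

section RankClasses

open scoped Matrix

variable {Q : Type*} {H : Q → Type*} [∀ q, NormedAddCommGroup (H q)]
  [∀ q, InnerProductSpace ℂ (H q)] [∀ q, CompleteSpace (H q)] [Fintype Q] {x : ∀ q, H q}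

theorem exists_kClass_eq_sum (hx : ∀ q, ‖x q‖ = 1) {m : Type*} [Fintype m]
    {p : Matrix m m (CStarSumAlgebra fun q => CompactAlgebra (H q))} (hp : IsStarProjection p) :
    ∃ a : Q → ℤ, kClass (p.map (Unitization.inr (R := ℂ))) =
      ∑ q, a q • elementClass (blockRankOne q (x q) (x q)) := by
  have h1 : ∀ q, IsStarProjection (p.map (sumComponent (fun q => CompactAlgebra (H q)) q)) := by
    intro q
    constructor
    · rw [IsIdempotentElem, ← Matrix.map_mul, show p * p = p from hp.isIdempotentElem]
    · rw [isSelfAdjoint_iff, Matrix.star_eq_conjTranspose,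
        ← Matrix.conjTranspose_map _ (map_star _), show pᴴ = p from hp.isSelfAdjoint]
  choose d b hb hd using fun q => exists_orthonormal_of_isStarProjection (h1 q)
  refine ⟨fun q => d q, ?_⟩
  rw [kClass_eq_sum_of_orthonormal hx (fun q i j => by rw [hb q i j]; congr) fun q k l => hd q k l]
  simp

/-- An orthonormal basis of the range of each component splits `p` into rank-one projections; the
multiplicities are the ranks. -/
theorem elementClass_eq_sum (hx : ∀ q, ‖x q‖ = 1)
    {p : CStarSumAlgebra fun q => CompactAlgebra (H q)} (hp : IsStarProjection p) :
    elementClass p = ∑ q, (Module.finrank ℂ (p.component q).toOperator.range : ℤ) •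
      elementClass (blockRankOne q (x q) (x q)) := by
  have h1 : ∀ q, IsStarProjection (p.component q).toOperator := fun q =>
    (hp.map (sumComponent (fun q => CompactAlgebra (H q)) q)).map (compactInclusion (H q))
  choose b hb hd using fun q => exists_orthonormalBasis_of_isStarProjection
    (Subtype.prop (p := (· ∈ CompactOperators (H q))) (p.component q)) (h1 q)
  have h2 := kClass_eq_sum_of_orthonormal (m := Fin 1) hx (b := fun q j _ => b q j)
    (fun q i j => by
      rw [Fin.sum_univ_one, orthonormal_iff_ite.1 (hb q) i j]
      congr)
    (p := Matrix.of fun _ _ => p) fun q _ _ => compactInclusion_injective _ (by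
      rw [map_sum]
      exact hd q)
  simp only [Fintype.card_fin] at h2
  simp only [natCast_zsmul]
  exact h2

end RankClasses
end

noncomputable section

/-! ## Projections over the unitization and their scalar parts -/

section ScalarPart

open scoped Matrix

/-- A version of `exists_partialIsometry` for matrices, with an entrywise smallness condition. -/
theorem exists_partialIsometry_matrix {R : Type*} [CStarAlgebra R] (m : Type*) [Fintype m] :
    ∃ δ > 0, ∀ P r a : Matrix m m R, IsStarProjection P → IsStarProjection r →
      r * P * r - r = r * a * r → (∀ i j, ‖a i j‖ < δ) →
        ∃ v : Matrix m m R, vᴴ * v = r ∧ P * v = v ∧ v * r = v := by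
  classical
  let _ := CStarAlgebra.spectralOrder R
  have _ := CStarAlgebra.spectralOrderedRing R
  have h0 : Continuous fun a : Matrix m m R => ‖CStarMatrix.ofMatrixL (m := m) (n := m) a‖ :=
    CStarMatrix.ofMatrixL.continuous.norm
  -- The C*-norm of a matrix is continuous in the entries; this is the origin of `δ`.
  have h1 : ∀ᶠ a : m → m → R in 𝓝 0, ‖CStarMatrix.ofMatrixL (m := m) (n := m) a‖ < 1 := by
    refine h0.continuousAt.eventually_lt continuousAt_const ?_
    have h2 : CStarMatrix.ofMatrixL (m := m) (n := m) (0 : Matrix m m R) = 0 := map_zero _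
    change ‖CStarMatrix.ofMatrixL (m := m) (n := m) (0 : Matrix m m R)‖ < (1 : ℝ)
    rw [h2, norm_zero]
    exact one_pos
  obtain ⟨δ, hδ, h2⟩ := Metric.eventually_nhds_iff.1 h1
  refine ⟨δ, hδ, fun P r a hP hr h ha => ?_⟩
  have h3 : ‖CStarMatrix.ofMatrix a‖ < 1 :=
    h2 (y := a) ((dist_zero_right (E := m → m → R) a).trans_lt
      ((pi_norm_lt_iff hδ).2 fun i => (pi_norm_lt_iff hδ).2 (ha i)))
  have hP' : IsStarProjection (CStarMatrix.ofMatrix P) := ⟨hP.1, hP.2⟩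
  have hr' : IsStarProjection (CStarMatrix.ofMatrix r) := ⟨hr.1, hr.2⟩
  have h4 : ‖CStarMatrix.ofMatrix r * CStarMatrix.ofMatrix P * CStarMatrix.ofMatrix r -
      CStarMatrix.ofMatrix r‖ < 1 := by
    have h5 : CStarMatrix.ofMatrix r * CStarMatrix.ofMatrix P * CStarMatrix.ofMatrix r -
      CStarMatrix.ofMatrix r = CStarMatrix.ofMatrix r * CStarMatrix.ofMatrix a *
        CStarMatrix.ofMatrix r := h
    rw [h5]
    refine (norm_mul_le _ _).trans_lt ((mul_le_of_le_one_right (norm_nonneg _)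
      hr'.norm_le).trans_lt ((norm_mul_le _ _).trans_lt
        ((mul_le_of_le_one_left (norm_nonneg _) hr'.norm_le).trans_lt h3)))
  obtain ⟨v, hv, hPv⟩ := exists_partialIsometry hP' hr' h4
  refine ⟨CStarMatrix.ofMatrix.symm v, hv, hPv, ?_⟩
  -- As v* v = r is a projection, v(1 - r) has vanishing square norm.
  have h6 : star (v - v * CStarMatrix.ofMatrix r) * (v - v * CStarMatrix.ofMatrix r) = 0 := by
    have h7 := hr'.isIdempotentElem.eq
    rw [star_sub, star_mul, hr'.isSelfAdjoint.star_eq, sub_mul, mul_sub, mul_sub, hv,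
      ← mul_assoc, hv, h7, mul_assoc, hv, h7, mul_assoc, ← mul_assoc (star v), hv, h7, h7]
    simp
  exact (sub_eq_zero.1 (CStarRing.star_mul_self_eq_zero_iff _ |>.1 h6)).symm

variable (A : Type*) [NonUnitalCStarAlgebra A]

/-- The scalar part, as an endomorphism of the unitization. -/
def scalarPart : Unitization ℂ A →+* Unitization ℂ A :=
  (algebraMap ℂ (Unitization ℂ A)).comp
    (Unitization.fstHom ℂ A : Unitization ℂ A →+* ℂ)

variable {A}

theorem scalarPart_apply (x : Unitization ℂ A) :
    scalarPart A x = algebraMap ℂ (Unitization ℂ A) x.fst := rfl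

theorem sub_scalarPart (x : Unitization ℂ A) : x - scalarPart A x = Unitization.inr x.snd := by
  rw [scalarPart_apply, sub_eq_iff_eq_add, add_comm]
  exact (Unitization.inl_fst_add_inr_snd_eq x).symm

theorem star_scalarPart (x : Unitization ℂ A) :
    scalarPart A (star x) = star (scalarPart A x) := by
  rw [scalarPart_apply, scalarPart_apply, Unitization.fst_star, algebraMap_star_comm]

/-- Taking scalar parts factors through the augmentation, which vanishes on `KZero`. -/
theorem map_scalarPart_eq_zero {y : KZeroUnital (Unitization ℂ A)} (hy : y ∈ KZero A) :
    KZeroUnital.map (scalarPart A) star_scalarPart y = 0 := by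
  have h : ∀ y, KZeroUnital.map (scalarPart A) star_scalarPart y =
      KZeroUnital.map (algebraMap ℂ (Unitization ℂ A)) algebraMap_star_comm
        (kAugmentation A y) := by
    intro y
    induction y using KZeroUnital.induction with
    | h1 p =>
      have h1 := map_mk (algebraMap ℂ (Unitization ℂ A)) algebraMap_star_comm
        (p.map (Unitization.fstHom ℂ A : Unitization ℂ A →+* ℂ) fun x => Unitization.fst_star x)
      have h2 : kAugmentation A (KZeroUnital.mk p) = KZeroUnital.mk
        (p.map (Unitization.fstHom ℂ A : Unitization ℂ A →+* ℂ) fun x => Unitization.fst_star x) :=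
          map_mk _ _ p
      rw [map_mk, h2, h1]
      rfl
    | hadd x y hx hy => rw [map_add, map_add, map_add, hx, hy]
    | hneg x hx => rw [map_neg, map_neg, map_neg, hx]
    | h0 => rw [map_zero, map_zero, map_zero]
  rw [h, show kAugmentation A y = 0 from hy, map_zero]

open scoped ComplexOrder in
theorem eq_zero_of_trace_eq_zero {m : Type*} [Fintype m] {E : Matrix m m ℂ}
    (hE : IsStarProjection E) (h : E.trace = 0) : E = 0 := by
  rwa [← Matrix.trace_conjTranspose_mul_self_eq_zero_iff, hE.conjTranspose_eq, hE.mul_self]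

/-- If a projection over the unitization is nearly scalar outside a projection `f` of the algebra,
then it differs from its scalar part by classes of projections over the algebra. -/
theorem exists_sub_scalarPart_eq (m : Type*) [Fintype m] [DecidableEq m] : ∃ δ > 0,
    ∀ P : Matrix m m (Unitization ℂ A), IsStarProjection P → ∀ f : A, IsStarProjection f →
      (∀ i j, ‖(P i j).snd - f * (P i j).snd‖ < δ) →
        ∃ p q : Matrix m m A, IsStarProjection p ∧ IsStarProjection q ∧
          kClass P - kClass (P.map (scalarPart A)) =
            kClass (p.map (Unitization.inr (R := ℂ))) -
              kClass (q.map (Unitization.inr (R := ℂ))) := by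
  obtain ⟨δ, hδ, key⟩ := exists_partialIsometry_matrix (R := Unitization ℂ A) m
  refine ⟨δ, hδ, fun P hP f hf hPf => ?_⟩
  -- A projection without scalar part is a projection over `A`.
  have descend : ∀ g : Matrix m m (Unitization ℂ A), IsStarProjection g → (∀ i j, (g i j).fst = 0) →
      ∃ p : Matrix m m A, IsStarProjection p ∧ g = p.map (Unitization.inr (R := ℂ)) := by
    intro g hg h0
    have h1 : g = (g.map fun x => x.snd).map (Unitization.inrNonUnitalStarAlgHom ℂ A) :=
      Matrix.ext fun i j => by
        have h2 := Unitization.inl_fst_add_inr_snd_eq (g i j)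
        rw [h0, Unitization.inl_zero, zero_add] at h2
        exact h2.symm
    have hinj : Function.Injective
        fun p : Matrix m m A => p.map (Unitization.inrNonUnitalStarAlgHom ℂ A) :=
      Matrix.map_injective Unitization.inr_injective
    refine ⟨g.map fun x => x.snd, ⟨hinj ?_, hinj ?_⟩, h1⟩
    · beta_reduce
      rw [Matrix.map_mul, ← h1]
      exact hg.isIdempotentElem
    · beta_reduce
      rw [Matrix.star_eq_conjTranspose, Matrix.conjTranspose_map _ (map_star _), ← h1]
      exact hg.isSelfAdjoint
  set s := P.map (scalarPart A) with hs
  have hsP : IsStarProjection s := hP.map_matrix _ star_scalarPart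
  set F : Matrix m m (Unitization ℂ A) := Matrix.diagonal fun _ => (f : Unitization ℂ A) with hF
  have hFP : IsStarProjection F := by
    refine isStarProjection_matrix ?_ ?_
    · rw [hF, Matrix.diagonal_conjTranspose]
      exact congrArg _ (funext fun _ => (isStarProjection_inr hf).isSelfAdjoint)
    · rw [hF, Matrix.diagonal_mul_diagonal]
      exact congrArg _ (funext fun _ => (isStarProjection_inr hf).isIdempotentElem)
  have hcomm : Commute F s := by
    refine Matrix.ext fun i j => ?_
    rw [hF, Matrix.diagonal_mul, Matrix.mul_diagonal]
    exact (Algebra.commutes (P i j).fst (f : Unitization ℂ A)).symm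
  have hFs : IsStarProjection (F * s) := hFP.mul hsP hcomm
  -- The scalar projection `s` commutes with `F` and splits as F s + r. The first summand lies over
  -- `A`; the second is nearly dominated by `P`, because (1 - F)(P - s) is small and r P r - r = r
  -- (1 - F)(P - s) r.
  set r := (1 - F) * s with hr
  have hcomm' : Commute (1 - F) s := (Commute.one_left s).sub_left hcomm
  have hrP : IsStarProjection r := hFP.one_sub.mul hsP hcomm'
  have hrF : r * (1 - F) = r := by
    rw [hr, hcomm'.eq, mul_assoc, hFP.one_sub.isIdempotentElem.eq]
  have hrs : r * s = r := by rw [hr, mul_assoc, hsP.isIdempotentElem.eq]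
  obtain ⟨v, hv, hPv, hvr⟩ := key P r ((1 - F) * (P - s)) hP hrP
    (by rw [← mul_assoc r, hrF, mul_sub, sub_mul, hrs, hrP.isIdempotentElem.eq]) fun i j => by
      have h1 : ((1 - F) * (P - s)) i j =
          ((P i j).snd - f * (P i j).snd : A) := by
        rw [hF, ← Matrix.diagonal_one, Matrix.diagonal_sub, Matrix.diagonal_mul, Matrix.sub_apply,
          hs, Matrix.map_apply, sub_scalarPart, sub_mul, one_mul, ← Unitization.inr_mul,
          Unitization.inr_sub]
      rw [h1, Unitization.norm_inr]
      exact hPf i j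
  have hw : IsStarProjection (v * vᴴ) := by
    refine isStarProjection_matrix ?_ ?_
    · rw [Matrix.conjTranspose_mul, Matrix.conjTranspose_conjTranspose]
    · rw [Matrix.mul_assoc, ← Matrix.mul_assoc vᴴ, hv, ← Matrix.mul_assoc, hvr]
  have hPw : P * (v * vᴴ) = v * vᴴ := by rw [← Matrix.mul_assoc, hPv]
  have hg : IsStarProjection (P - v * vᴴ) := hw.sub_of_mul_eq_right hP hPw
  -- Both `P` and `s` contain a copy of `r`, which cancels in the difference of classes and leaves
  -- [P - v v*] - [F s].
  have h1 : kClass P = kClass (P - v * vᴴ) + kClass r := by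
    rw [kClass_eq_of_equiv hrP hw ⟨v, hv, rfl⟩, ← kClass_add hg hw, sub_add_cancel]
    rw [sub_mul, hPw, hw.isIdempotentElem.eq, sub_self]
  have h2 : kClass s = kClass (F * s) + kClass r := by
    rw [← kClass_add hFs hrP, hr, sub_mul, one_mul, add_sub_cancel]
    rw [hr, hcomm'.eq, hcomm.eq, mul_assoc, ← mul_assoc F, hcomm.eq, mul_assoc s F,
      hFP.mul_one_sub_self, mul_zero, mul_zero]
  set τ : Unitization ℂ A →+* ℂ := (Unitization.fstHom ℂ A : Unitization ℂ A →+* ℂ) with hτ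
  have hτs : ∀ x, τ (star x) = star (τ x) := fun x => Unitization.fst_star x
  have hτF : (F * s).map τ = 0 := by
    rw [Matrix.map_mul]
    have h3 : F.map τ = 0 := Matrix.ext fun i j => by
      rw [Matrix.map_apply, hF, Matrix.diagonal_apply]
      split_ifs
      · exact Unitization.fst_inr ℂ f
      · exact map_zero τ
    rw [h3, Matrix.zero_mul]
  -- The scalar part of the remainder is a complex projection. Its trace is zero since v v* and v* v
  -- = r have scalar parts of equal trace, and `r` has the scalar part of `P`.
  have hτg : (P - v * vᴴ).map τ = 0 := by
    have h3 := hg.map_matrix τ hτs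
    refine eq_zero_of_trace_eq_zero h3 ?_
    have h4 : r.map τ = P.map τ := by
      rw [hr, sub_mul, one_mul, Matrix.map_sub τ (map_sub τ), hτF, sub_zero, hs, Matrix.map_map]
      exact Matrix.ext fun i j => Unitization.fst_inl A _
    rw [Matrix.map_sub τ (map_sub τ), Matrix.trace_sub, Matrix.map_mul, Matrix.trace_mul_comm,
      ← Matrix.map_mul, hv, h4, sub_self]
  obtain ⟨p, hp, hgp⟩ := descend _ hg fun i j => congrFun (congrFun hτg i) j
  obtain ⟨q, hq, hFq⟩ := descend _ hFs fun i j => congrFun (congrFun hτF i) j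
  refine ⟨p, q, hp, hq, ?_⟩
  rw [← hgp, ← hFq, h1, h2, add_sub_add_right_eq_sub]

end ScalarPart
end

noncomputable section

/-! ## Functoriality of `K₀` under isomorphisms -/

section KZeroCongr

variable {A B : Type*} [NonUnitalCStarAlgebra A] [NonUnitalCStarAlgebra B]

theorem fst_starMap (f : A →⋆ₙₐ[ℂ] B) (x : Unitization ℂ A) :
    (Unitization.starMap f x).fst = x.fst := by
  change (algebraMap ℂ (Unitization ℂ B) x.fst + Unitization.inr (f x.snd)).fst = _
  rw [Unitization.fst_add, Unitization.fst_inr, add_zero]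
  rfl

theorem snd_starMap (f : A →⋆ₙₐ[ℂ] B) (x : Unitization ℂ A) :
    (Unitization.starMap f x).snd = f x.snd := by
  change (algebraMap ℂ (Unitization ℂ B) x.fst + Unitization.inr (f x.snd)).snd = _
  rw [Unitization.snd_add, Unitization.snd_inr]
  exact zero_add _

theorem kMap_mem_kZero (f : A →⋆ₙₐ[ℂ] B) {y : KZeroUnital (Unitization ℂ A)} (hy : y ∈ KZero A) :
    kMap f y ∈ KZero B := by
  have h : ∀ y, kAugmentation B (kMap f y) = kAugmentation A y := by
    intro y
    induction y using KZeroUnital.induction with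
    | h1 p =>
      have h1 : kAugmentation A (KZeroUnital.mk p) = _ := map_mk _ _ p
      have h2 : kMap f (KZeroUnital.mk p) = _ := map_mk _ (star_starMap f) p
      have h3 : kAugmentation B (KZeroUnital.mk (p.map _ (star_starMap f))) = _ := map_mk _ _ _
      rw [h1, h2, h3]
      refine congrArg KZeroUnital.mk ?_
      unfold MatrixProjection.map
      congr 1
      refine Matrix.ext fun i j => ?_
      exact fst_starMap f (p.mat i j)
    | hadd x y hx hy => rw [map_add, map_add, map_add, hx, hy]
    | hneg x hx => rw [map_neg, map_neg, map_neg, hx]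
    | h0 => rw [map_zero, map_zero, map_zero]
  exact (h y).trans hy

theorem kMap_kMap_of_leftInverse {f : A →⋆ₙₐ[ℂ] B} {g : B →⋆ₙₐ[ℂ] A} (h : ∀ a, g (f a) = a)
    (y : KZeroUnital (Unitization ℂ A)) : kMap g (kMap f y) = y := by
  induction y using KZeroUnital.induction with
  | h1 p =>
    have h2 : kMap f (KZeroUnital.mk p) = _ := map_mk _ (star_starMap f) p
    have h3 : kMap g (KZeroUnital.mk (p.map _ (star_starMap f))) = _ := map_mk _ (star_starMap g) _
    rw [h2, h3]
    refine congrArg KZeroUnital.mk ?_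
    obtain ⟨n, M, hM⟩ := p
    unfold MatrixProjection.map
    congr 1
    refine Matrix.ext fun i j => Unitization.ext ((fst_starMap g _).trans (fst_starMap f _)) ?_
    refine (snd_starMap g _).trans ((congrArg g (snd_starMap f _)).trans (h _))
  | hadd x y hx hy => rw [map_add, map_add, hx, hy]
  | hneg x hx => rw [map_neg, map_neg, hx]
  | h0 => rw [map_zero, map_zero]

/-- Isomorphic C*-algebras have isomorphic `K₀`. -/
def kZeroCongr (φ : A ≃⋆ₐ[ℂ] B) : KZero A ≃+ KZero B where
  toFun y := ⟨kMap (φ : A →⋆ₙₐ[ℂ] B) y, kMap_mem_kZero _ y.2⟩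
  invFun y := ⟨kMap (φ.symm : B →⋆ₙₐ[ℂ] A) y, kMap_mem_kZero _ y.2⟩
  left_inv y := Subtype.ext (kMap_kMap_of_leftInverse φ.symm_apply_apply y.1)
  right_inv y := Subtype.ext (kMap_kMap_of_leftInverse φ.apply_symm_apply y.1)
  map_add' x y := Subtype.ext (map_add (kMap _) x.1 y.1)

theorem kZeroCongr_mk (φ : A ≃⋆ₐ[ℂ] B) {p : A} (hp : IsStarProjection p) :
    kZeroCongr φ (KZero.mk p hp) = KZero.mk (φ p) (hp.map φ) := by
  refine Subtype.ext ?_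
  rw [KZero.coe_mk]
  change kMap (φ : A →⋆ₙₐ[ℂ] B) (KZero.mk p hp : KZeroUnital (Unitization ℂ A)) = _
  rw [KZero.coe_mk, kMap_elementClass _ hp]
  rfl

theorem KZero.mk_congr {p q : A} (h : p = q) (hp : IsStarProjection p) (hq : IsStarProjection q) :
    KZero.mk p hp = KZero.mk q hq := by
  subst h
  rfl

/-- Isomorphisms which agree on projections generating `K₀` induce the same map on `K₀`. -/
theorem kZeroCongr_eq_of_generates {φ ψ : A ≃⋆ₐ[ℂ] B} {J : Type*} {e : J → B}
    (he : ∀ y : KZero B, y ∈ AddSubgroup.closure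
      {y | ∃ (j : J) (hp : IsStarProjection (e j)), y = KZero.mk (e j) hp})
    (h : ∀ j, φ (ψ.symm (e j)) = e j) (y : KZero A) : kZeroCongr φ y = kZeroCongr ψ y := by
  have h1 : ∀ y, kZeroCongr φ ((kZeroCongr ψ).symm y) = y := by
    intro y
    induction he y using AddSubgroup.closure_induction with
    | mem y hy =>
      obtain ⟨j, hp, rfl⟩ := hy
      have h2 : (kZeroCongr ψ).symm (KZero.mk _ hp) = KZero.mk _ (hp.map ψ.symm) :=
        kZeroCongr_mk ψ.symm hp
      rw [h2, kZeroCongr_mk]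
      exact KZero.mk_congr (h j) _ _
    | zero => rw [map_zero, map_zero]
    | add a b _ _ ha hb => rw [map_add, map_add, ha, hb]
    | neg a _ ha => rw [map_neg, map_neg, ha]
  rw [← h1 (kZeroCongr ψ y), AddEquiv.symm_apply_apply]

end KZeroCongr

/-! ## `K₀` of a finite direct sum of algebras of compact operators -/

section BlockKTheory

variable {Q : Type*} {H : Q → Type*} [∀ q, NormedAddCommGroup (H q)]
  [∀ q, InnerProductSpace ℂ (H q)] [∀ q, CompleteSpace (H q)] [Fintype Q]

/-- In each of the finitely many blocks the finite-dimensional subspaces adapted to the finitely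
many elements are joined, and the projections onto the joins are added. -/
theorem exists_approximate_unit_projection {K : Type*} [Finite K]
    (a : K → CStarSumAlgebra fun q => CompactAlgebra (H q)) {δ : ℝ} (hδ : 0 < δ) :
    ∃ f : CStarSumAlgebra fun q => CompactAlgebra (H q), IsStarProjection f ∧
      ∀ k, ‖a k - f * a k‖ < δ := by
  choose U hU hUa using fun k q => exists_finiteDimensional_approx ((a k).component q) (half_pos hδ)
  have hfin : ∀ q, FiniteDimensional ℂ (⨆ k, U k q : Submodule ℂ (H q)) := fun q =>
    Submodule.finiteDimensional_iSup _
  set f : CStarSumAlgebra fun q => CompactAlgebra (H q) :=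
    ∑ q, sumSingle _ q (compactProjection (⨆ k, U k q)) with hf
  have hfq : ∀ q, f.component q = compactProjection (⨆ k, U k q) := by
    intro q
    rw [hf, ← sumComponent_apply, map_sum, Finset.sum_eq_single q]
    · rw [sumComponent_apply, sumSingle_component_same]
    · intro q' _ hq'
      rw [sumComponent_apply, sumSingle_component_of_ne hq'.symm]
    · exact fun h => absurd (Finset.mem_univ q) h
  refine ⟨f, ⟨CStarSumAlgebra.ext fun q => ?_, CStarSumAlgebra.ext fun q => ?_⟩, fun k => ?_⟩
  · rw [← sumComponent_apply, map_mul, sumComponent_apply, hfq]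
    exact compactInclusion_injective _ (by
      rw [map_mul]
      exact (isStarProjection_starProjection (U := ⨆ k, U k q)).isIdempotentElem)
  · rw [← sumComponent_apply, map_star, sumComponent_apply, hfq]
    exact compactInclusion_injective _ (by
      rw [map_star]
      exact (isStarProjection_starProjection (U := ⨆ k, U k q)).isSelfAdjoint)
  · refine (CStarSumAlgebra.norm_le (half_pos hδ).le fun q => ?_).trans_lt (half_lt_self hδ)
    rw [← sumComponent_apply, map_sub, map_mul, sumComponent_apply, sumComponent_apply, hfq]
    exact hUa k q _ (le_iSup (fun k => U k q) k)

variable {x : ∀ q, H q}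

/-- Subtracting the scalar part makes the statement hold on the whole of `K₀` of the unitization,
where it can be checked on generators. On `KZero` the subtracted term vanishes. -/
theorem exists_sub_scalarPart_eq_sum (hx : ∀ q, ‖x q‖ = 1)
    (y : KZeroUnital (Unitization ℂ (CStarSumAlgebra fun q => CompactAlgebra (H q)))) :
    ∃ a : Q → ℤ, y - KZeroUnital.map (scalarPart _) star_scalarPart y =
      ∑ q, a q • elementClass (blockRankOne q (x q) (x q)) := by
  induction y using KZeroUnital.induction with
  | h1 P =>
    obtain ⟨δ, hδ, h⟩ := exists_sub_scalarPart_eq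
      (A := CStarSumAlgebra fun q => CompactAlgebra (H q)) (Fin P.size)
    obtain ⟨f, hf, hfa⟩ := exists_approximate_unit_projection
      (fun k : Fin P.size × Fin P.size => (P.mat k.1 k.2).snd) hδ
    obtain ⟨p, q, hp, hq, h1⟩ := h P.mat P.isStarProjection f hf fun i j => hfa (i, j)
    obtain ⟨a, ha⟩ := exists_kClass_eq_sum hx hp
    obtain ⟨b, hb⟩ := exists_kClass_eq_sum hx hq
    refine ⟨a - b, ?_⟩
    rw [mk_eq_kClass, map_kClass _ _ P.isStarProjection, h1, ha, hb, ← Finset.sum_sub_distrib]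
    simp only [Pi.sub_apply, sub_smul]
  | hadd y z hy hz =>
    obtain ⟨a, ha⟩ := hy
    obtain ⟨b, hb⟩ := hz
    refine ⟨a + b, ?_⟩
    rw [map_add, add_sub_add_comm, ha, hb, ← Finset.sum_add_distrib]
    simp only [Pi.add_apply, add_smul]
  | hneg y hy =>
    obtain ⟨a, ha⟩ := hy
    refine ⟨-a, ?_⟩
    rw [map_neg, neg_sub_neg, ← neg_sub, ha, ← Finset.sum_neg_distrib]
    simp only [Pi.neg_apply, neg_smul]
  | h0 => exact ⟨0, by simp⟩

theorem sum_zsmul_elementClass_mem (hx : ∀ q, ‖x q‖ = 1) (a : Q → ℤ) :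
    ∑ q, a q • elementClass (blockRankOne q (x q) (x q)) ∈
      KZero (CStarSumAlgebra fun q => CompactAlgebra (H q)) := by
  refine sum_mem fun q _ => zsmul_mem ?_ _
  rw [← KZero.coe_mk (isStarProjection_blockRankOne q (hx q))]
  exact (KZero.mk _ _).2

/-- The basis of `K₀` of a finite direct sum of algebras of compact operators given by the rank one
projections. -/
def rankOneClasses (hx : ∀ q, ‖x q‖ = 1) :
    (Q → ℤ) →+ KZero (CStarSumAlgebra fun q => CompactAlgebra (H q)) where
  toFun a := ⟨_, sum_zsmul_elementClass_mem hx a⟩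
  map_zero' := Subtype.ext (by simp)
  map_add' a b := Subtype.ext (by simp [add_smul, Finset.sum_add_distrib])

theorem rankOneClasses_bijective (hx : ∀ q, ‖x q‖ = 1) :
    Function.Bijective (rankOneClasses hx) := by
  constructor
  · refine (injective_iff_map_eq_zero _).2 fun a ha => ?_
    exact eq_zero_of_sum_zsmul_elementClass_eq_zero hx (congrArg Subtype.val ha)
  · intro y
    obtain ⟨a, ha⟩ := exists_sub_scalarPart_eq_sum hx y.1
    refine ⟨a, Subtype.ext ?_⟩
    rw [map_scalarPart_eq_zero y.2, sub_zero] at ha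
    exact ha.symm

/-- The generation clause is kept because it is used to compare the maps on `K₀` induced by
different isomorphisms. -/
theorem exists_blockRankEquiv (hx : ∀ q, ‖x q‖ = 1) :
    ∃ θ : KZero (CStarSumAlgebra fun q => CompactAlgebra (H q)) ≃+ (Q → ℤ),
      (∀ p (hp : IsStarProjection p) q,
        θ (KZero.mk p hp) q = Module.finrank ℂ (p.component q).toOperator.range) ∧
      ∀ y, y ∈ AddSubgroup.closure (Set.range fun q =>
        KZero.mk _ (isStarProjection_blockRankOne q (hx q))) := by
  set e := AddEquiv.ofBijective (rankOneClasses hx) (rankOneClasses_bijective hx) with he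
  refine ⟨e.symm, fun p hp q => ?_, fun y => ?_⟩
  · have h1 : KZero.mk p hp = e fun q => Module.finrank ℂ (p.component q).toOperator.range :=
      Subtype.ext ((KZero.coe_mk hp).trans (elementClass_eq_sum hx hp))
    rw [h1, e.symm_apply_apply]
  · obtain ⟨a, rfl⟩ := e.surjective y
    have h1 : e a = ∑ q, a q • KZero.mk _ (isStarProjection_blockRankOne q (hx q)) := by
      refine Subtype.ext ?_
      rw [AddSubgroup.val_finsetSum]
      refine Finset.sum_congr rfl fun q _ => ?_
      rw [AddSubgroup.coe_zsmul, KZero.coe_mk]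
    rw [h1]
    exact sum_mem fun q _ => zsmul_mem
      (AddSubgroup.subset_closure (Set.mem_range_self (f := fun q =>
        KZero.mk _ (isStarProjection_blockRankOne q (hx q))) q)) _

end BlockKTheory
end

noncomputable section

/-! ## `K₀` of the block algebra and formal characters -/

section FormalCharacters

universe u

variable {ι V : Type*} {W : Type u} [AddCommGroup V] [Module ℝ V] [AddCommGroup W]
  [Module ℝ W] (P : RootPairing ι ℝ V W) [Fintype ι]
  [P.IsCrystallographic] [P.IsReduced] [P.IsIrreducible] (ℓ : ℤ)

/-- Functions on the set of cosets as invariant formal characters. -/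
def cosetCharacters : (LevelQuotient P ℓ → ℤ) →+ InvariantFormalCharacters P ℓ where
  toFun a := ⟨fun ξ => a ξ, fun ξ η => congrArg a (levelQuotient_add ξ η)⟩
  map_zero' := rfl
  map_add' _ _ := rfl

theorem cosetCharacters_bijective : Function.Bijective (cosetCharacters P ℓ) := by
  constructor
  · intro a b h
    funext q
    obtain ⟨ξ, rfl⟩ := QuotientAddGroup.mk_surjective q
    exact congrFun (congrArg Subtype.val h) ξ
  · intro a
    refine ⟨fun q => a.1 q.out, Subtype.ext (funext fun ξ => ?_)⟩
    obtain ⟨η, hη⟩ := exists_eq_add_of_levelQuotient_eq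
      (QuotientAddGroup.out_eq' (ξ : LevelQuotient P ℓ))
    change a.1 (ξ : LevelQuotient P ℓ).out = a.1 ξ
    rw [hη]
    exact a.2 ξ η

variable {P ℓ}

open Classical in
theorem blockUnit_zero_eq (q : LevelQuotient P ℓ) (μ : WeightLattice P)
    (h : (μ : LevelQuotient P ℓ) = q) : blockUnit ℓ μ 0 =
      blockRankOne q (lp.single 2 ⟨μ, h⟩ 1 : CosetL2 q) (lp.single 2 ⟨μ, h⟩ 1 : CosetL2 q) := by
  subst h
  have h1 : cosetShift (μ : LevelQuotient P ℓ) 0 ⟨μ, rfl⟩ = ⟨μ, rfl⟩ :=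
    Subtype.ext (by simp [cosetShift])
  rw [blockUnit, h1]
  rfl

/-- The generators are stated as the block units of trivial shift: these are the images of the
weight projections under every trivialization. -/
theorem exists_formalCharacterEquiv [P.IsRootSystem] {r : ℕ}
    (β : Module.Basis (Fin r) ℤ (IntegralLattice P)) (h0 : ℓ ≠ 0) :
    ∃ θ : KZero (BlockAlgebra P ℓ) ≃+ InvariantFormalCharacters P ℓ,
      (∀ p (hp : IsStarProjection p) (ξ : WeightLattice P), (θ (KZero.mk p hp)).1 ξ =
        Module.finrank ℂ (blockComponent p (ξ : LevelQuotient P ℓ)).range) ∧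
      ∀ y, y ∈ AddSubgroup.closure {y | ∃ (μ : WeightLattice P)
        (hp : IsStarProjection (blockUnit (P := P) ℓ μ 0)), y = KZero.mk (blockUnit ℓ μ 0) hp} := by
  classical
  have _ := finite_levelQuotient P β h0
  have _ := Fintype.ofFinite (LevelQuotient P ℓ)
  let x : ∀ q : LevelQuotient P ℓ, CosetL2 q := fun q =>
    lp.single 2 ⟨q.out, QuotientAddGroup.out_eq' q⟩ 1
  have hx : ∀ q, ‖x q‖ = 1 := fun q => by
    rw [lp.norm_single (by norm_num), norm_one]
  obtain ⟨θ, h1, h2⟩ := exists_blockRankEquiv (H := fun q : LevelQuotient P ℓ => CosetL2 q) hx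
  have h3 : ∀ q, blockUnit ℓ q.out 0 = blockRankOne q (x q) (x q) := fun q =>
    blockUnit_zero_eq q q.out (QuotientAddGroup.out_eq' q)
  clear_value x
  refine ⟨θ.trans (AddEquiv.ofBijective _ (cosetCharacters_bijective P ℓ)), ?_, ?_⟩
  · intro p hp ξ
    exact h1 p hp ξ
  · intro y
    refine AddSubgroup.closure_mono ?_ (h2 y)
    rintro _ ⟨q, rfl⟩
    have h4 : IsStarProjection (blockUnit (P := P) ℓ q.out 0) := by
      rw [h3]
      exact isStarProjection_blockRankOne q (hx q)
    exact ⟨q.out, h4, KZero.mk_congr (h3 q).symm _ _⟩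

end FormalCharacters

/-! ## Independence of the trivialization -/

section Independence

universe u

variable {ι V : Type*} {W : Type u} [AddCommGroup V] [Module ℝ V] [AddCommGroup W]
  [Module ℝ W] {P : RootPairing ι ℝ V W} [Fintype ι]
  [P.IsCrystallographic] [P.IsReduced] [P.IsIrreducible] {k ℓ : ℤ}

/-- With zero shift the wave function and the volume that normalises it involve only the identity
sheet, where the two isomorphisms agree. -/
theorem waveElt_zero_congr {G : Type u} [Group G] [TopologicalSpace G]
    [IsTopologicalGroup G] [LocallyCompactSpace G] [MeasurableSpace G] [BorelSpace G]
    {Φ Ψ : G ≃ₜ* TorusExt P 0 k} {c : Circle →* G}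
    (hΦ : ∀ z, Φ (c z) = TorusExt.central z) (hΨ : ∀ z, Ψ (c z) = TorusExt.central z)
    (h : ∀ g, (Φ g).lattice = 0 → Ψ g = Φ g) (h' : ∀ g, (Ψ g).lattice = 0 → Φ g = Ψ g)
    (n : ℤ) (ξ : WeightLattice P) : waveElt Φ hΦ n ξ 0 = waveElt Ψ hΨ n ξ 0 := by
  have h1 : wave Φ n ξ 0 = wave Ψ n ξ 0 := by
    ext g
    by_cases hg : (Φ g).lattice = 0
    · rw [wave_of_mem Φ n ξ hg, wave_of_mem Ψ n ξ (by rw [h g hg, hg]), h g hg]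
    · rw [wave_of_notMem Φ n ξ hg, wave_of_notMem Ψ n ξ fun hg' => hg (by rw [h' g hg', hg'])]
  have h2 : sheetVolume Φ = sheetVolume Ψ := by
    refine congrArg (Measure.haar : Measure G).real (Set.ext fun g => ⟨fun hg => ?_, fun hg => ?_⟩)
    · change (Ψ g).lattice = 0
      rw [h g hg]; exact hg
    · change (Φ g).lattice = 0
      rw [h' g hg]; exact hg
  simp only [waveElt, h1, h2]

theorem apply_eq_of_lattice_eq_zero {ε : LinearMap.BilinForm ℤ (IntegralLattice P)}
    {Φ : TorusExt P ε k ≃ₜ* TorusExt P 0 k} (hc : ∀ z, Φ (TorusExt.central z) = TorusExt.central z)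
    (ht : ∀ t : MaximalTorus P, Φ ⟨t, 0, 1⟩ = ⟨t, 0, 1⟩) (t : MaximalTorus P) (z : Circle) :
    Φ ⟨t, 0, z⟩ = ⟨t, 0, z⟩ := by
  have h : ∀ ε' : LinearMap.BilinForm ℤ (IntegralLattice P),
      (⟨t, 0, z⟩ : TorusExt P ε' k) = ⟨t, 0, 1⟩ * TorusExt.central z := fun ε' => by
    simp [TorusExt.central, TorusExt.mul_def, TorusExt.kappa_zero]
  rw [h, map_mul, hc, ht, ← h]

/-- The identity sheet is the product of T and the central circle, both of which are fixed by `Φ`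
and `Ψ`. -/
theorem apply_eq_apply_of_lattice_eq_zero {ε : LinearMap.BilinForm ℤ (IntegralLattice P)}
    {Φ Ψ : TorusExt P ε k ≃ₜ* TorusExt P 0 k}
    (hΦ : ∀ z, Φ (TorusExt.central z) = TorusExt.central z)
    (hΦt : ∀ t : MaximalTorus P, Φ ⟨t, 0, 1⟩ = ⟨t, 0, 1⟩)
    (hΨ : ∀ z, Ψ (TorusExt.central z) = TorusExt.central z)
    (hΨt : ∀ t : MaximalTorus P, Ψ ⟨t, 0, 1⟩ = ⟨t, 0, 1⟩) (g : TorusExt P ε k)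
    (hg : (Φ g).lattice = 0) : Ψ g = Φ g := by
  have h1 : g = ⟨(Φ g).torus, 0, (Φ g).phase⟩ := by
    refine Φ.injective ?_
    rw [apply_eq_of_lattice_eq_zero hΦ hΦt]
    exact TorusExt.ext rfl hg rfl
  have h2 := apply_eq_of_lattice_eq_zero hΨ hΨt (Φ g).torus (Φ g).phase
  rw [← h1] at h2
  rw [h2]
  exact TorusExt.ext rfl hg.symm rfl

open Classical in
theorem isDeterminedBy_of_eq_schrodingerEval {ε : LinearMap.BilinForm ℤ (IntegralLattice P)}
    {n : ℤ} (hℓ : k * n = ℓ) (Φ : TorusExt P ε k ≃ₜ* TorusExt P 0 k)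
    {φ : HomogAlgebra (TorusExt.central (P := P) (ε := ε) (k := k)) n ≃⋆ₐ[ℂ] BlockAlgebra P ℓ}
    (h : ∀ a q, blockComponent (φ a) q = schrodingerEval Φ hℓ q (homogInclusion _ n a)) :
    IsDeterminedBy Φ φ := by
  intro f hf q μ ν
  rw [h]
  exact schrodingerEval_universalRep Φ hℓ q f μ ν

/-- `K₀` of the twisted group algebra, independently of the trivialization. -/
theorem exists_twistedKZeroEquiv [P.IsRootSystem] {r : ℕ}
    (β : Module.Basis (Fin r) ℤ (IntegralLattice P))
    (ε : LinearMap.BilinForm ℤ (IntegralLattice P)) (h0 : ℓ ≠ 0) :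
    ∃ θ : KZero (HomogAlgebra (TorusExt.central (P := P) (ε := ε) (k := ℓ)) 1) ≃+
        InvariantFormalCharacters P ℓ,
      ∀ Φ : TorusExt P ε ℓ ≃ₜ* TorusExt P 0 ℓ,
        (∀ z, Φ (TorusExt.central z) = TorusExt.central z) →
        (∀ t : MaximalTorus P, Φ ⟨t, 0, 1⟩ = ⟨t, 0, 1⟩) →
        ∃ φ : HomogAlgebra (TorusExt.central (P := P) (ε := ε) (k := ℓ)) 1 ≃⋆ₐ[ℂ]
            BlockAlgebra P ℓ,
          IsDeterminedBy Φ φ ∧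
          ∀ p (hp : IsStarProjection p) (ξ : WeightLattice P),
            (θ (KZero.mk p hp)).1 ξ =
              Module.finrank ℂ (blockComponent (φ p) (ξ : LevelQuotient P ℓ)).range := by
  obtain ⟨θ, hθ, hgen⟩ := exists_formalCharacterEquiv β h0
  obtain ⟨ψ, -, hψw⟩ := exists_blockIso (untwist P β ε ℓ) (mul_one ℓ) h0 (untwist_central P β ε ℓ)
  refine ⟨(kZeroCongr ψ).trans θ, fun Φ hΦ hΦt => ?_⟩
  obtain ⟨φ, hφ, hφw⟩ := exists_blockIso Φ (mul_one ℓ) h0 hΦ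
  refine ⟨φ, isDeterminedBy_of_eq_schrodingerEval (mul_one ℓ) Φ hφ, fun p hp ξ => ?_⟩
  -- The map `θ` was built from `untwist`. The isomorphism for another `Φ` agrees with it on the
  -- weight projections, whose classes generate `K₀`, so both give the same map on `K₀`.
  have hw : ∀ μ, φ (ψ.symm (blockUnit ℓ μ 0)) = blockUnit ℓ μ 0 := by
    intro μ
    rw [← hψw, ψ.symm_apply_apply, hψw, ← hφw]
    refine congrArg φ (waveElt_zero_congr _ _
      (apply_eq_apply_of_lattice_eq_zero (untwist_central P β ε ℓ) (untwist_torus P β ε ℓ) hΦ hΦt)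
      (apply_eq_apply_of_lattice_eq_zero hΦ hΦt (untwist_central P β ε ℓ) (untwist_torus P β ε ℓ))
      1 μ)
  have h2 : kZeroCongr φ (KZero.mk p hp) = kZeroCongr ψ (KZero.mk p hp) :=
    kZeroCongr_eq_of_generates hgen hw _
  change (θ (kZeroCongr ψ (KZero.mk p hp))).1 ξ = _
  rw [← h2, kZeroCongr_mk, hθ]

end Independence
end

/-! ### The main theorem -/

theorem mainTheorem10 {ι V W : Type*} [Fintype ι] [AddCommGroup V] [Module ℝ V] [AddCommGroup W]
    [Module ℝ W] (P : RootPairing ι ℝ V W) [P.IsRootSystem] [P.IsCrystallographic] [P.IsReduced]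
    [P.IsIrreducible] {r : ℕ} (β : Module.Basis (Fin r) ℤ (IntegralLattice P)) :
    -- `C*(T ⋉ Π^bas)` is the direct sum of its homogeneous ideals
    ((∀ n : ℤ,
        (HomogIdeal (TorusExt.central (P := P) (ε := epsilonForm P β) (k := 1)) n : Set _) =
          closure (universalRep ''
            {f | IsHomogeneous (TorusExt.central (P := P) (ε := epsilonForm P β) (k := 1)) n f}) ∧
        HomogIdeal (TorusExt.central (P := P) (ε := epsilonForm P β) (k := 1)) n ≤
          GroupCStar (TorusExt P (epsilonForm P β) 1) ∧
        ∀ a ∈ GroupCStar (TorusExt P (epsilonForm P β) 1),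
          ∀ x ∈ HomogIdeal (TorusExt.central (P := P) (ε := epsilonForm P β) (k := 1)) n,
            a * x ∈ HomogIdeal (TorusExt.central (P := P) (ε := epsilonForm P β) (k := 1)) n ∧
            x * a ∈ HomogIdeal (TorusExt.central (P := P) (ε := epsilonForm P β) (k := 1)) n) ∧
      ∃ Θ : CStarSumAlgebra (fun n : ℤ =>
            HomogAlgebra (TorusExt.central (P := P) (ε := epsilonForm P β) (k := 1)) n) ≃⋆ₐ[ℂ]
          GroupCStarAlgebra (TorusExt P (epsilonForm P β) 1),
        ∀ x n, (∀ m, m ≠ n → x.component m = 0) →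
          (Θ x).toOperators = (x.component n).toOperators) ∧
    -- group isomorphisms of the central extensions exist
    (∀ k : ℤ, ∃ Φ : TorusExt P (epsilonForm P β) k ≃ₜ* TorusExt P 0 k,
      (∀ z, Φ (TorusExt.central z) = TorusExt.central z) ∧
      ∀ t : MaximalTorus P, Φ ⟨t, 0, 1⟩ = ⟨t, 0, 1⟩) ∧
    -- each of them determines isomorphisms of the homogeneous ideals
    (∀ Φ : TorusExt P (epsilonForm P β) 1 ≃ₜ* TorusExt P 0 1,
      (∀ z, Φ (TorusExt.central z) = TorusExt.central z) →
      (∃ φ : HomogAlgebra (TorusExt.central (P := P) (ε := epsilonForm P β) (k := 1)) 0 ≃⋆ₐ[ℂ]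
            C₀(WeightLattice P × DualTorus P, ℂ),
        ∀ (f : C_c(TorusExt P (epsilonForm P β) 1, ℂ)) (hf : IsHomogeneous TorusExt.central 0 f)
          (ξ : WeightLattice P) (χ : DualTorus P),
          φ (homogeneousElement TorusExt.central 0 f hf) (ξ, χ) =
            ∫ g, f g * (((Φ g).torus.pow ξ * χ (Multiplicative.ofAdd (Φ g).lattice) : Circle) : ℂ)
              ∂Measure.haar) ∧
      ∀ ℓ : ℤ, ℓ ≠ 0 →
        ∃ φ : HomogAlgebra (TorusExt.central (P := P) (ε := epsilonForm P β) (k := 1)) ℓ ≃⋆ₐ[ℂ]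
            BlockAlgebra P ℓ,
          IsDeterminedBy Φ φ) ∧
    -- the K-theory of `C*_τ(T × Π)`, where `τ` is `ℓ` times the basic central extension
    ∀ ℓ : ℤ, ℓ ≠ 0 →
      ∃ θ : KZero (HomogAlgebra (TorusExt.central (P := P) (ε := epsilonForm P β) (k := ℓ)) 1) ≃+
          InvariantFormalCharacters P ℓ,
        ∀ Φ : TorusExt P (epsilonForm P β) ℓ ≃ₜ* TorusExt P 0 ℓ,
          (∀ z, Φ (TorusExt.central z) = TorusExt.central z) →
          (∀ t : MaximalTorus P, Φ ⟨t, 0, 1⟩ = ⟨t, 0, 1⟩) →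
          ∃ φ : HomogAlgebra (TorusExt.central (P := P) (ε := epsilonForm P β) (k := ℓ)) 1 ≃⋆ₐ[ℂ]
              BlockAlgebra P ℓ,
            IsDeterminedBy Φ φ ∧
            ∀ p (hp : IsStarProjection p) (ξ : WeightLattice P),
              (θ (KZero.mk p hp)).1 ξ =
                Module.finrank ℂ (blockComponent (φ p) (ξ : LevelQuotient P ℓ)).range := by
  -- The clauses on the ideals mention no trivialization; this one serves to prove them.
  set Φ₁ := untwist P β (epsilonForm P β) 1
  have hc := untwist_central P β (epsilonForm P β) 1
  refine ⟨⟨fun n => ⟨?_, homogIdeal_le_groupCStar Φ₁ hc n, fun a ha x hx =>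
    ⟨groupCStar_mul_homogIdeal Φ₁ hc n ha hx, homogIdeal_mul_groupCStar Φ₁ hc n ha hx⟩⟩,
    exists_homogeneous_decomposition Φ₁ hc⟩,
    fun k => ⟨untwist P β (epsilonForm P β) k, untwist_central P β _ k, untwist_torus P β _ k⟩,
    fun Φ hΦ => ⟨?_, fun ℓ h0 => ?_⟩, fun ℓ h0 => exists_twistedKZeroEquiv β _ h0⟩
  · exact (homogIdeal_eq_closure Φ₁ hc n).trans (closure_homogeneous_eq Φ₁ hc n).symm
  · obtain ⟨φ, hφ⟩ := exists_weightZeroIso Φ hΦ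
    refine ⟨φ, fun f hf ξ χ => ?_⟩
    rw [hφ]
    exact characterEval_universalRep Φ ξ χ f
  -- Only the product k n = ℓ matters for the blocks. Here k = 1 and n = ℓ, while the K-theory
  -- clause takes k = ℓ and n = 1.
  · obtain ⟨φ, hφ, -⟩ := exists_blockIso Φ (one_mul ℓ) h0 hΦ
    exact ⟨φ, isDeterminedBy_of_eq_schrodingerEval (one_mul ℓ) Φ hφ⟩
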